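/- **Theorem (general complex universality).** Notation and conventions. $B(z,r)$ is the open disk in $\mathbb{C}$; $n$ is a positive integer or $\infty$; $\phi_1,\dots,\phi_n:\mathbb{C}\to\mathbb{C}$ are deterministic functions; $0<\delta_n<1$; $D_n\subset\mathbb{C}$ is any set. Zeros are counted with multiplicity, and a function that is analytic and vanishes identically on a disk is regarded as having no zeros there. For coefficients $\xi_1,\dots,\xi_n$ put $F_n=\sum_{i=1}^n\xi_i\phi_i$ and for $\tilde\xi_1,\dots,\tilde\xi_n$ put $\tilde F_n=\sum_{i=1}^n\tilde\xi_i\phi_i$ (a limit of partial sums if $n=\infty$). *Condition C1* with constants $N_0,\tau>0$, $0<\varepsilon<1$. (i) The $\xi_i$ are independent real or complex random variables with $\mathbb{E}|\xi_i-\mathbb{E}\xi_i|^2=1$ and $\mathbb{E}|\xi_i-\mathbb{E}\xi_i|^{2+\varepsilon}\le\tau$, and the same holds for the $\tilde\xi_i$. (ii) For $i\ge N_0$ and all $a,b\in\{0,1,2\}$ with $a+b\le2$, $\mathbb{E}\,\mathrm{Re}(\xi_i)^a\,\mathrm{Im}(\xi_i)^b=\mathbb{E}\,\mathrm{Re}(\tilde\xi_i)^a\,\mathrm{Im}(\tilde\xi_i)^b$;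 for $i<N_0$, $|\mathbb{E}\xi_i-\mathbb{E}\tilde\xi_i|\le\tau$. *Condition C2(1)–(4)* for $F_n$ with positive parameters $(k,C_1,\alpha_1,A,c_1,C)$. (1) For every $z\in D_n$, almost surely $F_n$ is analytic on $B(z,2)$ (for $n=\infty$ the series converges at every point there), and $\mathbb{E}\,N^{k+2}\mathbf 1_{N\ge\delta_n^{-C_1}}\le C$, where $N$ is the number of zeros of $F_n$ in $B(z,1)$. (2) For every $z\in D_n$, with probability at least $1-C\delta_n^A$ there is $z'\in B(z,1/100)$ with $|F_n(z')|\ge\exp(-\delta_n^{-c_1})$. (3) For every $z\in D_n$, with probability at least $1-C\delta_n^A$, $|F_n(w)|\le\exp(\delta_n^{-c_1})$ for all $w\in B(z,2)$. (4) For every $z\in D_n+B(0,1)$, $\sum_{j=1}^n|\phi_j(z)|^2<\infty$ and $|\phi_i(z)|\le C\delta_n^{\alpha_1}\big(\sum_{j=1}^n|\phi_j(z)|^2\big)^{1/2}$ for every $1\le i\le n$. *Statement.* Let $N_0,\tau>0$, $0<\varepsilon<1$, $\alpha_1,C_1,C>0$ and let $k\ge1$ be an integer. Set $A=2kC_1+\frac{\alpha_1\varepsilon}{60}$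 and $c_1=\frac{\alpha_1\varepsilon}{10^5k^2}$. There exist $C',c>0$ depending only on $N_0,\tau,\varepsilon,\alpha_1,C_1,C,k$ (and not on $n,\delta_n,D_n$, the $\phi_i$ or the random variables) such that the following holds. Assume that $(\xi_i),(\tilde\xi_i)$ satisfy C1 with constants $N_0,\tau,\varepsilon$, and that $F_n$ and $\tilde F_n$ both satisfy C2(1)–(4) with parameters $(k,C_1,\alpha_1,A,c_1,C)$. Let $z_1,\dots,z_k\in D_n$, and let $G:\mathbb{C}^k\to\mathbb{C}$ vanish outside $\prod_{i=1}^kB(z_i,1/100)$, have continuous derivatives up to order $2k+4$ in the $2k$ real coordinates, and be such that all partial derivatives of $\mathrm{Re}\,G$ and $\mathrm{Im}\,G$ of every order $0\le a\le2k+4$ are bounded by $1$ in absolute value. Then $\sum G(\zeta_{i_1},\dots,\zeta_{i_k})$ and $\sum G(\tilde\zeta_{i_1},\dots,\tilde\zeta_{i_k})$ are integrable, and $$\Big|\mathbb{E}\sum G(\zeta_{i_1},\dots,\zeta_{i_k})-\mathbb{E}\sum G(\tilde\zeta_{i_1},\dots,\tilde\zeta_{i_k})\Big|\le C'\delta_n^{c},$$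 where the sums run over all $k$-tuples (repetitions of indices allowed) of the zeros $\zeta_1,\zeta_2,\dots$ of $F_n$, respectively $\tilde\zeta_1,\tilde\zeta_2,\dots$ of $\tilde F_n$. -/

import Mathlib

open MeasureTheory ProbabilityTheory Filter Topology
open scoped ENNReal Pointwise

universe u v

noncomputable section

namespace RandomRoots

/-- The index set `{1, …, n}`, for `n` a natural number or `∞`. -/
def idx (n : ℕ∞) : Set ℕ := {i | 1 ≤ i ∧ (i : ℕ∞) ≤ n}

open scoped Classical in
/-- The partial sum of `∑ ξᵢ φᵢ(w)` over the indices `1 ≤ i ≤ N` that belong to `{1, …, n}`. -/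
def partialSum {Ω : Type*} (n : ℕ∞) (ξ : ℕ → Ω → ℂ) (φ : ℕ → ℂ → ℂ) (ω : Ω) (w : ℂ) (N : ℕ) : ℂ :=
  ∑ i ∈ (Finset.range (N + 1)).filter (fun i => i ∈ idx n), ξ i ω * φ i w

/-- The (finite or infinite) sum `∑ ξᵢ φᵢ(w)` converges, as a limit of partial sums. This is
automatic when `n` is finite. -/
def SeriesConverges {Ω : Type*} (n : ℕ∞) (ξ : ℕ → Ω → ℂ) (φ : ℕ → ℂ → ℂ) (ω : Ω) (w : ℂ) : Prop :=
  ∃ l : ℂ, Tendsto (partialSum n ξ φ ω w) atTop (𝓝 l)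

/-- The random function `F_n = ∑_{i=1}^n ξᵢ φᵢ`, the limit of the partial sums (for finite `n` they
are eventually constant). It is only ever used where the series converges almost surely. -/
def randomFun {Ω : Type*} (n : ℕ∞) (ξ : ℕ → Ω → ℂ) (φ : ℕ → ℂ → ℂ) (ω : Ω) (w : ℂ) : ℂ :=
  limUnder atTop (partialSum n ξ φ ω w)

/-- The number of zeros of `f` in the open disk `B(z, r)`, counted with multiplicity. By convention
a point near which `f` vanishes identically is not counted as a zero; so the count is `0` if `f`
is analytic on a disk containing `B(z, r)` and vanishes identically there. -/
def zeroCount (f : ℂ → ℂ) (z : ℂ) (r : ℝ) : ℝ≥0∞ :=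
  ∑' w : Metric.ball z r, (analyticOrderNatAt f (w : ℂ) : ℝ≥0∞)

/-- The sum of `G (ζ_{i₁}, …, ζ_{iₖ})` over all `k`-tuples of zeros `ζ₁, ζ₂, …` of `f`, where each
zero is listed as often as its multiplicity, and the indices may repeat. A `k`-tuple of points
`w` is hit by `∏ⱼ mult (wⱼ)` tuples of indices. As in `zeroCount`, points near which `f` vanishes
identically do not contribute. -/
def rootSum {k : ℕ} (f : ℂ → ℂ) (G : (Fin k → ℂ) → ℂ) : ℂ :=
  ∑ᶠ w : Fin k → ℂ, (∏ j, (analyticOrderNatAt f (w j) : ℂ)) * G w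

/-- The standard real basis vectors of `ℂᵏ`: `coordVec (j, false)` is the direction of `Re w_j`,
`coordVec (j, true)` that of `Im w_j`. -/
def coordVec {k : ℕ} (p : Fin k × Bool) : Fin k → ℂ :=
  Pi.single p.1 (if p.2 then Complex.I else 1)

/-- `‖∇ᵃ G‖_∞`: the supremum of the absolute values of all partial derivatives of total order `a`,
with respect to the `2k` real coordinates, of the real part and of the imaginary part of `G`. -/
def gradSup {k : ℕ} (a : ℕ) (G : (Fin k → ℂ) → ℂ) : ℝ≥0∞ :=
  ⨆ (x : Fin k → ℂ) (p : Fin a → Fin k × Bool),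
    max ‖iteratedFDeriv ℝ a (fun w => (G w).re) x (fun m => coordVec (p m))‖ₑ
      ‖iteratedFDeriv ℝ a (fun w => (G w).im) x (fun m => coordVec (p m))‖ₑ

/-- The coefficients `ξ₁, …, ξₙ` are independent complex (possibly real) random variables with unit
variance `𝔼|ξᵢ - 𝔼ξᵢ|² = 1` and central moments of order `2 + ε` bounded by `τ`. -/
structure BoundedCentralMoments {Ω : Type*} [MeasurableSpace Ω] (P : Measure Ω) (n : ℕ∞)
    (ξ : ℕ → Ω → ℂ) (τ ε : ℝ) : Prop where
  measurable : ∀ i ∈ idx n, Measurable (ξ i)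
  indep : iIndepFun (fun i : idx n => ξ i) P
  memLp_two : ∀ i ∈ idx n, MemLp (ξ i) 2 P
  unit_variance : ∀ i ∈ idx n, ∫ ω, ‖ξ i ω - ∫ ω', ξ i ω' ∂P‖ ^ 2 ∂P = 1
  moment : ∀ i ∈ idx n,
    ∫⁻ ω, ‖ξ i ω - ∫ ω', ξ i ω' ∂P‖ₑ ^ (2 + ε) ∂P ≤ ENNReal.ofReal τ

/-- The moment condition on two coefficient sequences: both have bounded `(2 + ε)` central moments,
and their moments match up to second order, with exceptions for the indices below `N₀`. -/
structure ConditionC1 {Ω Ω' : Type*} [MeasurableSpace Ω] [MeasurableSpace Ω']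
    (P : Measure Ω) (P' : Measure Ω') (n : ℕ∞) (ξ : ℕ → Ω → ℂ) (ξ' : ℕ → Ω' → ℂ)
    (N₀ : ℕ) (τ ε : ℝ) : Prop where
  left : BoundedCentralMoments P n ξ τ ε
  right : BoundedCentralMoments P' n ξ' τ ε
  matching : ∀ i ∈ idx n, N₀ ≤ i → ∀ a b : ℕ, a + b ≤ 2 →
    ∫ ω, (ξ i ω).re ^ a * (ξ i ω).im ^ b ∂P = ∫ ω, (ξ' i ω).re ^ a * (ξ' i ω).im ^ b ∂P'
  exceptions : ∀ i ∈ idx n, i < N₀ → ‖(∫ ω, ξ i ω ∂P) - ∫ ω, ξ' i ω ∂P'‖ ≤ τ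

/-- The conditions on the random function `F_n = ∑ ξᵢ φᵢ` (those that concern complex roots: root
count, anti-concentration, boundedness and delocalization), with error parameter `δ`, region `D`
and parameters `(k, C₁, α₁, A, c₁, C)`. All disks are open. -/
structure ConditionC2 {Ω : Type*} [MeasurableSpace Ω] (P : Measure Ω) (n : ℕ∞)
    (ξ : ℕ → Ω → ℂ) (φ : ℕ → ℂ → ℂ) (δ : ℝ) (D : Set ℂ)
    (k : ℕ) (C₁ α₁ A c₁ C : ℝ) : Prop where
  analytic : ∀ z ∈ D, ∀ᵐ ω ∂P,
    (∀ w ∈ Metric.ball z 2, SeriesConverges n ξ φ ω w) ∧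
      AnalyticOnNhd ℂ (randomFun n ξ φ ω) (Metric.ball z 2)
  /-- `𝔼 N^{k+2} 1_{N ≥ δ^{-C₁}} ≤ C`, where `N` is the number of zeros in `B(z, 1)`. -/
  rootCount : ∀ z ∈ D,
    ∫⁻ ω, ({ω | ENNReal.ofReal (δ ^ (-C₁)) ≤ zeroCount (randomFun n ξ φ ω) z 1}.indicator
      (fun ω => zeroCount (randomFun n ξ φ ω) z 1 ^ (k + 2)) ω) ∂P ≤ ENNReal.ofReal C
  /-- Probability at least `1 - C δ^A`, written through the complementary event. -/
  antiConcentration : ∀ z ∈ D,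
    P {ω | ¬ ∃ z' ∈ Metric.ball z (1 / 100),
      Real.exp (-δ ^ (-c₁)) ≤ ‖randomFun n ξ φ ω z'‖} ≤ ENNReal.ofReal (C * δ ^ A)
  bounded : ∀ z ∈ D,
    P {ω | ¬ ∀ w ∈ Metric.ball z 2,
      ‖randomFun n ξ φ ω w‖ ≤ Real.exp (δ ^ (-c₁))} ≤ ENNReal.ofReal (C * δ ^ A)
  /-- Written without division, so that it also makes sense at a common zero of all the `φⱼ`. When
  `n = ∞` the finiteness of the sum is part of the meaning of the quotient. -/
  delocalization : ∀ z ∈ D + Metric.ball (0 : ℂ) 1,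
    Summable (fun j : idx n => ‖φ j z‖ ^ 2) ∧
      ∀ i ∈ idx n, ‖φ i z‖ ≤ C * δ ^ α₁ * √(∑' j : idx n, ‖φ j z‖ ^ 2)

end RandomRoots

end

/-!
Universality of the correlation functions of complex zeros.

By Green's formula, `log ‖f‖` is a fundamental solution for the zeros of an analytic function `f`:
summing a test function over the zeros is integrating its Laplacian against `(2π)⁻¹ log ‖f‖`.
Applied in each of the `k` coordinates this expresses the sum of `G` over `k`-tuples of zeros as the
integral of the iterated Laplacian of `G` against `∏ⱼ log ‖f (wⱼ)‖` (`rootSum_eq_integral`), which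
turns the statement into a comparison of `𝔼 ∏ⱼ log ‖F (wⱼ)‖` for the two random functions, averaged
over `w`. By Fubini's theorem the comparison can be made for each `w` separately.

The logarithm is unbounded in both directions and singular at zero. With probability close to one,
`F` is at most `exp Q` on the disks and at least `exp (-Q)` somewhere near the centres, where
`Q = δ ^ (-c₁)`. Dividing out the zeros near the centre, whose number the maximum principle bounds,
and applying the Borel–Carathéodory inequality to the logarithm of the quotient, one gets
`∫ |log ‖F‖| ^ p ≤ B Q ^ p` on the small disks for each `p` (`exists_integral_abs_log_pow_le`). So
clipping the logarithms at `M = Q ^ 4` costs little (`norm_integral_prod_log_sub_prod_clipLog_le`).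
On the exceptional event the sum over the zeros is controlled by the moments of the number of zeros
(`integrable_rootSum_and_norm_sub_le`); the exponent `A` exceeds `k C₁` for this purpose.

At fixed points `w`, the clipped logarithm is replaced by a function `truncLog` that is smooth
at the scale `r √(∑ᵢ ‖φᵢ (wⱼ)‖²)`, with `r` a small power of `δ`. The two differ only if `F (wⱼ)`
is small compared with its standard deviation or if the logarithm is large. The first event is rare
by a small ball estimate, which follows from a bound for the characteristic function of a sum of
many small independent terms (`BoundedCentralMoments.measureReal_norm_randomFun_lt_le`). For the
smooth function the Lindeberg exchange of the coefficients, one at a time, gives the comparison: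
each term is a small fraction of the standard deviation, and the first two moments match, except
for boundedly many terms for which a first order estimate is enough
(`ConditionC1.abs_integral_truncLog_sub_le`). All errors are positive powers of `δ`.
-/
namespace RandomRoots

/-! ### Zeros of analytic functions on a disk -/

/-- A zero of finite order can be divided out globally. -/
lemma exists_eq_pow_mul_of_analyticOnNhd {f : ℂ → ℂ} {U : Set ℂ} (hf : AnalyticOnNhd ℂ f U)
    {a : ℂ} (ha : a ∈ U) (hord : analyticOrderAt f a ≠ ⊤) :
    ∃ g : ℂ → ℂ, AnalyticOnNhd ℂ g U ∧ g a ≠ 0 ∧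
      ∀ w, f w = (w - a) ^ analyticOrderNatAt f a * g w := by
  obtain ⟨g₀, hg₀, hg₀a, hfg⟩ :=
    ((hf a ha).analyticOrderNatAt_eq_iff hord (n := analyticOrderNatAt f a)).1 rfl
  set n := analyticOrderNatAt f a with hn
  classical
  let g : ℂ → ℂ := Function.update (fun w => f w / (w - a) ^ n) a (g₀ a)
  have hgne : ∀ w, w ≠ a → g w = f w / (w - a) ^ n := fun w hw => Function.update_of_ne hw _ _
  have hga : g a = g₀ a := Function.update_self _ _ _
  refine ⟨g, ?_, by rwa [hga], ?_⟩
  · intro w hw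
    by_cases hwa : w = a
    · subst hwa
      refine hg₀.congr ?_
      filter_upwards [hfg] with x hx
      by_cases hxw : x = w
      · rw [hxw, hga]
      · rw [hgne x hxw, hx, smul_eq_mul,
          mul_div_cancel_left₀ _ (pow_ne_zero _ (sub_ne_zero.2 hxw))]
    · have h1 : AnalyticAt ℂ (fun x => f x / (x - a) ^ n) w :=
        (hf w hw).div (by fun_prop) (pow_ne_zero _ (sub_ne_zero.2 hwa))
      refine h1.congr ?_
      filter_upwards [isOpen_ne.mem_nhds hwa] with x hx
      exact (hgne x hx).symm
  · intro w
    by_cases hwa : w = a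
    · subst hwa
      rw [hga]
      simpa using hfg.self_of_nhds
    · rw [hgne w hwa, mul_div_cancel₀ _ (pow_ne_zero _ (sub_ne_zero.2 hwa))]

/-- Finitely many zeros of finite order can be divided out globally. -/
lemma exists_eq_prod_mul_of_analyticOnNhd {f : ℂ → ℂ} {U : Set ℂ} (hf : AnalyticOnNhd ℂ f U)
    (hord : ∀ w ∈ U, analyticOrderAt f w ≠ ⊤) (Z : Finset ℂ) (hZ : ↑Z ⊆ U) :
    ∃ g : ℂ → ℂ, AnalyticOnNhd ℂ g U ∧ (∀ a ∈ Z, g a ≠ 0) ∧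
      ∀ w, f w = (∏ a ∈ Z, (w - a) ^ analyticOrderNatAt f a) * g w := by
  classical
  induction Z using Finset.induction_on with
  | empty => exact ⟨f, hf, by simp, by simp⟩
  | insert a Z ha ih =>
    rw [Finset.coe_insert, Set.insert_subset_iff] at hZ
    obtain ⟨g, hg, hgZ, hfg⟩ := ih hZ.2
    have hord' : analyticOrderAt f a = analyticOrderAt g a := by
      have hP : AnalyticAt ℂ (fun w => ∏ b ∈ Z, (w - b) ^ analyticOrderNatAt f b) a := by
        fun_prop
      have h0 : analyticOrderAt (fun w => ∏ b ∈ Z, (w - b) ^ analyticOrderNatAt f b) a = 0 := by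
        rw [hP.analyticOrderAt_eq_zero]
        refine Finset.prod_ne_zero_iff.2 fun b hb => pow_ne_zero _ (sub_ne_zero.2 ?_)
        rintro rfl
        exact ha hb
      have : f = (fun w => ∏ b ∈ Z, (w - b) ^ analyticOrderNatAt f b) * g := funext hfg
      conv_lhs => rw [this]
      rw [analyticOrderAt_mul hP (hg a hZ.1), h0, zero_add]
    obtain ⟨g', hg', hg'a, hgg'⟩ := exists_eq_pow_mul_of_analyticOnNhd hg hZ.1
      (hord' ▸ hord a hZ.1)
    have hnat : analyticOrderNatAt f a = analyticOrderNatAt g a := by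
      simp [analyticOrderNatAt, hord']
    refine ⟨g', hg', ?_, ?_⟩
    · intro b hb
      rw [Finset.mem_insert] at hb
      rcases hb with rfl | hb
      · exact hg'a
      · have := hgZ b hb
        rw [hgg'] at this
        exact right_ne_zero_of_mul this
    · intro w
      rw [Finset.prod_insert ha, hfg w, hgg' w, hnat]
      ring

/-- An analytic function on a disk that is not identically zero has only zeros of finite order. -/
lemma analyticOrderAt_ne_top_of_ball {f : ℂ → ℂ} {z : ℂ} {R : ℝ}
    (hf : AnalyticOnNhd ℂ f (Metric.ball z R)) {w₀ : ℂ} (hw₀ : w₀ ∈ Metric.ball z R)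
    (hne : f w₀ ≠ 0) : ∀ w ∈ Metric.ball z R, analyticOrderAt f w ≠ ⊤ := by
  intro w hw
  refine hf.analyticOrderAt_ne_top_of_isPreconnected (convex_ball z R).isPreconnected hw₀ hw ?_
  rw [((hf w₀ hw₀).analyticOrderAt_eq_zero).2 hne]
  simp

/-- The zeros of finite order in a compact set are finite in number. -/
lemma finite_setOf_analyticOrderNatAt_ne_zero {f : ℂ → ℂ} {U K : Set ℂ}
    (hf : AnalyticOnNhd ℂ f U) (hK : IsCompact K) (hKU : K ⊆ U) :
    {w | w ∈ K ∧ analyticOrderNatAt f w ≠ 0}.Finite := by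
  have hloc : ∀ x ∈ K, {y | y = x ∨ analyticOrderNatAt f y = 0} ∈ 𝓝 x := by
    intro x hx
    have hfx := hf x (hKU hx)
    rcases hfx.eventually_eq_zero_or_eventually_ne_zero with h | h
    · filter_upwards [h.eventually_nhds] with y hy
      right
      simp [analyticOrderNatAt, analyticOrderAt_eq_top.2 hy]
    · rw [eventually_nhdsWithin_iff] at h
      filter_upwards [h] with y hy
      by_cases hyx : y = x
      · exact Or.inl hyx
      · right
        by_contra h0
        exact hy hyx (apply_eq_zero_of_analyticOrderNatAt_ne_zero h0)
  obtain ⟨t, -, ht⟩ := hK.elim_nhds_subcover _ hloc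
  refine t.finite_toSet.subset ?_
  rintro w ⟨hwK, hw⟩
  obtain ⟨x, hxt, hx⟩ := Set.mem_iUnion₂.1 (ht hwK)
  rcases hx with rfl | hx
  · exact hxt
  · exact absurd hx hw

/-- Division by the zeros in a compact subset of the disk: the quotient has no zeros there. -/
lemma exists_factorization {f : ℂ → ℂ} {z : ℂ} {R : ℝ}
    (hf : AnalyticOnNhd ℂ f (Metric.ball z R)) {w₀ : ℂ} (hw₀ : w₀ ∈ Metric.ball z R)
    (hne : f w₀ ≠ 0) {K : Set ℂ} (hK : IsCompact K) (hKU : K ⊆ Metric.ball z R) :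
    ∃ (Z : Finset ℂ) (g : ℂ → ℂ), (∀ w, w ∈ Z ↔ w ∈ K ∧ analyticOrderNatAt f w ≠ 0) ∧
      AnalyticOnNhd ℂ g (Metric.ball z R) ∧ (∀ w ∈ K, g w ≠ 0) ∧
      ∀ w, f w = (∏ a ∈ Z, (w - a) ^ analyticOrderNatAt f a) * g w := by
  have hfin := finite_setOf_analyticOrderNatAt_ne_zero hf hK hKU
  have hord := analyticOrderAt_ne_top_of_ball hf hw₀ hne
  have hmem : ∀ w, w ∈ hfin.toFinset ↔ w ∈ K ∧ analyticOrderNatAt f w ≠ 0 := by simp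
  obtain ⟨g, hg, hgZ, hfg⟩ := exists_eq_prod_mul_of_analyticOnNhd hf hord hfin.toFinset
    (fun w hw => hKU ((hmem w).1 hw).1)
  refine ⟨hfin.toFinset, g, hmem, hg, ?_, hfg⟩
  intro w hw
  by_cases hwZ : w ∈ hfin.toFinset
  · exact hgZ w hwZ
  · intro h0
    have hw0 : f w = 0 := by rw [hfg w, h0, mul_zero]
    have : analyticOrderNatAt f w = 0 := by
      by_contra h
      exact hwZ ((hmem w).2 ⟨hw, h⟩)
    have h1 : analyticOrderAt f w = 0 := by
      rw [← Nat.cast_analyticOrderNatAt (hord w (hKU hw)), this]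
      rfl
    exact ((hf w (hKU hw)).analyticOrderAt_eq_zero.1 h1) hw0

/-! ### Integrability of the logarithm of an analytic function -/

/-- The function `|log ‖w‖| ^ p`, cut off outside the unit disk. -/
noncomputable def logPow (p : ℕ) : ℂ → ℝ :=
  (Metric.ball (0 : ℂ) 1).indicator fun w => |Real.log ‖w‖| ^ p

lemma logPow_nonneg (p : ℕ) (w : ℂ) : 0 ≤ logPow p w :=
  Set.indicator_nonneg (fun _ _ => by positivity) w

lemma integrable_logPow (p : ℕ) : Integrable (logPow p) := by
  have h : logPow p = fun w : ℂ => (Set.Iio (1 : ℝ)).indicator (fun x => |Real.log x| ^ p) ‖w‖ := by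
    ext w
    by_cases h : ‖w‖ < 1 <;> simp [logPow, h]
  rw [h, integrable_fun_norm_addHaar volume]
  have h2 : Module.finrank ℝ ℂ - 1 = 1 := by simp
  rw [h2]
  have h3 : IntegrableOn (fun _ : ℝ => ((p : ℝ) + 1) ^ p) (Set.Ioo 0 1) := by
    simp
  have h4 : IntegrableOn (fun y : ℝ => y * |Real.log y| ^ p) (Set.Ioo 0 1) := by
    refine h3.mono' (by fun_prop) ?_
    refine (ae_restrict_iff' measurableSet_Ioo).2 (Eventually.of_forall fun y hy => ?_)
    rw [Real.norm_of_nonneg (mul_nonneg hy.1.le (by positivity))]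
    rcases Nat.eq_zero_or_pos p with rfl | hp
    · simpa using hy.2.le
    have hp' : (0 : ℝ) < p := by exact_mod_cast hp
    have h5 := (Real.abs_log_mul_self_rpow_lt y (1 / p) hy.1 hy.2.le (by positivity)).le
    rw [one_div_one_div, abs_mul, abs_of_nonneg (Real.rpow_nonneg hy.1.le _)] at h5
    have h6 := pow_le_pow_left₀
      (mul_nonneg (abs_nonneg _) (Real.rpow_nonneg hy.1.le _)) h5 p
    rw [mul_pow, ← Real.rpow_natCast (y ^ (1 / (p : ℝ))), ← Real.rpow_mul hy.1.le,
      one_div_mul_cancel hp'.ne', Real.rpow_one, mul_comm] at h6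
    refine h6.trans (pow_le_pow_left₀ hp'.le (by linarith) p)
  have h7 : IntegrableOn (fun y : ℝ => (Set.Iio (1 : ℝ)).indicator (fun y => y * |Real.log y| ^ p) y)
      (Set.Ioi 0) := by
    rw [integrableOn_indicator_iff measurableSet_Iio]
    refine h4.mono_set ?_
    intro x hx
    exact ⟨hx.2, hx.1⟩
  refine h7.congr_fun (fun y _ => ?_) measurableSet_Ioi
  simp [Set.indicator_apply]

lemma abs_log_sub_pow_eq {p : ℕ} {w a : ℂ} (h : ‖w - a‖ < 1) :
    |Real.log ‖w - a‖| ^ p = logPow p (w - a) := by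
  rw [logPow, Set.indicator_of_mem (by simpa using h)]

/-- A weighted form of Jensen's inequality with integer weights. -/
lemma sum_mul_pow_le {ι : Type*} (s : Finset ι) (m : ι → ℕ) (x : ι → ℝ) (hx : ∀ i ∈ s, 0 ≤ x i)
    {p : ℕ} (hp : p ≠ 0) :
    (∑ i ∈ s, (m i : ℝ) * x i) ^ p ≤ (∑ i ∈ s, (m i : ℝ)) ^ (p - 1) * ∑ i ∈ s, m i * x i ^ p := by
  set T : ℝ := ∑ i ∈ s, (m i : ℝ) with hT
  have hT0 : 0 ≤ T := Finset.sum_nonneg fun _ _ => by positivity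
  rcases hT0.eq_or_lt with h0 | h0
  · have hz : ∀ i ∈ s, (m i : ℝ) = 0 :=
      (Finset.sum_eq_zero_iff_of_nonneg (fun _ _ => by positivity)).1 h0.symm
    rw [Finset.sum_eq_zero (fun i hi => by rw [hz i hi, zero_mul]),
      Finset.sum_eq_zero (s := s) (f := fun i => (m i : ℝ) * x i ^ p)
        (fun i hi => by rw [hz i hi, zero_mul]), zero_pow hp, mul_zero]
  · have h := Real.pow_arith_mean_le_arith_mean_pow s (fun i => (m i : ℝ) / T) x
      (fun _ _ => by positivity) (by rw [← Finset.sum_div, ← hT, div_self h0.ne']) hx p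
    have e1 : ∑ i ∈ s, (m i : ℝ) / T * x i = (∑ i ∈ s, (m i : ℝ) * x i) / T := by
      rw [Finset.sum_div]; exact Finset.sum_congr rfl fun _ _ => by ring
    have e2 : ∑ i ∈ s, (m i : ℝ) / T * x i ^ p = (∑ i ∈ s, (m i : ℝ) * x i ^ p) / T := by
      rw [Finset.sum_div]; exact Finset.sum_congr rfl fun _ _ => by ring
    rw [e1, e2, div_pow, div_le_div_iff₀ (by positivity) h0] at h
    have e3 : T ^ p = T ^ (p - 1) * T := by
      rw [← pow_succ, Nat.sub_add_cancel (Nat.one_le_iff_ne_zero.2 hp)]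
    rw [e3] at h
    nlinarith [h]

/-- Two-sided bound for a harmonic function of the form `log ‖g‖` near the centre of a disk, from an
upper bound on the disk and a lower bound at the centre. -/
lemma abs_log_norm_le_of_borelCaratheodory {g : ℂ → ℂ} {z : ℂ} {Q : ℝ} (hQ : 0 < Q)
    (hg : AnalyticOnNhd ℂ g (Metric.ball z (1 / 2))) (hg0 : ∀ w ∈ Metric.ball z (1 / 2), g w ≠ 0)
    (hup : ∀ w ∈ Metric.ball z (1 / 2), ‖g w‖ ≤ Real.exp Q) (hlow : Real.exp (-Q) ≤ ‖g z‖)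
    {w : ℂ} (hw : ‖w - z‖ ≤ 1 / 50) : |Real.log ‖g w‖| ≤ 2 * Q := by
  have hharm : InnerProductSpace.HarmonicOnNhd (fun x => Real.log ‖g x‖) (Metric.ball z (1 / 2)) :=
    fun x hx => (hg x hx).harmonicAt_log_norm (hg0 x hx)
  obtain ⟨F, hF, hre⟩ := hharm.exists_analyticOnNhd_ball_re_eq
  have hzmem : z ∈ Metric.ball z (1 / 2) := Metric.mem_ball_self (by norm_num)
  have hlog : ∀ x ∈ Metric.ball z (1 / 2), Real.log ‖g x‖ ≤ Q := fun x hx => by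
    have := Real.log_le_log (norm_pos_iff.2 (hg0 x hx)) (hup x hx)
    rwa [Real.log_exp] at this
  have hlogz : |Real.log ‖g z‖| ≤ Q := by
    rw [abs_le]
    refine ⟨?_, hlog z hzmem⟩
    have := Real.log_le_log (Real.exp_pos _) hlow
    rwa [Real.log_exp] at this
  let H : ℂ → ℂ := fun x => F (z + x) - (F z).im * Complex.I
  have hmaps : ∀ x ∈ Metric.ball (0 : ℂ) (1 / 2), z + x ∈ Metric.ball z (1 / 2) := by
    intro x hx
    simpa using hx
  have hH : DifferentiableOn ℂ H (Metric.ball 0 (1 / 2)) := by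
    have h1 : DifferentiableOn ℂ (fun x => F (z + x)) (Metric.ball 0 (1 / 2)) :=
      hF.differentiableOn.comp (by fun_prop) hmaps
    exact h1.sub_const _
  have hHre : ∀ x ∈ Metric.ball (0 : ℂ) (1 / 2), (H x).re = Real.log ‖g (z + x)‖ := by
    intro x hx
    have := hre (hmaps x hx)
    simp only at this
    simp [H, this]
  have h0 : ‖H 0‖ ≤ Q := by
    have h1 : H 0 = ((Real.log ‖g z‖ : ℝ) : ℂ) := by
      apply Complex.ext
      · rw [hHre 0 (by simp)]; simp
      · simp [H]
    rw [h1, Complex.norm_real]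
    exact hlogz
  have hxw : w - z ∈ Metric.ball (0 : ℂ) (1 / 2) := by
    rw [mem_ball_zero_iff]; linarith
  have hbc := Complex.borelCaratheodory hQ hH
    (fun x hx => by
      change (H x).re ≤ Q
      rw [hHre x hx]; exact hlog _ (hmaps x hx)) (by norm_num) hxw
  have h1 : |Real.log ‖g w‖| ≤ ‖H (w - z)‖ := by
    have := Complex.abs_re_le_norm (H (w - z))
    rwa [hHre _ hxw, add_sub_cancel] at this
  refine h1.trans (hbc.trans ?_)
  set t := ‖w - z‖
  have ht : 0 ≤ t := norm_nonneg _
  rw [← add_div, div_le_iff₀ (by linarith)]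
  nlinarith [mul_le_mul_of_nonneg_right h0 (by linarith : (0 : ℝ) ≤ 1 / 2 + t)]

/-- An analytic function on a disk of radius `2` that is bounded by `exp Q` and at least `exp (-Q)`
at a point near the centre has at most `3 Q` zeros near the centre, and dividing them out leaves
a function whose logarithm is at most `2 Q`. The maximum principle for the quotient gives both. -/
lemma exists_log_decomposition {f : ℂ → ℂ} {z z' : ℂ} {Q : ℝ} (hQ : 1 ≤ Q)
    (hf : AnalyticOnNhd ℂ f (Metric.ball z 2))
    (hup : ∀ w ∈ Metric.ball z 2, ‖f w‖ ≤ Real.exp Q)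
    (hz' : z' ∈ Metric.ball z (1 / 100)) (hlow : Real.exp (-Q) ≤ ‖f z'‖) :
    ∃ (Z : Finset ℂ) (m : ℂ → ℕ) (g : ℂ → ℂ), (∑ a ∈ Z, (m a : ℝ)) ≤ 3 * Q ∧
      (∀ w ∈ Metric.closedBall z (1 / 100), ∀ a ∈ Z, ‖w - a‖ < 1) ∧
      (∀ w ∈ Metric.closedBall z (1 / 100), |Real.log ‖g w‖| ≤ 2 * Q) ∧
      ∀ w ∈ Metric.closedBall z (1 / 100), w ∉ Z →
        Real.log ‖f w‖ = ∑ a ∈ Z, m a * Real.log ‖w - a‖ + Real.log ‖g w‖ := by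
  have hzz' : dist z' z < 1 / 100 := hz'
  have hz'2 : z' ∈ Metric.ball z 2 := Metric.mem_ball.2 (by linarith)
  have hfz' : f z' ≠ 0 := norm_pos_iff.1 ((Real.exp_pos _).trans_le hlow)
  have hsub : Metric.closedBall z' (1 / 2) ⊆ Metric.ball z 2 :=
    Metric.closedBall_subset_ball' (by linarith)
  obtain ⟨Z, g, hZ, hg, hg0, hfg⟩ :=
    exists_factorization hf hz'2 hfz' (isCompact_closedBall z' (1 / 2)) hsub
  set m : ℂ → ℕ := fun a => analyticOrderNatAt f a with hm
  have hZd : ∀ a ∈ Z, ‖a - z'‖ ≤ 1 / 2 := fun a ha => by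
    simpa [dist_eq_norm] using ((hZ a).1 ha).1
  have hbig : Metric.closedBall z' (19 / 10) ⊆ Metric.ball z 2 :=
    Metric.closedBall_subset_ball' (by linarith)
  have hgbound : ∀ w ∈ Metric.closedBall z' (19 / 10), ‖g w‖ ≤ Real.exp Q := by
    intro w hw
    have hd : DiffContOnCl ℂ g (Metric.ball z' (19 / 10)) := by
      refine DifferentiableOn.diffContOnCl ?_
      rw [closure_ball z' (by norm_num)]
      exact hg.differentiableOn.mono hbig
    refine Complex.norm_le_of_forall_mem_frontier_norm_le Metric.isBounded_ball hd ?_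
      (by rwa [closure_ball z' (by norm_num)])
    intro x hx
    rw [frontier_ball z' (by norm_num), mem_sphere_iff_norm] at hx
    have hxU : x ∈ Metric.ball z 2 := hbig (by simp [dist_eq_norm, hx])
    have hfx := hup x hxU
    rw [hfg x, norm_mul, norm_prod] at hfx
    -- On the circle of radius `19 / 10` all the zeros divided out are at distance at least one.
    have hprod : 1 ≤ ∏ a ∈ Z, ‖(x - a) ^ analyticOrderNatAt f a‖ := by
      rw [← Finset.prod_const_one (s := Z)]
      refine Finset.prod_le_prod (fun _ _ => zero_le_one) fun a ha => ?_
      rw [norm_pow]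
      refine one_le_pow₀ ?_
      have h1 : ‖x - z'‖ ≤ ‖x - a‖ + ‖a - z'‖ := norm_sub_le_norm_sub_add_norm_sub _ _ _
      linarith [hZd a ha]
    nlinarith [norm_nonneg (g x)]
  have hcount : Real.exp (-Q) * 2 ^ (∑ a ∈ Z, m a) ≤ ‖g z'‖ := by
    have h1 := hlow
    rw [hfg z', norm_mul, norm_prod] at h1
    -- At `z'` they are at distance at most one half, so each doubles the value of the quotient.
    have hprod : ∏ a ∈ Z, ‖(z' - a) ^ analyticOrderNatAt f a‖ ≤ (1 / 2) ^ (∑ a ∈ Z, m a) := by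
      rw [← Finset.prod_pow_eq_pow_sum]
      refine Finset.prod_le_prod (fun _ _ => norm_nonneg _) fun a ha => ?_
      rw [norm_pow]
      refine pow_le_pow_left₀ (norm_nonneg _) ?_ _
      rw [norm_sub_rev]; exact hZd a ha
    have h2 : Real.exp (-Q) ≤ (1 / 2) ^ (∑ a ∈ Z, m a) * ‖g z'‖ :=
      h1.trans (mul_le_mul_of_nonneg_right hprod (norm_nonneg _))
    rw [one_div, inv_pow, ← div_eq_inv_mul, le_div_iff₀ (by positivity)] at h2
    exact h2
  have hz'self : z' ∈ Metric.closedBall z' (19 / 10) := Metric.mem_closedBall_self (by norm_num)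
  refine ⟨Z, m, g, ?_, ?_, ?_, ?_⟩
  · have h1 := hcount.trans (hgbound z' hz'self)
    have h2 := Real.log_le_log (by positivity) h1
    rw [Real.log_exp, Real.log_mul (Real.exp_pos _).ne' (by positivity), Real.log_exp,
      Real.log_pow] at h2
    have h3 := Real.log_two_gt_d9
    push_cast at h2
    have h4 : (0 : ℝ) ≤ ∑ a ∈ Z, (m a : ℝ) := Finset.sum_nonneg fun _ _ => by positivity
    nlinarith
  · intro w hw a ha
    have h1 : ‖w - a‖ ≤ ‖w - z‖ + ‖z - a‖ := norm_sub_le_norm_sub_add_norm_sub _ _ _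
    have h2 : ‖z - a‖ ≤ ‖z - z'‖ + ‖z' - a‖ := norm_sub_le_norm_sub_add_norm_sub _ _ _
    have h3 := hZd a ha
    rw [norm_sub_rev] at h3
    rw [mem_closedBall_iff_norm] at hw
    rw [dist_eq_norm, norm_sub_rev] at hzz'
    linarith
  · intro w hw
    have hball : Metric.ball z' (1 / 2) ⊆ Metric.closedBall z' (19 / 10) := fun x hx => by
      rw [Metric.mem_ball] at hx; rw [Metric.mem_closedBall]; linarith
    refine abs_log_norm_le_of_borelCaratheodory (by linarith) (hg.mono (hball.trans hbig))
      (fun x hx => hg0 x (Metric.ball_subset_closedBall hx)) (fun x hx => hgbound x (hball hx))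
      (le_trans ?_ hcount) (w := w) ?_
    · exact le_mul_of_one_le_right (Real.exp_pos _).le (one_le_pow₀ (by norm_num))
    · have h1 : ‖w - z'‖ ≤ ‖w - z‖ + ‖z - z'‖ := norm_sub_le_norm_sub_add_norm_sub _ _ _
      rw [mem_closedBall_iff_norm] at hw
      rw [dist_eq_norm, norm_sub_rev] at hzz'
      linarith
  · intro w hw hwZ
    have hgw : g w ≠ 0 := by
      refine hg0 w ?_
      have h1 : ‖w - z'‖ ≤ ‖w - z‖ + ‖z - z'‖ := norm_sub_le_norm_sub_add_norm_sub _ _ _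
      rw [mem_closedBall_iff_norm] at hw ⊢
      rw [dist_eq_norm, norm_sub_rev] at hzz'
      linarith
    have hne : ∀ a ∈ Z, ‖(w - a) ^ analyticOrderNatAt f a‖ ≠ 0 := fun a ha => by
      rw [norm_ne_zero_iff]
      exact pow_ne_zero _ (sub_ne_zero.2 fun h => hwZ (h ▸ ha))
    rw [hfg w, norm_mul, norm_prod, Real.log_mul (Finset.prod_ne_zero_iff.2 hne)
      (norm_ne_zero_iff.2 hgw), Real.log_prod hne]
    congr 1
    refine Finset.sum_congr rfl fun a _ => ?_
    rw [norm_pow, Real.log_pow]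

/-- `L^p` bound for the logarithm of an analytic function that is neither too large nor too
small. -/
lemma exists_integral_abs_log_pow_le (p : ℕ) (hp : p ≠ 0) :
    ∃ B : ℝ, 0 < B ∧ ∀ (f : ℂ → ℂ) (z z' : ℂ) (Q : ℝ), 1 ≤ Q →
      AnalyticOnNhd ℂ f (Metric.ball z 2) → (∀ w ∈ Metric.ball z 2, ‖f w‖ ≤ Real.exp Q) →
      z' ∈ Metric.ball z (1 / 100) → Real.exp (-Q) ≤ ‖f z'‖ →
      IntegrableOn (fun w => |Real.log ‖f w‖| ^ p) (Metric.closedBall z (1 / 100)) ∧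
      ∫ w in Metric.closedBall z (1 / 100), |Real.log ‖f w‖| ^ p ≤ B * Q ^ p := by
  set I : ℝ := ∫ w, logPow p w with hI
  have hI0 : 0 ≤ I := integral_nonneg (logPow_nonneg p)
  refine ⟨2 ^ (p - 1) * (3 ^ p * I + 2 ^ p), by positivity, ?_⟩
  intro f z z' Q hQ hf hup hz' hlow
  obtain ⟨Z, m, g, hm, hdist, hg, hlog⟩ := exists_log_decomposition hQ hf hup hz' hlow
  set U := Metric.closedBall z (1 / 100) with hU
  set T : ℝ := ∑ a ∈ Z, (m a : ℝ) with hT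
  have hT0 : 0 ≤ T := Finset.sum_nonneg fun _ _ => by positivity
  have hUm : MeasurableSet U := Metric.isClosed_closedBall.measurableSet
  have hvol : volume.real U ≤ 1 := by
    rw [hU, Measure.real, Complex.volume_closedBall]
    simp only [ENNReal.toReal_mul, ENNReal.toReal_pow, ENNReal.coe_toReal, NNReal.coe_real_pi]
    rw [ENNReal.toReal_ofReal (by norm_num)]
    nlinarith [Real.pi_lt_d2]
  have hvol' : volume U ≠ ∞ := measure_closedBall_lt_top.ne
  -- the pointwise bound outside the finite set of zeros
  set Φ : ℂ → ℝ := fun w =>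
    2 ^ (p - 1) * (T ^ (p - 1) * ∑ a ∈ Z, m a * logPow p (w - a) + (2 * Q) ^ p) with hΦ
  have hpt : ∀ w ∈ U, w ∉ Z → |Real.log ‖f w‖| ^ p ≤ Φ w := by
    intro w hw hwZ
    have h1 : |Real.log ‖f w‖| ≤ ∑ a ∈ Z, m a * |Real.log ‖w - a‖| + 2 * Q := by
      rw [hlog w hw hwZ]
      refine (abs_add_le _ _).trans (add_le_add ?_ (hg w hw))
      refine (Finset.abs_sum_le_sum_abs _ _).trans (Finset.sum_le_sum fun a _ => ?_)
      rw [abs_mul, Nat.abs_cast]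
    have hS : 0 ≤ ∑ a ∈ Z, m a * |Real.log ‖w - a‖| :=
      Finset.sum_nonneg fun _ _ => by positivity
    refine (pow_le_pow_left₀ (abs_nonneg _) h1 p).trans ?_
    refine (add_pow_le hS (by linarith) p).trans ?_
    refine mul_le_mul_of_nonneg_left (add_le_add_left ?_ _) (by positivity)
    refine (sum_mul_pow_le Z m _ (fun _ _ => abs_nonneg _) hp).trans ?_
    refine mul_le_mul_of_nonneg_left (Finset.sum_le_sum fun a ha => ?_) (by positivity)
    rw [abs_log_sub_pow_eq (hdist w hw a ha)]
  have hae : ∀ᵐ w ∂(volume.restrict U), |Real.log ‖f w‖| ^ p ≤ Φ w := by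
    rw [ae_restrict_iff' hUm]
    have : ∀ᵐ w : ℂ, w ∉ (Z : Set ℂ) :=
      (measure_eq_zero_iff_ae_notMem).1 (Z.finite_toSet.measure_zero volume)
    filter_upwards [this] with w hw hwU
    exact hpt w hwU (by simpa using hw)
  have hshift : ∀ a : ℂ, Integrable (fun w => logPow p (w - a)) := fun a =>
    (integrable_logPow p).comp_sub_right a
  have hS : Integrable (fun w => ∑ a ∈ Z, (m a : ℝ) * logPow p (w - a)) :=
    integrable_finsetSum _ fun a _ => (hshift a).const_mul _
  have hΦi : IntegrableOn Φ U :=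
    (((hS.integrableOn).const_mul _).add (integrableOn_const hvol')).const_mul _
  have hfm : AEStronglyMeasurable (fun w => |Real.log ‖f w‖| ^ p) (volume.restrict U) := by
    have h1 : ContinuousOn f U := (hf.mono (by
      intro x hx
      rw [hU, Metric.mem_closedBall] at hx
      rw [Metric.mem_ball]; linarith)).continuousOn
    have h2 : AEMeasurable f (volume.restrict U) := h1.aemeasurable hUm
    exact ((Real.measurable_log.comp_aemeasurable h2.norm).abs.pow_const p).aestronglyMeasurable
  have hint : IntegrableOn (fun w => |Real.log ‖f w‖| ^ p) U := by
    refine hΦi.mono' hfm ?_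
    filter_upwards [hae] with w hw
    rwa [Real.norm_of_nonneg (by positivity)]
  refine ⟨hint, (integral_mono_ae hint hΦi hae).trans ?_⟩
  have hSle : ∫ w in U, ∑ a ∈ Z, (m a : ℝ) * logPow p (w - a) ≤ T * I := by
    refine (setIntegral_le_integral hS (Eventually.of_forall fun w =>
      Finset.sum_nonneg fun a _ => mul_nonneg (by positivity) (logPow_nonneg _ _))).trans ?_
    rw [integral_finsetSum _ fun a _ => (hshift a).const_mul _]
    simp_rw [integral_const_mul, integral_sub_right_eq_self (logPow p)]
    rw [← Finset.sum_mul]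
  have e1 : ∫ w in U, Φ w = 2 ^ (p - 1) * (T ^ (p - 1) *
      (∫ w in U, ∑ a ∈ Z, (m a : ℝ) * logPow p (w - a)) + volume.real U * (2 * Q) ^ p) := by
    rw [hΦ, integral_const_mul, integral_add (hS.integrableOn.const_mul _)
      (integrableOn_const hvol'), integral_const_mul, setIntegral_const, smul_eq_mul]
  rw [e1, mul_assoc]
  refine mul_le_mul_of_nonneg_left ?_ (by positivity)
  have h3 : T ^ (p - 1) * (T * I) ≤ (3 * Q) ^ p * I := by
    rw [← mul_assoc, ← pow_succ, Nat.sub_add_cancel (Nat.one_le_iff_ne_zero.2 hp)]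
    exact mul_le_mul_of_nonneg_right (pow_le_pow_left₀ hT0 hm p) hI0
  have h4 : volume.real U * (2 * Q) ^ p ≤ (2 * Q) ^ p :=
    mul_le_of_le_one_left (by positivity) hvol
  calc _ ≤ T ^ (p - 1) * (T * I) + (2 * Q) ^ p :=
        add_le_add (mul_le_mul_of_nonneg_left hSle (by positivity)) h4
    _ ≤ (3 * Q) ^ p * I + (2 * Q) ^ p := by linarith
    _ = (3 ^ p * I + 2 ^ p) * Q ^ p := by rw [mul_pow, mul_pow]; ring

/-! ### Green's formula in the plane -/

section DirectionalDerivative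

variable {E F : Type*} [NormedAddCommGroup E] [NormedSpace ℝ E] [NormedAddCommGroup F]
  [NormedSpace ℝ F]

/-- The derivative in the direction `v`, as an operator on functions. Defined through lines, so that
it commutes with restriction to affine subspaces without any smoothness assumption. -/
noncomputable def dirDeriv (v : E) (H : E → F) : E → F := fun w => lineDeriv ℝ H w v

lemma dirDeriv_eq_fderiv {H : E → F} (hH : Differentiable ℝ H) (v : E) :
    dirDeriv v H = fun w => fderiv ℝ H w v :=
  funext fun w => (hH w).lineDeriv_eq_fderiv

lemma contDiff_dirDeriv {H : E → F} {n : ℕ} (hH : ContDiff ℝ (n + 1 : ℕ) H) (v : E) :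
    ContDiff ℝ n (dirDeriv v H) := by
  rw [dirDeriv_eq_fderiv (hH.differentiable (by simp)) v]
  exact (hH.fderiv_right (m := n) (by norm_cast)).clm_apply contDiff_const

lemma dirDeriv_eq_zero_of_isOpen {H : E → F} {S : Set E} (hS : IsOpen S) (h : ∀ w ∈ S, H w = 0)
    (v : E) : ∀ w ∈ S, dirDeriv v H w = 0 := by
  intro w hw
  have h1 : H =ᶠ[𝓝 w] fun _ => 0 := by
    filter_upwards [hS.mem_nhds hw] with x hx using h x hx
  rw [dirDeriv, h1.lineDeriv_eq]
  simp [lineDeriv]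

lemma tsupport_dirDeriv_subset (H : E → F) (v : E) : tsupport (dirDeriv v H) ⊆ tsupport H := by
  refine closure_minimal ?_ (isClosed_tsupport H)
  intro w hw
  by_contra h
  exact hw (dirDeriv_eq_zero_of_isOpen (isClosed_tsupport H).isOpen_compl
    (fun x hx => image_eq_zero_of_notMem_tsupport hx) v w h)

end DirectionalDerivative

/-- The Laplacian of a function on the plane, through second derivatives along the two axes. -/
noncomputable def planeLap {F : Type*} [NormedAddCommGroup F] [NormedSpace ℝ F] (g : ℂ → F) :
    ℂ → F :=
  fun w => dirDeriv 1 (dirDeriv 1 g) w + dirDeriv Complex.I (dirDeriv Complex.I g) w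

lemma tsupport_planeLap_subset {F : Type*} [NormedAddCommGroup F] [NormedSpace ℝ F] (g : ℂ → F) :
    tsupport (planeLap g) ⊆ tsupport g := by
  refine closure_minimal ?_ (isClosed_tsupport g)
  intro w hw
  by_contra h
  have h1 : ∀ v : ℂ, dirDeriv v (dirDeriv v g) w = 0 := fun v => by
    by_contra h2
    exact h (tsupport_dirDeriv_subset g v (tsupport_dirDeriv_subset _ v (subset_tsupport _ h2)))
  exact hw (by simp [planeLap, h1])

lemma continuous_planeLap {g : ℂ → ℂ} (hg : ContDiff ℝ 2 g) : Continuous (planeLap g) := by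
  have h : ∀ v : ℂ, Continuous (dirDeriv v (dirDeriv v g)) := fun v =>
    (contDiff_dirDeriv (n := 0) (contDiff_dirDeriv (n := 1) hg v) v).continuous
  exact (h 1).add (h Complex.I)

lemma continuous_smul_of_tsupport {f : ℂ → ℝ} {h : ℂ → ℂ} (hh : Continuous h)
    (hf : ∀ x ∈ tsupport h, ContinuousAt f x) : Continuous fun x => f x • h x := by
  rw [continuous_iff_continuousAt]
  intro x
  by_cases hx : x ∈ tsupport h
  · exact (hf x hx).smul hh.continuousAt
  · have h1 : (fun x => f x • h x) =ᶠ[𝓝 x] fun _ => 0 := by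
      filter_upwards [(isClosed_tsupport h).isOpen_compl.mem_nhds hx] with y hy
      rw [image_eq_zero_of_notMem_tsupport hy, smul_zero]
    exact continuousAt_const.congr h1.symm

lemma integrable_smul_of_tsupport {f : ℂ → ℝ} {h : ℂ → ℂ} {K : Set ℂ} (hK : IsCompact K)
    (hh : Continuous h) (hhK : tsupport h ⊆ K) (hf : ∀ x ∈ K, ContinuousAt f x) :
    Integrable fun x => f x • h x := by
  refine (continuous_smul_of_tsupport hh fun x hx => hf x (hhK hx)).integrable_of_hasCompactSupport
    (HasCompactSupport.of_support_subset_isCompact hK ?_)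
  intro x hx
  exact hhK (subset_tsupport _ (right_ne_zero_of_smul hx))

/-- Integration by parts twice in a fixed direction. -/
lemma integral_smul_dirDeriv_dirDeriv {f : ℂ → ℝ} {g : ℂ → ℂ} (hg : ContDiff ℝ 2 g)
    (hgc : HasCompactSupport g) (hf : ∀ x ∈ tsupport g, ContDiffAt ℝ 2 f x) (v : ℂ) :
    ∫ x, f x • dirDeriv v (dirDeriv v g) x =
      ∫ x, iteratedFDeriv ℝ 2 f x ![v, v] • g x := by
  have hgd : Differentiable ℝ g := hg.differentiable (by simp)
  have hg1 : ContDiff ℝ 1 (dirDeriv v g) := contDiff_dirDeriv (n := 1) hg v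
  have hg1d : Differentiable ℝ (dirDeriv v g) := hg1.differentiable (by simp)
  have hg2 : Continuous (dirDeriv v (dirDeriv v g)) :=
    (contDiff_dirDeriv (n := 0) hg1 v).continuous
  have ht1 := tsupport_dirDeriv_subset g v
  have ht2 := (tsupport_dirDeriv_subset (dirDeriv v g) v).trans ht1
  have hf0 : ∀ x ∈ tsupport g, ContinuousAt f x := fun x hx => (hf x hx).continuousAt
  have hf1 : ∀ x ∈ tsupport g, ContDiffAt ℝ 1 (fun y => fderiv ℝ f y v) x := fun x hx =>
    ((hf x hx).fderiv_right (m := 1) (by norm_cast)).clm_apply contDiffAt_const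
  have hf2 : ∀ x ∈ tsupport g, ContinuousAt (fun x => fderiv ℝ (fun y => fderiv ℝ f y v) x v) x :=
    fun x hx => (((hf1 x hx).fderiv_right (m := 0) (by norm_cast)).clm_apply
      contDiffAt_const).continuousAt
  have step1 : ∫ x, f x • dirDeriv v (dirDeriv v g) x =
      -∫ x, fderiv ℝ f x v • dirDeriv v g x := by
    have hi1 := integrable_smul_of_tsupport hgc hg1.continuous ht1
      fun x hx => (hf1 x hx).continuousAt
    have hi2 := integrable_smul_of_tsupport hgc hg2 ht2 hf0
    have hi3 := integrable_smul_of_tsupport hgc hg1.continuous ht1 hf0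
    rw [dirDeriv_eq_fderiv hg1d v] at hi2 ⊢
    exact integral_smul_fderiv_eq_neg_fderiv_smul_of_integrable hi1 hi2 hi3
      (fun x hx => (hf x (ht1 hx)).differentiableAt (by simp)) fun x _ => hg1d x
  have step2 : ∫ x, fderiv ℝ f x v • dirDeriv v g x =
      -∫ x, fderiv ℝ (fun y => fderiv ℝ f y v) x v • g x := by
    have hi1 := integrable_smul_of_tsupport hgc hg.continuous subset_rfl hf2
    have hi2 := integrable_smul_of_tsupport hgc hg1.continuous ht1
      fun x hx => (hf1 x hx).continuousAt
    have hi3 := integrable_smul_of_tsupport hgc hg.continuous subset_rfl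
      fun x hx => (hf1 x hx).continuousAt
    rw [dirDeriv_eq_fderiv hgd v] at hi2 ⊢
    exact integral_smul_fderiv_eq_neg_fderiv_smul_of_integrable hi1 hi2 hi3
      (fun x hx => (hf1 x hx).differentiableAt (by simp)) fun x _ => hgd x
  rw [step1, step2, neg_neg]
  refine integral_congr_ae (Eventually.of_forall fun x => ?_)
  by_cases hx : x ∈ tsupport g
  · simp only [iteratedFDeriv_two_apply, Matrix.cons_val_zero, Matrix.cons_val_one]
    have hd : DifferentiableAt ℝ (fderiv ℝ f) x :=
      ((hf x hx).fderiv_right (m := 1) (by norm_cast)).differentiableAt (by simp)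
    rw [fderiv_clm_apply hd (differentiableAt_const v)]
    simp
  · simp [image_eq_zero_of_notMem_tsupport hx]

/-- Green's second identity for a compactly supported `g`. -/
lemma integral_smul_planeLap {f : ℂ → ℝ} {g : ℂ → ℂ} (hg : ContDiff ℝ 2 g)
    (hgc : HasCompactSupport g) (hf : ∀ x ∈ tsupport g, ContDiffAt ℝ 2 f x) :
    ∫ x, f x • planeLap g x = ∫ x, Laplacian.laplacian f x • g x := by
  have hD : ∀ v : ℂ, Integrable fun x => f x • dirDeriv v (dirDeriv v g) x := fun v =>
    integrable_smul_of_tsupport hgc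
      (contDiff_dirDeriv (n := 0) (contDiff_dirDeriv (n := 1) hg v) v).continuous
      ((tsupport_dirDeriv_subset _ v).trans (tsupport_dirDeriv_subset g v))
      fun x hx => (hf x hx).continuousAt
  have hI : ∀ v : ℂ, Integrable fun x => iteratedFDeriv ℝ 2 f x ![v, v] • g x := fun v => by
    refine integrable_smul_of_tsupport hgc hg.continuous subset_rfl fun x hx => ?_
    have h1 : ContinuousAt (iteratedFDeriv ℝ 2 f) x :=
      ((hf x hx).iteratedFDeriv_right (m := 0) (i := 2) (by norm_cast)).continuousAt
    exact (ContinuousMultilinearMap.apply ℝ (fun _ : Fin 2 => ℂ) ℝ ![v, v]).continuous.continuousAt.comp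
      h1
  rw [InnerProductSpace.laplacian_eq_iteratedFDeriv_complexPlane]
  simp_rw [planeLap, smul_add, add_smul]
  rw [integral_add (hD 1) (hD Complex.I), integral_add (hI 1) (hI Complex.I),
    integral_smul_dirDeriv_dirDeriv hg hgc hf, integral_smul_dirDeriv_dirDeriv hg hgc hf]

/-- A harmonic function is orthogonal to the Laplacians of test functions. -/
lemma integral_smul_planeLap_of_harmonic {f : ℂ → ℝ} {g : ℂ → ℂ} (hg : ContDiff ℝ 2 g)
    (hgc : HasCompactSupport g) (hf : ∀ x ∈ tsupport g, InnerProductSpace.HarmonicAt f x) :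
    ∫ x, f x • planeLap g x = 0 := by
  rw [integral_smul_planeLap hg hgc fun x hx => (hf x hx).1]
  refine integral_eq_zero_of_ae (Eventually.of_forall fun x => ?_)
  by_cases hx : x ∈ tsupport g
  · have := (hf x hx).2.self_of_nhds
    simp [this]
  · simp [image_eq_zero_of_notMem_tsupport hx]

/-! ### The logarithm as fundamental solution of the Laplacian -/

/-- The regularised logarithm `½ log (‖w - a‖² + s²)`. -/
noncomputable def regLog (a : ℂ) (s : ℝ) (w : ℂ) : ℝ := 1 / 2 * Real.log (‖w - a‖ ^ 2 + s ^ 2)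

lemma contDiff_regLog (a : ℂ) {s : ℝ} (hs : s ≠ 0) : ContDiff ℝ 2 (regLog a s) := by
  have h : ContDiff ℝ 2 fun w : ℂ => ‖w - a‖ ^ 2 + s ^ 2 :=
    ((contDiff_id.sub contDiff_const).norm_sq ℝ).add contDiff_const
  exact contDiff_const.mul (h.log fun w => by positivity)

lemma hasDerivAt_half_log_quadratic {b c : ℝ} (hc : 0 < c) (t : ℝ) :
    HasDerivAt (fun t : ℝ => 1 / 2 * Real.log ((b + t) ^ 2 + c)) ((b + t) / ((b + t) ^ 2 + c)) t := by
  have h1 : HasDerivAt (fun t : ℝ => (b + t) ^ 2 + c) (2 * (b + t)) t := by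
    have := (((hasDerivAt_id t).const_add b).pow 2).add_const c
    simpa using this
  have h2 := (h1.log (by positivity)).const_mul (1 / 2)
  refine h2.congr_deriv ?_
  ring

lemma hasDerivAt_linear_div_quadratic {b c : ℝ} (hc : 0 < c) (t : ℝ) :
    HasDerivAt (fun t : ℝ => (b + t) / ((b + t) ^ 2 + c))
      (((b + t) ^ 2 + c - 2 * (b + t) ^ 2) / ((b + t) ^ 2 + c) ^ 2) t := by
  have h1 : HasDerivAt (fun t : ℝ => (b + t) ^ 2 + c) (2 * (b + t)) t := by
    have := (((hasDerivAt_id t).const_add b).pow 2).add_const c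
    simpa using this
  have h2 := ((hasDerivAt_id' t).const_add b).div h1 (by positivity)
  refine h2.congr_deriv ?_
  ring

/-- The second derivative in a direction, from the restriction of the function to a line. -/
lemma iteratedFDeriv_two_eq_of_line {f : ℂ → ℝ} (hf : ContDiff ℝ 2 f) (x v : ℂ) {p q : ℝ → ℝ}
    (hp : ∀ t : ℝ, f (x + t • v) = p t) {p' : ℝ → ℝ} (hp' : ∀ t, HasDerivAt p (p' t) t)
    (hq : HasDerivAt p' (q 0) 0) : iteratedFDeriv ℝ 2 f x ![v, v] = q 0 := by
  have hd : Differentiable ℝ f := hf.differentiable (by simp)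
  have hd2 : Differentiable ℝ (fderiv ℝ f) :=
    (hf.fderiv_right (m := 1) (by norm_cast)).differentiable (by simp)
  have hline : ∀ t : ℝ, HasDerivAt (fun t : ℝ => x + t • v) v t := fun t => by
    have := ((hasDerivAt_id t).smul_const v).const_add x
    simpa using this
  have h1 : ∀ t : ℝ, fderiv ℝ f (x + t • v) v = p' t := fun t => by
    have h2 := (hd (x + t • v)).hasFDerivAt.comp_hasDerivAt t (hline t)
    have h3 : f ∘ (fun t : ℝ => x + t • v) = p := funext hp
    rw [h3] at h2
    exact h2.unique (hp' t)
  have h4 : HasDerivAt (fun t : ℝ => fderiv ℝ f (x + t • v) v) (fderiv ℝ (fderiv ℝ f) x v v) 0 := by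
    have h5 := (hd2 (x + (0 : ℝ) • v)).hasFDerivAt.comp_hasDerivAt 0 (hline 0)
    have h6 := h5.clm_apply (hasDerivAt_const (0 : ℝ) v)
    simpa using h6
  have h7 : (fun t : ℝ => fderiv ℝ f (x + t • v) v) = p' := funext h1
  rw [h7] at h4
  rw [iteratedFDeriv_two_apply]
  exact h4.unique hq

lemma laplacian_regLog (a : ℂ) {s : ℝ} (hs : s ≠ 0) (w : ℂ) :
    Laplacian.laplacian (regLog a s) w = 2 * s ^ 2 / (‖w - a‖ ^ 2 + s ^ 2) ^ 2 := by
  rw [InnerProductSpace.laplacian_eq_iteratedFDeriv_complexPlane]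
  have hn : ∀ u : ℂ, ‖u‖ ^ 2 = u.re ^ 2 + u.im ^ 2 := fun u => by
    rw [Complex.sq_norm, Complex.normSq_apply]; ring
  have h1 := iteratedFDeriv_two_eq_of_line (contDiff_regLog a hs) w 1
    (p := fun t => 1 / 2 * Real.log (((w - a).re + t) ^ 2 + ((w - a).im ^ 2 + s ^ 2)))
    (q := fun t => ((((w - a).re + t) ^ 2 + ((w - a).im ^ 2 + s ^ 2) - 2 * ((w - a).re + t) ^ 2) /
      (((w - a).re + t) ^ 2 + ((w - a).im ^ 2 + s ^ 2)) ^ 2))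
    (fun t => by
      rw [regLog, hn]
      simp only [Complex.sub_re, Complex.add_re, Complex.real_smul, Complex.mul_re,
        Complex.ofReal_re, Complex.one_re, Complex.ofReal_im, Complex.one_im, Complex.sub_im,
        Complex.add_im, Complex.mul_im]
      ring_nf)
    (fun t => hasDerivAt_half_log_quadratic (by positivity) t)
    (hasDerivAt_linear_div_quadratic (by positivity) 0)
  have h2 := iteratedFDeriv_two_eq_of_line (contDiff_regLog a hs) w Complex.I
    (p := fun t => 1 / 2 * Real.log (((w - a).im + t) ^ 2 + ((w - a).re ^ 2 + s ^ 2)))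
    (q := fun t => ((((w - a).im + t) ^ 2 + ((w - a).re ^ 2 + s ^ 2) - 2 * ((w - a).im + t) ^ 2) /
      (((w - a).im + t) ^ 2 + ((w - a).re ^ 2 + s ^ 2)) ^ 2))
    (fun t => by
      rw [regLog, hn]
      simp only [Complex.sub_re, Complex.add_re, Complex.real_smul, Complex.mul_re,
        Complex.ofReal_re, Complex.I_re, Complex.ofReal_im, Complex.I_im, Complex.sub_im,
        Complex.add_im, Complex.mul_im]
      ring_nf)
    (fun t => hasDerivAt_half_log_quadratic (by positivity) t)
    (hasDerivAt_linear_div_quadratic (by positivity) 0)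
  simp only [h1, h2, hn, add_zero]
  rw [show (w - a).im ^ 2 + ((w - a).re ^ 2 + s ^ 2) = (w - a).re ^ 2 + ((w - a).im ^ 2 + s ^ 2) by
    ring, ← add_div, ← add_assoc]
  congr 1
  ring

lemma integral_inv_one_add_sq_sq : ∫ v : ℂ, 2 / (‖v‖ ^ 2 + 1) ^ 2 = 2 * Real.pi := by
  have h := integral_fun_norm_addHaar (volume : Measure ℂ) (fun y : ℝ => 2 / (y ^ 2 + 1) ^ 2)
  rw [h, show Module.finrank ℝ ℂ - 1 = 1 by simp]
  have h1 : ∫ y in Set.Ioi (0 : ℝ), y ^ 1 • (2 / (y ^ 2 + 1) ^ 2) = 1 := by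
    -- In polar coordinates the integrand has an elementary primitive.
    have hd : ∀ x ∈ Set.Ici (0 : ℝ), HasDerivAt (fun y : ℝ => -1 / (y ^ 2 + 1))
        (x ^ 1 • (2 / (x ^ 2 + 1) ^ 2)) x := by
      intro x _
      have h2 : HasDerivAt (fun y : ℝ => y ^ 2 + 1) (2 * x) x := by
        simpa using ((hasDerivAt_id x).pow 2).add_const 1
      have h3 := (hasDerivAt_const x (-1 : ℝ)).div h2 (by positivity)
      refine h3.congr_deriv ?_
      rw [smul_eq_mul]
      ring
    have hlim : Tendsto (fun y : ℝ => -1 / (y ^ 2 + 1)) atTop (𝓝 0) := by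
      refine Tendsto.div_atTop tendsto_const_nhds ?_
      exact tendsto_atTop_add_const_right _ _ (tendsto_pow_atTop two_ne_zero)
    rw [integral_Ioi_of_hasDerivAt_of_nonneg' hd ?_ hlim]
    · norm_num
    · intro x hx
      have : (0 : ℝ) < x := hx
      positivity
  rw [h1, Measure.real, Complex.volume_ball]
  simp

/-- Against the Laplacian of a test function, the regularised logarithm acts as an average at scale
`s` around its centre. -/
lemma integral_regLog_planeLap (a : ℂ) {s : ℝ} (hs : 0 < s) {g : ℂ → ℂ} (hg : ContDiff ℝ 2 g)
    (hgc : HasCompactSupport g) :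
    ∫ w, regLog a s w • planeLap g w = ∫ v : ℂ, (2 / (‖v‖ ^ 2 + 1) ^ 2) • g (s • v + a) := by
  rw [integral_smul_planeLap hg hgc fun x _ => (contDiff_regLog a hs.ne').contDiffAt]
  simp_rw [laplacian_regLog a hs.ne']
  rw [← integral_add_right_eq_self _ a]
  have h := Measure.integral_comp_smul (volume : Measure ℂ)
    (fun w : ℂ => (2 * s ^ 2 / (‖w + a - a‖ ^ 2 + s ^ 2) ^ 2) • g (w + a)) s
  rw [Complex.finrank_real_complex, abs_of_nonneg (by positivity)] at h
  have h2 := congrArg (fun x : ℂ => (s ^ 2 : ℝ) • x) h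
  simp only [smul_smul] at h2
  rw [mul_inv_cancel₀ (by positivity), one_smul] at h2
  rw [← h2, ← integral_smul]
  refine integral_congr_ae (Eventually.of_forall fun v => ?_)
  simp only [smul_smul]
  congr 1
  rw [add_sub_cancel_right, norm_smul, Real.norm_of_nonneg hs.le]
  have : (0 : ℝ) < ‖v‖ ^ 2 + 1 := by positivity
  field_simp

lemma abs_log_norm_le_logPow (u : ℂ) : |Real.log ‖u‖| ≤ logPow 1 u + ‖u‖ := by
  by_cases h : ‖u‖ < 1
  · have : logPow 1 u = |Real.log ‖u‖| := by
      rw [logPow, Set.indicator_of_mem (by simpa using h), pow_one]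
    rw [this]
    linarith [norm_nonneg u]
  · push Not at h
    rw [abs_of_nonneg (Real.log_nonneg h)]
    have := Real.log_le_sub_one_of_pos (lt_of_lt_of_le one_pos h)
    linarith [logPow_nonneg 1 u]

lemma abs_regLog_le {a w : ℂ} {s : ℝ} (hs : 0 < s) (hs1 : s ≤ 1) (hw : w ≠ a) :
    |regLog a s w| ≤ |Real.log ‖w - a‖| + 1 := by
  have h0 : 0 < ‖w - a‖ := norm_pos_iff.2 (sub_ne_zero.2 hw)
  have hlow : Real.log ‖w - a‖ ≤ regLog a s w := by
    have h1 := Real.log_le_log (by positivity : 0 < ‖w - a‖ ^ 2)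
      (by nlinarith : ‖w - a‖ ^ 2 ≤ ‖w - a‖ ^ 2 + s ^ 2)
    rw [Real.log_pow] at h1
    rw [regLog]
    push_cast at h1
    linarith
  have hup : regLog a s w ≤ |Real.log ‖w - a‖| + 1 := by
    have h2 : (0 : ℝ) ≤ 1 / 2 := by norm_num
    have hl2 := Real.log_two_lt_d9
    rcases le_or_gt ‖w - a‖ 1 with h | h
    · have h1 := Real.log_le_log (by positivity : 0 < ‖w - a‖ ^ 2 + s ^ 2)
        (by nlinarith : ‖w - a‖ ^ 2 + s ^ 2 ≤ 2)
      rw [regLog]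
      linarith [abs_nonneg (Real.log ‖w - a‖)]
    · have h1 := Real.log_le_log (by positivity : 0 < ‖w - a‖ ^ 2 + s ^ 2)
        (by nlinarith : ‖w - a‖ ^ 2 + s ^ 2 ≤ 2 * ‖w - a‖ ^ 2)
      rw [Real.log_mul two_ne_zero (by positivity), Real.log_pow] at h1
      rw [regLog]
      push_cast at h1
      linarith [le_abs_self (Real.log ‖w - a‖)]
  rw [abs_le]
  exact ⟨by linarith [neg_abs_le (Real.log ‖w - a‖)], hup⟩

lemma integrable_log_norm_sub_smul (a : ℂ) {h : ℂ → ℂ} (hh : Continuous h)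
    (hc : HasCompactSupport h) : Integrable fun w => |Real.log ‖w - a‖| * ‖h w‖ := by
  obtain ⟨B, hB⟩ := hh.bounded_above_of_compact_support hc
  have h1 : Integrable fun w => logPow 1 (w - a) * ‖h w‖ :=
    ((integrable_logPow 1).comp_sub_right a).mul_bdd (c := B) hh.norm.aestronglyMeasurable
      (Eventually.of_forall fun w => by simpa using hB w)
  have h2 : Integrable fun w => ‖w - a‖ * ‖h w‖ :=
    (by fun_prop : Continuous fun w => ‖w - a‖ * ‖h w‖).integrable_of_hasCompactSupport
      hc.norm.mul_left
  have hm : Measurable fun w : ℂ => |Real.log ‖w - a‖| :=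
    (Real.measurable_log.comp (by fun_prop)).abs
  refine (h1.add h2).mono' (hm.aestronglyMeasurable.mul hh.norm.aestronglyMeasurable) (Eventually.of_forall fun w => ?_)
  rw [Real.norm_of_nonneg (by positivity), Pi.add_apply, ← add_mul]
  exact mul_le_mul_of_nonneg_right (abs_log_norm_le_logPow _) (norm_nonneg _)

/-- `(2π)⁻¹ log ‖· - a‖` is a fundamental solution of the Laplacian. -/
lemma integral_log_norm_sub_planeLap (a : ℂ) {g : ℂ → ℂ} (hg : ContDiff ℝ 2 g)
    (hgc : HasCompactSupport g) :
    ∫ w, Real.log ‖w - a‖ • planeLap g w = (2 * Real.pi) • g a := by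
  set s : ℕ → ℝ := fun n => 1 / ((n : ℝ) + 1) with hs
  have hs0 : ∀ n, 0 < s n := fun n => by positivity
  have hs1 : ∀ n, s n ≤ 1 := fun n => by
    rw [hs]; exact (div_le_one (by positivity)).2 (by linarith [(Nat.cast_nonneg n : (0 : ℝ) ≤ n)])
  have hslim : Tendsto s atTop (𝓝 0) := tendsto_one_div_add_atTop_nhds_zero_nat
  have hLc := continuous_planeLap hg
  have hLs : HasCompactSupport (planeLap g) :=
    HasCompactSupport.of_support_subset_isCompact hgc
      ((subset_tsupport _).trans (tsupport_planeLap_subset g))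
  have hne : ∀ᵐ w : ℂ, w ≠ a := by
    have : ∀ᵐ w : ℂ, w ∉ ({a} : Set ℂ) :=
      (measure_eq_zero_iff_ae_notMem).1 (measure_singleton a)
    simpa using this
  have lim1 : Tendsto (fun n => ∫ w, regLog a (s n) w • planeLap g w) atTop
      (𝓝 (∫ w, Real.log ‖w - a‖ • planeLap g w)) := by
    refine tendsto_integral_of_dominated_convergence
      (fun w => |Real.log ‖w - a‖| * ‖planeLap g w‖ + ‖planeLap g w‖) ?_
      ((integrable_log_norm_sub_smul a hLc hLs).add
        (hLc.integrable_of_hasCompactSupport hLs).norm) ?_ ?_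
    · intro n
      exact ((contDiff_regLog a (hs0 n).ne').continuous.smul hLc).aestronglyMeasurable
    · intro n
      filter_upwards [hne] with w hw
      rw [norm_smul, Real.norm_eq_abs, ← add_one_mul]
      exact mul_le_mul_of_nonneg_right (abs_regLog_le (hs0 n) (hs1 n) hw) (norm_nonneg _)
    · filter_upwards [hne] with w hw
      have h0 : 0 < ‖w - a‖ := norm_pos_iff.2 (sub_ne_zero.2 hw)
      refine Tendsto.smul ?_ tendsto_const_nhds
      have h1 : Tendsto (fun n => ‖w - a‖ ^ 2 + s n ^ 2) atTop (𝓝 (‖w - a‖ ^ 2 + 0 ^ 2)) :=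
        tendsto_const_nhds.add (hslim.pow 2)
      have h2 := (h1.log (by positivity)).const_mul (1 / 2)
      have h3 : 1 / 2 * Real.log (‖w - a‖ ^ 2 + 0 ^ 2) = Real.log ‖w - a‖ := by
        rw [zero_pow two_ne_zero, add_zero, Real.log_pow]
        push_cast
        ring
      rw [h3] at h2
      exact h2
  have lim2 : Tendsto (fun n => ∫ w, regLog a (s n) w • planeLap g w) atTop
      (𝓝 (∫ v : ℂ, (2 / (‖v‖ ^ 2 + 1) ^ 2 : ℝ) • g a)) := by
    simp_rw [integral_regLog_planeLap a (hs0 _) hg hgc]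
    obtain ⟨B, hB⟩ := hg.continuous.bounded_above_of_compact_support hgc
    have hint : Integrable fun v : ℂ => (2 / (‖v‖ ^ 2 + 1) ^ 2 : ℝ) := by
      by_contra h
      have := integral_undef h
      rw [integral_inv_one_add_sq_sq] at this
      linarith [Real.pi_pos]
    have hcont : Continuous fun v : ℂ => (2 / (‖v‖ ^ 2 + 1) ^ 2 : ℝ) :=
      continuous_const.div (by fun_prop) fun v => by positivity
    refine tendsto_integral_of_dominated_convergence (fun v => (2 / (‖v‖ ^ 2 + 1) ^ 2) * B) ?_
      (hint.mul_const B) ?_ ?_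
    · intro n
      exact (hcont.smul (hg.continuous.comp (by fun_prop))).aestronglyMeasurable
    · intro n
      refine Eventually.of_forall fun v => ?_
      rw [norm_smul, Real.norm_of_nonneg (by positivity)]
      exact mul_le_mul_of_nonneg_left (hB _) (by positivity)
    · refine Eventually.of_forall fun v => tendsto_const_nhds.smul ?_
      have h1 : Tendsto (fun n => s n • v + a) atTop (𝓝 ((0 : ℝ) • v + a)) :=
        (hslim.smul_const v).add_const a
      rw [zero_smul, zero_add] at h1
      exact (hg.continuous.tendsto a).comp h1
  have := tendsto_nhds_unique lim1 lim2
  rw [this, integral_smul_const, integral_inv_one_add_sq_sq]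

/-- **Green's formula** for the zeros of an analytic function `f` on a disk: a sum over zeros is an
integral against `log ‖f‖`. -/
lemma sum_zeros_eq_integral_log {f : ℂ → ℂ} {z : ℂ} {R : ℝ}
    (hf : AnalyticOnNhd ℂ f (Metric.ball z R)) {w₀ : ℂ} (hw₀ : w₀ ∈ Metric.ball z R)
    (hne : f w₀ ≠ 0) {K : Set ℂ} (hK : IsCompact K) (hKU : K ⊆ Metric.ball z R)
    {Z : Finset ℂ} (hZ : ∀ w, w ∈ Z ↔ w ∈ K ∧ analyticOrderNatAt f w ≠ 0)
    {g : ℂ → ℂ} (hg : ContDiff ℝ 2 g) (hgK : ∀ w ∉ K, g w = 0) :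
    (2 * Real.pi) • ∑ a ∈ Z, (analyticOrderNatAt f a : ℂ) * g a =
      ∫ w, Real.log ‖f w‖ • planeLap g w := by
  obtain ⟨Z', q, hZ', hq, hq0, hfq⟩ := exists_factorization hf hw₀ hne hK hKU
  have hZZ : Z' = Z := Finset.ext fun w => by rw [hZ', hZ]
  subst hZZ
  have hts : tsupport g ⊆ K := closure_minimal (fun w hw => by
    by_contra h; exact hw (hgK w h)) hK.isClosed
  have hgc : HasCompactSupport g :=
    HasCompactSupport.of_support_subset_isCompact hK ((subset_tsupport _).trans hts)
  have hLc := continuous_planeLap hg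
  have hLt := tsupport_planeLap_subset g
  have hLs : HasCompactSupport (planeLap g) :=
    HasCompactSupport.of_support_subset_isCompact hgc ((subset_tsupport _).trans hLt)
  have hharm : ∀ x ∈ tsupport g, InnerProductSpace.HarmonicAt (fun w => Real.log ‖q w‖) x :=
    fun x hx => (hq x (hKU (hts hx))).harmonicAt_log_norm (hq0 x (hts hx))
  have hqi : Integrable fun w => Real.log ‖q w‖ • planeLap g w :=
    integrable_smul_of_tsupport hgc hLc hLt fun x hx => (hharm x hx).1.continuousAt
  have hai : ∀ a : ℂ, Integrable fun w => Real.log ‖w - a‖ • planeLap g w := fun a => by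
    refine (integrable_log_norm_sub_smul a hLc hLs).mono'
      (((Real.measurable_log.comp (by fun_prop)).aestronglyMeasurable).smul
        hLc.aestronglyMeasurable) (Eventually.of_forall fun w => ?_)
    rw [norm_smul, Real.norm_eq_abs]
  have hae : ∀ᵐ w : ℂ, Real.log ‖f w‖ • planeLap g w =
      (∑ a ∈ Z', (analyticOrderNatAt f a : ℝ) • (Real.log ‖w - a‖ • planeLap g w)) +
        Real.log ‖q w‖ • planeLap g w := by
    have : ∀ᵐ w : ℂ, w ∉ (Z' : Set ℂ) :=
      (measure_eq_zero_iff_ae_notMem).1 (Z'.finite_toSet.measure_zero volume)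
    filter_upwards [this] with w hwZ
    by_cases hw : w ∈ tsupport g
    · have hwZ' : w ∉ Z' := by simpa using hwZ
      have hne : ∀ a ∈ Z', ‖(w - a) ^ analyticOrderNatAt f a‖ ≠ 0 := fun a ha => by
        rw [norm_ne_zero_iff]
        exact pow_ne_zero _ (sub_ne_zero.2 fun h => hwZ' (h ▸ ha))
      rw [hfq w, norm_mul, norm_prod, Real.log_mul (Finset.prod_ne_zero_iff.2 hne)
        (norm_ne_zero_iff.2 (hq0 w (hts hw))), Real.log_prod hne, add_smul, Finset.sum_smul]
      congr 1
      refine Finset.sum_congr rfl fun a _ => ?_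
      rw [norm_pow, Real.log_pow, smul_smul]
    · have h0 : planeLap g w = 0 := image_eq_zero_of_notMem_tsupport fun h => hw (hLt h)
      simp [h0]
  have hai' : ∀ a ∈ Z', Integrable fun w =>
      (analyticOrderNatAt f a : ℝ) • (Real.log ‖w - a‖ • planeLap g w) := fun a _ =>
    (hai a).smul (analyticOrderNatAt f a : ℝ)
  rw [integral_congr_ae hae, integral_add (integrable_finsetSum _ hai') hqi,
    integral_finsetSum _ hai', integral_smul_planeLap_of_harmonic hg hgc hharm, add_zero, Finset.smul_sum]
  refine Finset.sum_congr rfl fun a _ => ?_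
  rw [integral_smul, integral_log_norm_sub_planeLap a hg hgc, smul_comm]
  simp

/-! ### Green's formula for tuples of zeros -/

/-- The Laplacian of a function on `ℂᵏ` in its `j`-th coordinate. -/
noncomputable def lapAt {k : ℕ} (j : Fin k) (G : (Fin k → ℂ) → ℂ) : (Fin k → ℂ) → ℂ := fun w =>
  dirDeriv (coordVec (j, false)) (dirDeriv (coordVec (j, false)) G) w +
    dirDeriv (coordVec (j, true)) (dirDeriv (coordVec (j, true)) G) w

/-- The composition `Δ₁ ⋯ Δₖ` of the Laplacians in all coordinates. -/
noncomputable def lapAll {k : ℕ} (G : (Fin k → ℂ) → ℂ) : (Fin k → ℂ) → ℂ :=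
  (List.finRange k).foldl (fun H j => lapAt j H) G

section Slices

variable {k : ℕ}

lemma dirDeriv_slice_tail (H : (Fin (k + 1) → ℂ) → ℂ) (v : Fin k → ℂ) (x : ℂ) (w : Fin k → ℂ) :
    dirDeriv (Fin.cons 0 v : Fin (k + 1) → ℂ) H (Fin.cons x w) =
      dirDeriv v (fun w => H (Fin.cons x w)) w := by
  simp only [dirDeriv, lineDeriv]
  congr 1
  funext t
  congr 1
  funext j
  refine Fin.cases ?_ (fun i => ?_) j <;> simp

lemma dirDeriv_slice_head (H : (Fin (k + 1) → ℂ) → ℂ) (v : ℂ) (x : ℂ) (w : Fin k → ℂ) :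
    dirDeriv (Fin.cons v 0 : Fin (k + 1) → ℂ) H (Fin.cons x w) =
      dirDeriv v (fun x => H (Fin.cons x w)) x := by
  simp only [dirDeriv, lineDeriv]
  congr 1
  funext t
  congr 1
  funext j
  refine Fin.cases ?_ (fun i => ?_) j <;> simp

lemma coordVec_succ (j : Fin k) (b : Bool) :
    (coordVec (j.succ, b) : Fin (k + 1) → ℂ) = Fin.cons 0 (coordVec (j, b)) := by
  funext i
  refine Fin.cases ?_ (fun i => ?_) i
  · simp [coordVec]
  · simp [coordVec, Pi.single_apply]

lemma coordVec_zero (b : Bool) :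
    (coordVec (0, b) : Fin (k + 1) → ℂ) = Fin.cons (if b then Complex.I else 1) 0 := by
  funext i
  refine Fin.cases ?_ (fun i => ?_) i
  · simp [coordVec]
  · simp [coordVec]

lemma lapAt_slice_tail (H : (Fin (k + 1) → ℂ) → ℂ) (j : Fin k) (x : ℂ) (w : Fin k → ℂ) :
    lapAt j.succ H (Fin.cons x w) = lapAt j (fun w => H (Fin.cons x w)) w := by
  simp only [lapAt, coordVec_succ, dirDeriv_slice_tail]

lemma lapAt_slice_head (H : (Fin (k + 1) → ℂ) → ℂ) (x : ℂ) (w : Fin k → ℂ) :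
    lapAt 0 H (Fin.cons x w) = planeLap (fun x => H (Fin.cons x w)) x := by
  simp only [lapAt, coordVec_zero, dirDeriv_slice_head, planeLap]
  simp

lemma foldl_lapAt_slice (l : List (Fin k)) (H : (Fin (k + 1) → ℂ) → ℂ) (x : ℂ) (w : Fin k → ℂ) :
    (l.map Fin.succ).foldl (fun H j => lapAt j H) H (Fin.cons x w) =
      l.foldl (fun H j => lapAt j H) (fun w => H (Fin.cons x w)) w := by
  induction l generalizing H with
  | nil => rfl
  | cons j l ih =>
    rw [List.map_cons, List.foldl_cons, List.foldl_cons, ih]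
    simp only [lapAt_slice_tail]

lemma lapAll_cons (G : (Fin (k + 1) → ℂ) → ℂ) (x : ℂ) (w : Fin k → ℂ) :
    lapAll G (Fin.cons x w) = lapAll (fun w => lapAt 0 G (Fin.cons x w)) w := by
  rw [lapAll, List.finRange_succ, List.foldl_cons, foldl_lapAt_slice]
  rfl

end Slices

section Regularity

variable {k : ℕ}

lemma contDiff_lapAt {n : ℕ} (j : Fin k) {G : (Fin k → ℂ) → ℂ} (hG : ContDiff ℝ (n + 2 : ℕ) G) :
    ContDiff ℝ n (lapAt j G) := by
  have h : ∀ v : Fin k → ℂ, ContDiff ℝ n (dirDeriv v (dirDeriv v G)) := fun v =>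
    contDiff_dirDeriv (contDiff_dirDeriv (n := n + 1) hG v) v
  exact (h _).add (h _)

lemma contDiff_foldl_lapAt {n : ℕ} (l : List (Fin k)) {G : (Fin k → ℂ) → ℂ}
    (hG : ContDiff ℝ (n + 2 * l.length : ℕ) G) :
    ContDiff ℝ n (l.foldl (fun H j => lapAt j H) G) := by
  induction l generalizing G with
  | nil => simpa using hG
  | cons j l ih =>
    rw [List.foldl_cons]
    refine ih (contDiff_lapAt j ?_)
    rw [List.length_cons, mul_add, mul_one, ← add_assoc] at hG
    exact hG

lemma continuous_lapAll {G : (Fin k → ℂ) → ℂ} (hG : ContDiff ℝ (2 * k : ℕ) G) :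
    Continuous (lapAll G) := by
  refine (contDiff_foldl_lapAt (n := 0) (List.finRange k) ?_).continuous
  simpa using hG

lemma lapAt_eq_zero {G : (Fin k → ℂ) → ℂ} {S : Set (Fin k → ℂ)} (hS : IsClosed S)
    (hG : ∀ w ∉ S, G w = 0) (j : Fin k) : ∀ w ∉ S, lapAt j G w = 0 := by
  intro w hw
  have h : ∀ v : Fin k → ℂ, dirDeriv v (dirDeriv v G) w = 0 := fun v =>
    dirDeriv_eq_zero_of_isOpen hS.isOpen_compl
      (dirDeriv_eq_zero_of_isOpen hS.isOpen_compl hG v) v w hw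
  simp [lapAt, h]

lemma lapAll_eq_zero {G : (Fin k → ℂ) → ℂ} {S : Set (Fin k → ℂ)} (hS : IsClosed S)
    (hG : ∀ w ∉ S, G w = 0) : ∀ w ∉ S, lapAll G w = 0 := by
  rw [lapAll]
  generalize List.finRange k = l
  induction l generalizing G with
  | nil => exact hG
  | cons j l ih => exact ih (lapAt_eq_zero hS hG j)

end Regularity

lemma sum_piFinset_succ {k : ℕ} {M : Type*} [AddCommMonoid M] (Z : Fin (k + 1) → Finset ℂ)
    (f : (Fin (k + 1) → ℂ) → M) :
    ∑ w ∈ Fintype.piFinset Z, f w =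
      ∑ x ∈ Z 0, ∑ w ∈ Fintype.piFinset (fun j => Z j.succ), f (Fin.cons x w) := by
  rw [← Finset.sum_product']
  refine Finset.sum_bij' (fun w _ => (w 0, fun j => w j.succ))
    (fun p _ => Fin.cons p.1 p.2) ?_ ?_ ?_ ?_ ?_
  · intro w hw
    rw [Fintype.mem_piFinset] at hw
    simp [hw]
  · rintro ⟨x, w⟩ hp
    simp only [Finset.mem_product, Fintype.mem_piFinset] at hp ⊢
    intro j
    refine Fin.cases ?_ (fun i => ?_) j
    · simpa using hp.1
    · simpa using hp.2 i
  · intro w _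
    exact Fin.cons_self_tail w
  · rintro ⟨x, w⟩ _
    simp
  · intro w _
    simp only
    congr 1
    exact (Fin.cons_self_tail w).symm

/-- A product of locally integrable functions of the coordinates, times a bounded function supported
in a product of compact sets, is integrable. -/
lemma integrable_prod_smul {k : ℕ} {S : Fin k → Set ℂ} (hS : ∀ j, IsCompact (S j))
    {u : Fin k → ℂ → ℝ} (hu : ∀ j, IntegrableOn (u j) (S j)) {H : (Fin k → ℂ) → ℂ}
    (hH : Continuous H) (hHS : ∀ w ∉ Set.univ.pi S, H w = 0) :
    Integrable fun w : Fin k → ℂ => (∏ j, u j (w j)) • H w := by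
  have hc : HasCompactSupport H :=
    HasCompactSupport.of_support_subset_isCompact (isCompact_univ_pi hS) fun w hw => by
      by_contra h; exact hw (hHS w h)
  obtain ⟨B, hB⟩ := hH.bounded_above_of_compact_support hc
  have h1 : Integrable fun w : Fin k → ℂ => ∏ j, (S j).indicator (u j) (w j) :=
    Integrable.fintype_prod fun j => (integrable_indicator_iff (hS j).measurableSet).2 (hu j)
  have h2 : Integrable fun w : Fin k → ℂ => (∏ j, (S j).indicator (u j) (w j)) • H w :=
    h1.smul_bdd B hH.aestronglyMeasurable (Eventually.of_forall hB)
  refine h2.congr (Eventually.of_forall fun w => ?_)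
  by_cases hw : w ∈ Set.univ.pi S
  · simp only
    congr 1
    exact Finset.prod_congr rfl fun j _ => Set.indicator_of_mem (hw j trivial) _
  · simp [hHS w hw]

/-- The integral formula for sums over tuples, from one-variable integral formulas for sums of
weights. -/
lemma sum_piFinset_eq_integral {k : ℕ} (Z : Fin k → Finset ℂ) (m : Fin k → ℂ → ℂ)
    (u : Fin k → ℂ → ℝ) (S : Fin k → Set ℂ) (hS : ∀ j, IsCompact (S j))
    (hu : ∀ j, IntegrableOn (u j) (S j))
    (hgreen : ∀ j, ∀ g : ℂ → ℂ, ContDiff ℝ 2 g → (∀ w ∉ S j, g w = 0) →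
      (2 * Real.pi) • ∑ a ∈ Z j, m j a * g a = ∫ w, u j w • planeLap g w)
    {G : (Fin k → ℂ) → ℂ} (hG : ContDiff ℝ (2 * k : ℕ) G) (hGS : ∀ w ∉ Set.univ.pi S, G w = 0) :
    (2 * Real.pi) ^ k • ∑ w ∈ Fintype.piFinset Z, (∏ j, m j (w j)) * G w =
      ∫ w, (∏ j, u j (w j)) • lapAll G w := by
  induction k with
  | zero =>
    rw [volume_pi, Measure.pi_of_empty (x := isEmptyElim)]
    simp [lapAll, Subsingleton.elim (isEmptyElim : Fin 0 → ℂ) finZeroElim]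
    congr 1
    exact Subsingleton.elim _ _
  | succ k ih =>
    have hclosed : IsClosed (Set.univ.pi S) := (isCompact_univ_pi hS).isClosed
    have hcons : Continuous fun p : ℂ × (Fin k → ℂ) => (Fin.cons p.1 p.2 : Fin (k + 1) → ℂ) := by
      fun_prop
    have hL0 : ContDiff ℝ (2 * k : ℕ) (lapAt 0 G) := contDiff_lapAt 0 hG
    have hL0S : ∀ w ∉ Set.univ.pi S, lapAt 0 G w = 0 := lapAt_eq_zero hclosed hGS 0
    have hcd1 : ∀ x : ℂ, ContDiff ℝ (2 * k : ℕ)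
        fun w : Fin k → ℂ => (Fin.cons x w : Fin (k + 1) → ℂ) := fun x => by
      rw [contDiff_pi]
      intro j
      refine Fin.cases ?_ (fun i => ?_) j
      · simpa using contDiff_const
      · simpa using contDiff_apply ℝ ℂ i
    have hcd2 : ∀ w : Fin k → ℂ, ContDiff ℝ (2 * (k + 1) : ℕ)
        fun x : ℂ => (Fin.cons x w : Fin (k + 1) → ℂ) := fun w => by
      rw [contDiff_pi]
      intro j
      refine Fin.cases ?_ (fun i => ?_) j
      · simpa using contDiff_fun_id
      · simpa using contDiff_const
    have hint := integrable_prod_smul hS hu (continuous_lapAll hG)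
      (lapAll_eq_zero hclosed hGS)
    have hmp := (volume_preserving_piFinSuccAbove (fun _ : Fin (k + 1) => ℂ) 0).symm
    rw [← hmp.integral_comp (MeasurableEquiv.measurableEmbedding _)]
    have hint' := (hmp.integrable_comp_emb (MeasurableEquiv.measurableEmbedding _)).2 hint
    simp only [Function.comp_def] at hint'
    rw [Measure.volume_eq_prod, integral_prod _ hint']
    have hslice : ∀ x : ℂ, ∀ w : Fin k → ℂ, (w ∉ Set.univ.pi fun j => S j.succ) →
        lapAt 0 G (Fin.cons x w) = 0 := by
      intro x w hw
      refine hL0S _ fun h => hw ?_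
      intro j _
      simpa using h j.succ trivial
    have hinner : ∀ x : ℂ,
        ∫ w : Fin k → ℂ, (∏ j, u j ((MeasurableEquiv.piFinSuccAbove (fun _ => ℂ) 0).symm
            (x, w) j)) • lapAll G ((MeasurableEquiv.piFinSuccAbove (fun _ => ℂ) 0).symm (x, w)) =
          u 0 x • ((2 * Real.pi) ^ k • ∑ w ∈ Fintype.piFinset fun j => Z j.succ,
            (∏ j, m j.succ (w j)) * lapAt 0 G (Fin.cons x w)) := by
      intro x
      rw [ih (fun j => Z j.succ) (fun j => m j.succ) (fun j => u j.succ) (fun j => S j.succ)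
        (fun j => hS j.succ) (fun j => hu j.succ) (fun j => hgreen j.succ)
        (G := fun w => lapAt 0 G (Fin.cons x w)) (hL0.comp (hcd1 x)) (hslice x), ← integral_smul]
      refine integral_congr_ae (Eventually.of_forall fun w => ?_)
      have e : (MeasurableEquiv.piFinSuccAbove (fun _ : Fin (k + 1) => ℂ) 0).symm (x, w) =
          Fin.cons x w := by
        simp [MeasurableEquiv.piFinSuccAbove, Fin.insertNthEquiv]
      simp only [e]
      rw [Fin.prod_univ_succ, lapAll_cons, mul_smul]
      simp
    simp_rw [hinner]
    have hg : ∀ w : Fin k → ℂ, ContDiff ℝ 2 fun x => G (Fin.cons x w) := fun w =>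
      (hG.comp (hcd2 w)).of_le (by norm_cast; omega)
    have hg0 : ∀ w : Fin k → ℂ, ∀ x ∉ S 0, G (Fin.cons x w) = 0 := fun w x hx =>
      hGS _ fun h => hx (by simpa using h 0 trivial)
    have hgi : ∀ w : Fin k → ℂ, Integrable fun x => u 0 x • planeLap (fun x => G (Fin.cons x w)) x := by
      intro w
      have hts : tsupport (fun x => G (Fin.cons x w)) ⊆ S 0 :=
        closure_minimal (fun x hx => by by_contra h; exact hx (hg0 w x h)) (hS 0).isClosed
      have hLt := (tsupport_planeLap_subset fun x => G (Fin.cons x w)).trans hts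
      have hLc := continuous_planeLap (hg w)
      have hcs : HasCompactSupport (planeLap fun x => G (Fin.cons x w)) :=
        HasCompactSupport.of_support_subset_isCompact (hS 0) ((subset_tsupport _).trans hLt)
      obtain ⟨B, hB⟩ := hLc.bounded_above_of_compact_support hcs
      have h1 := ((integrable_indicator_iff (hS 0).measurableSet).2 (hu 0)).smul_bdd B
        hLc.aestronglyMeasurable (Eventually.of_forall hB)
      refine h1.congr (Eventually.of_forall fun x => ?_)
      by_cases hx : x ∈ S 0
      · simp [hx]
      · simp [image_eq_zero_of_notMem_tsupport fun h => hx (hLt h)]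
    have hrhs : ∀ x : ℂ, u 0 x • ((2 * Real.pi) ^ k • ∑ w ∈ Fintype.piFinset fun j => Z j.succ,
        (∏ j, m j.succ (w j)) * lapAt 0 G (Fin.cons x w)) =
        (2 * Real.pi) ^ k • ∑ w ∈ Fintype.piFinset fun j => Z j.succ,
          (∏ j, m j.succ (w j)) * (u 0 x • planeLap (fun x => G (Fin.cons x w)) x) := by
      intro x
      rw [smul_comm, Finset.smul_sum]
      congr 1
      refine Finset.sum_congr rfl fun w _ => ?_
      rw [lapAt_slice_head, mul_smul_comm]
    simp_rw [hrhs]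
    have hgi' : ∀ w ∈ Fintype.piFinset fun j => Z j.succ, Integrable fun x =>
        (∏ j, m j.succ (w j)) * (u 0 x • planeLap (fun x => G (Fin.cons x w)) x) := fun w _ =>
      (hgi w).const_mul _
    rw [integral_smul, integral_finsetSum _ hgi']
    simp_rw [integral_const_mul]
    rw [pow_succ, mul_smul, sum_piFinset_succ, Finset.sum_comm]
    congr 1
    rw [Finset.smul_sum]
    refine Finset.sum_congr rfl fun w _ => ?_
    rw [← hgreen 0 _ (hg w) (hg0 w), mul_smul_comm, Finset.mul_sum]
    congr 1
    refine Finset.sum_congr rfl fun x _ => ?_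
    rw [Fin.prod_univ_succ]
    simp only [Fin.cons_zero, Fin.cons_succ]
    ring

lemma integrableOn_log_norm {f : ℂ → ℂ} {z : ℂ} {R : ℝ}
    (hf : AnalyticOnNhd ℂ f (Metric.ball z R)) {w₀ : ℂ} (hw₀ : w₀ ∈ Metric.ball z R)
    (hne : f w₀ ≠ 0) {K : Set ℂ} (hK : IsCompact K) (hKU : K ⊆ Metric.ball z R) :
    IntegrableOn (fun w => Real.log ‖f w‖) K := by
  obtain ⟨Z, q, hZ, hq, hq0, hfq⟩ := exists_factorization hf hw₀ hne hK hKU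
  have hae : ∀ᵐ w ∂(volume.restrict K), (∑ a ∈ Z, (analyticOrderNatAt f a : ℝ) *
      Real.log ‖w - a‖) + Real.log ‖q w‖ = Real.log ‖f w‖ := by
    rw [ae_restrict_iff' hK.measurableSet]
    have : ∀ᵐ w : ℂ, w ∉ (Z : Set ℂ) :=
      (measure_eq_zero_iff_ae_notMem).1 (Z.finite_toSet.measure_zero volume)
    filter_upwards [this] with w hwZ hw
    have hwZ' : w ∉ Z := by simpa using hwZ
    have hne : ∀ a ∈ Z, ‖(w - a) ^ analyticOrderNatAt f a‖ ≠ 0 := fun a ha => by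
      rw [norm_ne_zero_iff]
      exact pow_ne_zero _ (sub_ne_zero.2 fun h => hwZ' (h ▸ ha))
    rw [hfq w, norm_mul, norm_prod, Real.log_mul (Finset.prod_ne_zero_iff.2 hne)
      (norm_ne_zero_iff.2 (hq0 w hw)), Real.log_prod hne]
    congr 1
    refine Finset.sum_congr rfl fun a _ => ?_
    rw [norm_pow, Real.log_pow]
  refine IntegrableOn.congr_fun_ae ?_ hae
  have h1 : IntegrableOn (fun w => Real.log ‖q w‖) K := by
    refine ContinuousOn.integrableOn_compact hK fun w hw => ?_
    exact ((hq w (hKU hw)).harmonicAt_log_norm (hq0 w hw)).1.continuousAt.continuousWithinAt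
  refine Integrable.add (integrable_finsetSum _ fun a _ => Integrable.const_mul ?_ _) h1
  have h2 : IntegrableOn (fun w => logPow 1 (w - a) + ‖w - a‖) K :=
    ((integrable_logPow 1).comp_sub_right a).integrableOn.add
      ((by fun_prop : Continuous fun w : ℂ => ‖w - a‖).continuousOn.integrableOn_compact hK)
  refine h2.mono' (Real.measurable_log.comp (by fun_prop)).aestronglyMeasurable
    (Eventually.of_forall fun w => ?_)
  rw [Real.norm_eq_abs]
  exact abs_log_norm_le_logPow _

/-- The sum over tuples of zeros as a finite sum. -/
lemma rootSum_eq_sum_piFinset {k : ℕ} {f : ℂ → ℂ} {G : (Fin k → ℂ) → ℂ} {S : Fin k → Set ℂ}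
    {Z : Fin k → Finset ℂ} (hZ : ∀ j w, w ∈ Z j ↔ w ∈ S j ∧ analyticOrderNatAt f w ≠ 0)
    (hGS : ∀ w ∉ Set.univ.pi S, G w = 0) :
    rootSum f G = ∑ w ∈ Fintype.piFinset Z, (∏ j, (analyticOrderNatAt f (w j) : ℂ)) * G w := by
  refine finsum_eq_sum_of_support_subset _ fun w hw => ?_
  rw [Finset.mem_coe, Fintype.mem_piFinset]
  intro j
  have h1 := left_ne_zero_of_mul hw
  have h2 : w ∈ Set.univ.pi S := by
    by_contra h
    exact right_ne_zero_of_mul hw (hGS w h)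
  exact (hZ j _).2 ⟨h2 j trivial, by exact_mod_cast Finset.prod_ne_zero_iff.1 h1 j (Finset.mem_univ j)⟩

/-- Green's formula for the sum over all `k`-tuples of zeros. -/
theorem rootSum_eq_integral {k : ℕ} {f : ℂ → ℂ} {z : Fin k → ℂ} {ρ : ℝ} (hρ : ρ < 2)
    (hf : ∀ j, AnalyticOnNhd ℂ f (Metric.ball (z j) 2))
    (hne : ∀ j, ∃ w ∈ Metric.ball (z j) 2, f w ≠ 0) {G : (Fin k → ℂ) → ℂ}
    (hG : ContDiff ℝ (2 * k : ℕ) G)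
    (hGS : ∀ w ∉ Set.univ.pi fun j => Metric.closedBall (z j) ρ, G w = 0) :
    (2 * Real.pi) ^ k • rootSum f G = ∫ w, (∏ j, Real.log ‖f (w j)‖) • lapAll G w := by
  have hsub : ∀ j, Metric.closedBall (z j) ρ ⊆ Metric.ball (z j) 2 := fun j =>
    Metric.closedBall_subset_ball hρ
  have hfin : ∀ j, {w | w ∈ Metric.closedBall (z j) ρ ∧ analyticOrderNatAt f w ≠ 0}.Finite :=
    fun j => finite_setOf_analyticOrderNatAt_ne_zero (hf j) (isCompact_closedBall _ _) (hsub j)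
  have hZ : ∀ j w, w ∈ (hfin j).toFinset ↔
      w ∈ Metric.closedBall (z j) ρ ∧ analyticOrderNatAt f w ≠ 0 := fun j w => by simp
  choose w₀ hw₀ hfw₀ using hne
  rw [rootSum_eq_sum_piFinset (S := fun j => Metric.closedBall (z j) ρ) hZ hGS]
  exact sum_piFinset_eq_integral (fun j => (hfin j).toFinset)
    (fun _ a => (analyticOrderNatAt f a : ℂ)) (fun _ w => Real.log ‖f w‖)
    (fun j => Metric.closedBall (z j) ρ) (fun j => isCompact_closedBall _ _)
    (fun j => integrableOn_log_norm (hf j) (hw₀ j) (hfw₀ j) (isCompact_closedBall _ _) (hsub j))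
    (fun j g hg hgS => sum_zeros_eq_integral_log (hf j) (hw₀ j) (hfw₀ j) (isCompact_closedBall _ _)
      (hsub j) (hZ j) hg hgS) hG hGS

/-- If `f` vanishes identically on one of the disks, there are no zeros to sum over. -/
lemma rootSum_eq_zero {k : ℕ} {f : ℂ → ℂ} {z : Fin k → ℂ} {ρ : ℝ} (hρ : ρ < 2) (j : Fin k)
    (hf : ∀ w ∈ Metric.ball (z j) 2, f w = 0) {G : (Fin k → ℂ) → ℂ}
    (hGS : ∀ w ∉ Set.univ.pi fun j => Metric.closedBall (z j) ρ, G w = 0) :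
    rootSum f G = 0 := by
  refine finsum_eq_zero_of_forall_eq_zero fun w => ?_
  by_cases hw : w ∈ Set.univ.pi fun j => Metric.closedBall (z j) ρ
  · have hwj : w j ∈ Metric.ball (z j) 2 := Metric.closedBall_subset_ball hρ (hw j trivial)
    have h : analyticOrderAt f (w j) = ⊤ := analyticOrderAt_eq_top.2 <| by
      filter_upwards [Metric.isOpen_ball.mem_nhds hwj] with x hx using hf x hx
    rw [Finset.prod_eq_zero (Finset.mem_univ j) (by simp [analyticOrderNatAt, h]), zero_mul]
  · rw [hGS w hw, mul_zero]

/-! ### Bounds for iterated Laplacians -/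

section Bounds

variable {k : ℕ}

lemma norm_coordVec_le (p : Fin k × Bool) : ‖coordVec p‖ ≤ 1 := by
  rw [coordVec, Pi.norm_single]
  split_ifs <;> simp

lemma norm_iteratedFDeriv_dirDeriv_le {n : ℕ} {G : (Fin k → ℂ) → ℂ} (hG : ContDiff ℝ (n + 1 : ℕ) G)
    {v : Fin k → ℂ} (hv : ‖v‖ ≤ 1) {i : ℕ} (hi : i ≤ n) (x : Fin k → ℂ) :
    ‖iteratedFDeriv ℝ i (dirDeriv v G) x‖ ≤ ‖iteratedFDeriv ℝ (i + 1) G x‖ := by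
  have h1 : dirDeriv v G = (ContinuousLinearMap.apply ℝ ℂ v) ∘ fderiv ℝ G := by
    rw [dirDeriv_eq_fderiv (hG.differentiable (by simp))]
    rfl
  have h2 : ContDiffAt ℝ n (fderiv ℝ G) x :=
    (hG.fderiv_right (m := n) (by norm_cast)).contDiffAt
  rw [h1, ← norm_iteratedFDeriv_fderiv]
  refine (ContinuousLinearMap.norm_iteratedFDeriv_comp_left _ h2 (by exact_mod_cast hi)).trans ?_
  refine mul_le_of_le_one_left (norm_nonneg _) ?_
  refine ContinuousLinearMap.opNorm_le_bound _ zero_le_one fun L => ?_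
  rw [ContinuousLinearMap.apply_apply, one_mul]
  exact (L.le_opNorm v).trans (mul_le_of_le_one_right (norm_nonneg _) hv)

lemma norm_iteratedFDeriv_lapAt_le {n : ℕ} {G : (Fin k → ℂ) → ℂ} (hG : ContDiff ℝ (n + 2 : ℕ) G)
    (j : Fin k) {i : ℕ} (hi : i ≤ n) (x : Fin k → ℂ) :
    ‖iteratedFDeriv ℝ i (lapAt j G) x‖ ≤ 2 * ‖iteratedFDeriv ℝ (i + 2) G x‖ := by
  have hd : ∀ v : Fin k → ℂ, ContDiff ℝ n (dirDeriv v (dirDeriv v G)) := fun v =>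
    contDiff_dirDeriv (contDiff_dirDeriv (n := n + 1) hG v) v
  have hb : ∀ p : Fin k × Bool, ‖iteratedFDeriv ℝ i
      (dirDeriv (coordVec p) (dirDeriv (coordVec p) G)) x‖ ≤ ‖iteratedFDeriv ℝ (i + 2) G x‖ :=
    fun p => (norm_iteratedFDeriv_dirDeriv_le (contDiff_dirDeriv (n := n + 1) hG _)
      (norm_coordVec_le p) hi x).trans (norm_iteratedFDeriv_dirDeriv_le (n := n + 1) hG
        (norm_coordVec_le p) (by omega) x)
  have h1 : lapAt j G = dirDeriv (coordVec (j, false)) (dirDeriv (coordVec (j, false)) G) +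
      dirDeriv (coordVec (j, true)) (dirDeriv (coordVec (j, true)) G) := rfl
  rw [h1, iteratedFDeriv_add_apply ((hd _).of_le (by exact_mod_cast hi)).contDiffAt
    ((hd _).of_le (by exact_mod_cast hi)).contDiffAt]
  refine (norm_add_le _ _).trans ?_
  linarith [hb (j, false), hb (j, true)]

lemma norm_foldl_lapAt_le {B : ℝ} (l : List (Fin k)) {G : (Fin k → ℂ) → ℂ}
    (hG : ContDiff ℝ (2 * l.length : ℕ) G)
    (hB : ∀ a ≤ 2 * l.length, ∀ x, ‖iteratedFDeriv ℝ a G x‖ ≤ B) (x : Fin k → ℂ) :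
    ‖l.foldl (fun H j => lapAt j H) G x‖ ≤ 2 ^ l.length * B := by
  induction l generalizing G B with
  | nil => simpa using hB 0 le_rfl x
  | cons j l ih =>
    rw [List.length_cons, mul_add, mul_one] at hG hB
    rw [List.foldl_cons, List.length_cons, pow_succ, mul_assoc]
    refine ih (contDiff_lapAt j hG) fun a ha y => ?_
    refine (norm_iteratedFDeriv_lapAt_le hG j ha y).trans ?_
    exact mul_le_mul_of_nonneg_left (hB _ (by omega) y) zero_le_two

lemma norm_lapAll_le {B : ℝ} {G : (Fin k → ℂ) → ℂ} (hG : ContDiff ℝ (2 * k : ℕ) G)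
    (hB : ∀ a ≤ 2 * k, ∀ x, ‖iteratedFDeriv ℝ a G x‖ ≤ B) (x : Fin k → ℂ) :
    ‖lapAll G x‖ ≤ 2 ^ k * B := by
  have := norm_foldl_lapAt_le (List.finRange k) (G := G) (B := B) (by simpa using hG)
    (by simpa using hB) x
  rw [List.length_finRange] at this
  exact this

lemma eq_sum_coordVec (v : Fin k → ℂ) :
    v = ∑ p : Fin k × Bool, (if p.2 then (v p.1).im else (v p.1).re) • coordVec p := by
  funext i
  rw [Fintype.sum_prod_type, Finset.sum_apply]
  rw [Finset.sum_eq_single i]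
  · simp only [coordVec, Fintype.sum_bool]
    apply Complex.ext <;> simp
  · intro j _ hj
    simp [coordVec, hj.symm]
  · simp

/-- A real multilinear map is controlled by its values on the real basis vectors of `ℂᵏ`. -/
lemma norm_multilinear_le {a : ℕ} (T : ContinuousMultilinearMap ℝ (fun _ : Fin a => Fin k → ℂ) ℂ)
    {B : ℝ} (hB0 : 0 ≤ B) (hB : ∀ p : Fin a → Fin k × Bool, ‖T fun m => coordVec (p m)‖ ≤ B) :
    ‖T‖ ≤ (2 * k : ℝ) ^ a * B := by
  refine ContinuousMultilinearMap.opNorm_le_bound (by positivity) fun m => ?_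
  have h1 : T m = T fun i => ∑ p : Fin k × Bool,
      (if p.2 then (m i p.1).im else (m i p.1).re) • coordVec p :=
    congrArg T (funext fun i => eq_sum_coordVec (m i))
  rw [h1, T.map_sum]
  have h2 : ∀ p : Fin a → Fin k × Bool,
      ‖T fun i => (if (p i).2 then (m i (p i).1).im else (m i (p i).1).re) • coordVec (p i)‖ ≤
        (∏ i, ‖m i‖) * B := by
    intro p
    rw [T.map_smul_univ, norm_smul, norm_prod]
    refine mul_le_mul (Finset.prod_le_prod (fun _ _ => norm_nonneg _) fun i _ => ?_) (hB p)
      (norm_nonneg _) (Finset.prod_nonneg fun _ _ => norm_nonneg _)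
    have h3 := norm_le_pi_norm (m i) (p i).1
    split_ifs
    · exact (Complex.abs_im_le_norm _).trans h3
    · exact (Complex.abs_re_le_norm _).trans h3
  refine (norm_sum_le_of_le _ fun p _ => h2 p).trans ?_
  rw [Finset.sum_const, Finset.card_univ]
  simp only [Fintype.card_pi, Fintype.card_prod, Fintype.card_fin, Fintype.card_bool,
    Finset.prod_const, Finset.card_univ, nsmul_eq_mul]
  push_cast
  rw [mul_comm (k : ℝ) 2]
  exact le_of_eq (by ring)

lemma norm_iteratedFDeriv_le_of_gradSup {a n : ℕ} (ha : a ≤ n) {G : (Fin k → ℂ) → ℂ}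
    (hG : ContDiff ℝ n G) (h : gradSup a G ≤ 1) (x : Fin k → ℂ) :
    ‖iteratedFDeriv ℝ a G x‖ ≤ (2 * k : ℝ) ^ a * 2 := by
  refine norm_multilinear_le _ zero_le_two fun p => ?_
  have h1 := (le_iSup₂ (f := fun (x : Fin k → ℂ) (p : Fin a → Fin k × Bool) =>
    max ‖iteratedFDeriv ℝ a (fun w => (G w).re) x (fun m => coordVec (p m))‖ₑ
      ‖iteratedFDeriv ℝ a (fun w => (G w).im) x (fun m => coordVec (p m))‖ₑ) x p).trans h
  rw [max_le_iff] at h1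
  have ha' : (a : WithTop ℕ∞) ≤ n := by exact_mod_cast ha
  have hre : iteratedFDeriv ℝ a (fun w => (G w).re) x (fun m => coordVec (p m)) =
      (iteratedFDeriv ℝ a G x fun m => coordVec (p m)).re := by
    have := Complex.reCLM.iteratedFDeriv_comp_left (hG.contDiffAt (x := x)) ha'
    exact congrArg (fun T => T fun m => coordVec (p m)) this
  have him : iteratedFDeriv ℝ a (fun w => (G w).im) x (fun m => coordVec (p m)) =
      (iteratedFDeriv ℝ a G x fun m => coordVec (p m)).im := by
    have := Complex.imCLM.iteratedFDeriv_comp_left (hG.contDiffAt (x := x)) ha'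
    exact congrArg (fun T => T fun m => coordVec (p m)) this
  rw [hre, him, ← ofReal_norm, ← ofReal_norm, ENNReal.ofReal_le_one, ENNReal.ofReal_le_one,
    Real.norm_eq_abs, Real.norm_eq_abs] at h1
  refine (Complex.norm_le_abs_re_add_abs_im _).trans ?_
  linarith [h1.1, h1.2]

/-- The iterated Laplacian of a function all of whose partial derivatives are bounded by one. -/
lemma norm_lapAll_le_of_gradSup {G : (Fin k → ℂ) → ℂ} (hG : ContDiff ℝ (2 * k : ℕ) G)
    (h : ∀ a ≤ 2 * k, gradSup a G ≤ 1) (x : Fin k → ℂ) :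
    ‖lapAll G x‖ ≤ 2 ^ k * ((2 * k + 1 : ℝ) ^ (2 * k) * 2) := by
  refine norm_lapAll_le hG (fun a ha y => ?_) x
  refine (norm_iteratedFDeriv_le_of_gradSup ha hG (h a ha) y).trans ?_
  refine mul_le_mul_of_nonneg_right ?_ zero_le_two
  calc (2 * k : ℝ) ^ a ≤ (2 * k + 1 : ℝ) ^ a := by gcongr; linarith
    _ ≤ (2 * k + 1 : ℝ) ^ (2 * k) := pow_le_pow_right₀ (by linarith [(Nat.cast_nonneg k : (0 : ℝ) ≤ k)]) ha

lemma norm_le_of_gradSup {G : (Fin k → ℂ) → ℂ} (hG : ContDiff ℝ (0 : ℕ) G) (h : gradSup 0 G ≤ 1)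
    (x : Fin k → ℂ) : ‖G x‖ ≤ 2 := by
  simpa using norm_iteratedFDeriv_le_of_gradSup le_rfl hG h x

end Bounds

/-! ### A smooth truncated logarithm -/

/-- A bump function used to smooth the logarithm at the origin. -/
noncomputable def innerBump : ContDiffBump (0 : ℂ) := ⟨1 / 2, 1, by norm_num, by norm_num⟩

/-- A bump function used to cut off large values of the logarithm. -/
noncomputable def outerBump : ContDiffBump (0 : ℝ) := ⟨1, 2, by norm_num, by norm_num⟩

/-- A smooth function on the plane that equals `log ‖y‖` for `‖y‖ ≥ 1`. -/
noncomputable def smoothLog (y : ℂ) : ℝ := (1 - innerBump y) * Real.log ‖y‖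

/-- A smooth bounded function on the line that is the identity on `[-1, 1]`. -/
noncomputable def smoothCap (x : ℝ) : ℝ := x * outerBump x

/-- The logarithm `log ‖u‖`, smoothed where `‖u‖ < s` and where `|log ‖u‖| > M`. The value for
`s = 0` is immaterial for smoothness; it is `0` to agree with `Real.log 0`. -/
noncomputable def truncLog (M s : ℝ) (u : ℂ) : ℝ :=
  if s = 0 then 0 else M * smoothCap ((Real.log s + smoothLog (s⁻¹ • u)) / M)

lemma smoothLog_eq {y : ℂ} (hy : 1 ≤ ‖y‖) : smoothLog y = Real.log ‖y‖ := by
  rw [smoothLog, innerBump.zero_of_le_dist (by simpa [innerBump] using hy)]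
  simp

lemma smoothCap_eq {x : ℝ} (hx : |x| ≤ 1) : smoothCap x = x := by
  rw [smoothCap, outerBump.one_of_mem_closedBall (by simpa [outerBump] using hx), mul_one]

lemma abs_smoothCap_le (x : ℝ) : |smoothCap x| ≤ 2 := by
  rw [smoothCap, abs_mul, abs_of_nonneg outerBump.nonneg]
  rcases le_or_gt |x| 2 with h | h
  · exact (mul_le_of_le_one_right (abs_nonneg _) outerBump.le_one).trans h
  · rw [outerBump.zero_of_le_dist (by simpa [outerBump] using h.le), mul_zero]
    exact zero_le_two

lemma contDiff_smoothLog : ContDiff ℝ 3 smoothLog := by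
  rw [contDiff_iff_contDiffAt]
  intro y
  by_cases hy : y = 0
  · subst hy
    have h : smoothLog =ᶠ[𝓝 0] fun _ => 0 := by
      filter_upwards [innerBump.eventuallyEq_one] with x hx
      simp [smoothLog, hx]
    exact contDiffAt_const.congr_of_eventuallyEq h
  · exact (contDiffAt_const.sub innerBump.contDiffAt).mul
      ((contDiffAt_norm ℝ hy).log (norm_ne_zero_iff.2 hy))

lemma contDiff_smoothCap : ContDiff ℝ 3 smoothCap := contDiff_id.mul outerBump.contDiff

lemma abs_truncLog_le {M : ℝ} (hM : 0 ≤ M) (s : ℝ) (u : ℂ) : |truncLog M s u| ≤ 2 * M := by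
  rw [truncLog]
  split_ifs
  · simpa using hM
  · rw [abs_mul, abs_of_nonneg hM, mul_comm]
    exact mul_le_mul_of_nonneg_right (abs_smoothCap_le _) hM

lemma truncLog_eq {M s : ℝ} {u : ℂ} (hM : 0 < M) (hs : 0 < s) (hsu : s ≤ ‖u‖)
    (hu : |Real.log ‖u‖| ≤ M) : truncLog M s u = Real.log ‖u‖ := by
  have h1 : ‖s⁻¹ • u‖ = s⁻¹ * ‖u‖ := by rw [norm_smul, Real.norm_of_nonneg (by positivity)]
  have h2 : 1 ≤ ‖s⁻¹ • u‖ := by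
    rw [h1, inv_mul_eq_div, one_le_div hs]; exact hsu
  rw [truncLog, if_neg hs.ne', smoothLog_eq h2, h1, Real.log_mul (by positivity)
    (hs.trans_le hsu).ne', Real.log_inv, add_neg_cancel_left, smoothCap_eq]
  · field_simp
  · rw [abs_div, abs_of_pos hM, div_le_one hM]; exact hu

lemma measurable_truncLog (M : ℝ) : Measurable fun p : ℝ × ℂ => truncLog M p.1 p.2 := by
  refine Measurable.ite (measurableSet_eq_fun measurable_fst measurable_const) measurable_const ?_
  refine measurable_const.mul (contDiff_smoothCap.continuous.measurable.comp ?_)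
  refine Measurable.div_const (Measurable.add (Real.measurable_log.comp measurable_fst) ?_) M
  exact contDiff_smoothLog.continuous.measurable.comp (measurable_fst.inv.smul measurable_snd)

/-- The derivatives of the smoothed logarithm are bounded: at infinity they are homogeneous of
negative degree. -/
lemma exists_norm_iteratedFDeriv_smoothLog_le :
    ∃ C : ℝ, 1 ≤ C ∧ ∀ i, 1 ≤ i → i ≤ 3 → ∀ y, ‖iteratedFDeriv ℝ i smoothLog y‖ ≤ C := by
  have hb : ∀ i : ℕ, i ≤ 3 → ∃ C, ∀ y ∈ Metric.closedBall (0 : ℂ) 2,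
      ‖iteratedFDeriv ℝ i smoothLog y‖ ≤ C := fun i hi =>
    (isCompact_closedBall (0 : ℂ) 2).exists_bound_of_continuousOn
      (contDiff_smoothLog.continuous_iteratedFDeriv (by exact_mod_cast hi)).continuousOn
  choose! C hC using hb
  have hC0 : ∀ i ≤ 3, 0 ≤ C i := fun i hi =>
    (norm_nonneg _).trans (hC i hi 0 (Metric.mem_closedBall_self zero_le_two))
  have hCi : ∀ i, i ≤ 3 → C i ≤ 1 + ∑ i ∈ Finset.range 4, C i := fun i hi => by
    have := Finset.single_le_sum (f := C) (s := Finset.range 4) (fun j hj => hC0 j (by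
      rw [Finset.mem_range] at hj; omega)) (Finset.mem_range.2 (by omega : i < 4))
    linarith
  have hS : 0 ≤ ∑ i ∈ Finset.range 4, C i := Finset.sum_nonneg fun j hj => hC0 j (by
    rw [Finset.mem_range] at hj; omega)
  refine ⟨1 + ∑ i ∈ Finset.range 4, C i, by linarith, fun i hi1 hi3 y => ?_⟩
  rcases le_or_gt ‖y‖ 2 with hy | hy
  · exact (hC i hi3 y (by simpa using hy)).trans (hCi i hi3)
  · set t : ℝ := ‖y‖ / 2 with ht
    have ht1 : 1 ≤ t := by rw [ht]; linarith
    have ht0 : 0 < t := by linarith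
    set x : ℂ := t⁻¹ • y with hx
    have hty : t • x = y := by rw [hx, smul_smul, mul_inv_cancel₀ ht0.ne', one_smul]
    have hxn : ‖x‖ = 2 := by
      rw [hx, norm_smul, Real.norm_of_nonneg (by positivity), ht]
      field_simp
    have hloc : (fun w => smoothLog (t • w)) =ᶠ[𝓝 x] fun w => smoothLog w + Real.log t := by
      have : ∀ᶠ w in 𝓝 x, 1 < ‖w‖ :=
        continuous_norm.continuousAt.eventually (lt_mem_nhds (by change (1:ℝ) < ‖x‖; rw [hxn]; norm_num))
      filter_upwards [this] with w hw
      have h1 : ‖t • w‖ = t * ‖w‖ := by rw [norm_smul, Real.norm_of_nonneg ht0.le]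
      rw [smoothLog_eq hw.le, smoothLog_eq (by rw [h1]; nlinarith), h1,
        Real.log_mul ht0.ne' (by positivity), add_comm]
    have hcd : ContDiff ℝ i smoothLog := contDiff_smoothLog.of_le (by exact_mod_cast hi3)
    have h1 := (hloc.iteratedFDeriv ℝ i).self_of_nhds
    rw [iteratedFDeriv_comp_const_smul t hcd, fun_iteratedFDeriv_add_apply hcd.contDiffAt
      contDiffAt_const, iteratedFDeriv_const_of_ne (by omega)] at h1
    simp only [hty, Pi.zero_apply, add_zero] at h1
    have h2 := congrArg norm h1
    rw [norm_smul, Real.norm_of_nonneg (by positivity)] at h2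
    have h3 : ‖iteratedFDeriv ℝ i smoothLog y‖ ≤ t ^ i * ‖iteratedFDeriv ℝ i smoothLog y‖ :=
      le_mul_of_one_le_left (norm_nonneg _) (one_le_pow₀ ht1)
    rw [h2] at h3
    exact (h3.trans (hC i hi3 x (by simp [hxn]))).trans (hCi i hi3)

lemma exists_norm_iteratedFDeriv_smoothCap_le :
    ∃ C : ℝ, 1 ≤ C ∧ ∀ i ≤ 3, ∀ x, ‖iteratedFDeriv ℝ i smoothCap x‖ ≤ C := by
  have hcs : HasCompactSupport smoothCap := outerBump.hasCompactSupport.mul_left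
  have hb : ∀ i : ℕ, i ≤ 3 → ∃ C, ∀ x, ‖iteratedFDeriv ℝ i smoothCap x‖ ≤ C := fun i hi =>
    (contDiff_smoothCap.continuous_iteratedFDeriv (by exact_mod_cast hi))
      |>.bounded_above_of_compact_support (hcs.iteratedFDeriv i)
  choose! C hC using hb
  have hC0 : ∀ i ≤ 3, 0 ≤ C i := fun i hi => (norm_nonneg _).trans (hC i hi 0)
  have hS : 0 ≤ ∑ i ∈ Finset.range 4, C i := Finset.sum_nonneg fun j hj => hC0 j (by
    rw [Finset.mem_range] at hj; omega)
  refine ⟨1 + ∑ i ∈ Finset.range 4, C i, by linarith, fun i hi x => (hC i hi x).trans ?_⟩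
  have := Finset.single_le_sum (f := C) (s := Finset.range 4) (fun j hj => hC0 j (by
    rw [Finset.mem_range] at hj; omega)) (Finset.mem_range.2 (by omega : i < 4))
  linarith

/-- The truncated logarithm in the variable rescaled by `b`, for the truncation level `s = r b`. -/
lemma exists_contDiff_truncLog_rescaled :
    ∃ C : ℝ, 1 ≤ C ∧ ∀ M r b : ℝ, 1 ≤ M → 0 < r → 0 < b →
      ContDiff ℝ 3 (fun x : ℂ => truncLog M (r * b) (b • x)) ∧
      ∀ i ≤ 3, ∀ x, ‖iteratedFDeriv ℝ i (fun x : ℂ => truncLog M (r * b) (b • x)) x‖ ≤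
        (C * M) * (C / r) ^ i := by
  obtain ⟨C₁, hC₁1, hC₁⟩ := exists_norm_iteratedFDeriv_smoothLog_le
  obtain ⟨C₂, hC₂1, hC₂⟩ := exists_norm_iteratedFDeriv_smoothCap_le
  refine ⟨C₁ + 6 * C₂, by linarith, fun M r b hM hr hb => ?_⟩
  have hM0 : 0 < M := by linarith
  set c : ℝ := Real.log (r * b) with hc
  set φ : ℂ → ℝ := fun x => (c + smoothLog (r⁻¹ • x)) / M with hφ
  have heq : (fun x : ℂ => truncLog M (r * b) (b • x)) = fun x => M • (smoothCap ∘ φ) x := by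
    funext x
    rw [truncLog, if_neg (by positivity), smul_smul, mul_inv, mul_assoc, inv_mul_cancel₀ hb.ne',
      mul_one]
    rfl
  have hsl : ContDiff ℝ 3 fun x : ℂ => smoothLog (r⁻¹ • x) :=
    contDiff_smoothLog.comp (contDiff_const_smul _)
  have hφc : ContDiff ℝ 3 φ := (contDiff_const.add hsl).div_const M
  have hcomp : ContDiff ℝ 3 (smoothCap ∘ φ) := contDiff_smoothCap.comp hφc
  rw [heq]
  refine ⟨hcomp.const_smul M, fun i hi x => ?_⟩
  have hφi : ∀ i, 1 ≤ i → i ≤ 3 → ‖iteratedFDeriv ℝ i φ x‖ ≤ (C₁ / r) ^ i := by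
    intro i hi1 hi3
    have hi3' : (i : WithTop ℕ∞) ≤ 3 := by exact_mod_cast hi3
    have hcd : ContDiff ℝ i smoothLog := contDiff_smoothLog.of_le hi3'
    have e1 : φ = fun x => M⁻¹ • (c + smoothLog (r⁻¹ • x)) := by
      funext x; rw [hφ]; simp only [smul_eq_mul]; ring
    rw [e1, iteratedFDeriv_const_smul_apply' ((contDiff_const.add hsl).of_le hi3').contDiffAt,
      fun_iteratedFDeriv_add_apply contDiffAt_const (hsl.of_le hi3').contDiffAt,
      iteratedFDeriv_const_of_ne (by omega), iteratedFDeriv_comp_const_smul _ hcd]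
    simp only [Pi.zero_apply, zero_add]
    rw [norm_smul, norm_smul, Real.norm_of_nonneg (by positivity), Real.norm_of_nonneg
      (by positivity), div_pow, inv_pow, div_eq_inv_mul]
    refine (mul_le_of_le_one_left (by positivity) (inv_le_one_of_one_le₀ hM)).trans ?_
    refine mul_le_mul_of_nonneg_left ((hC₁ i hi1 hi3 _).trans ?_) (by positivity)
    exact le_self_pow₀ hC₁1 (by omega)
  have h1 := norm_iteratedFDeriv_comp_le contDiff_smoothCap hφc
    (by exact_mod_cast hi : (i : WithTop ℕ∞) ≤ 3) x (C := C₂) (D := C₁ / r)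
    (fun j hj => hC₂ j (hj.trans hi) _) (fun j hj1 hj => hφi j hj1 (hj.trans hi))
  rw [iteratedFDeriv_const_smul_apply' (hcomp.of_le (by exact_mod_cast hi)).contDiffAt, norm_smul,
    Real.norm_of_nonneg hM0.le]
  have hfac : ((i.factorial : ℕ) : ℝ) ≤ 6 := by
    have := Nat.factorial_le hi
    exact_mod_cast this
  have hpow : (C₁ / r) ^ i ≤ ((C₁ + 6 * C₂) / r) ^ i := by
    gcongr
    linarith
  calc M * ‖iteratedFDeriv ℝ i (smoothCap ∘ φ) x‖ ≤ M * (i.factorial * C₂ * (C₁ / r) ^ i) :=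
        mul_le_mul_of_nonneg_left h1 hM0.le
    _ ≤ M * (6 * C₂ * ((C₁ + 6 * C₂) / r) ^ i) := by gcongr
    _ = (6 * C₂) * M * ((C₁ + 6 * C₂) / r) ^ i := by ring
    _ ≤ (C₁ + 6 * C₂) * M * ((C₁ + 6 * C₂) / r) ^ i := by gcongr; linarith

/-- Products of functions of separate coordinates with geometrically bounded derivatives. -/
lemma norm_iteratedFDeriv_prod_coord_le {k : ℕ} {A a : ℝ} (hA : 0 ≤ A) (ha : 0 ≤ a)
    {f : Fin k → ℂ → ℝ} (hf : ∀ j, ContDiff ℝ 3 (f j))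
    (hb : ∀ j, ∀ i ≤ 3, ∀ x, ‖iteratedFDeriv ℝ i (f j) x‖ ≤ A * a ^ i) :
    ContDiff ℝ 3 (fun x : Fin k → ℂ => ∏ j, f j (x j)) ∧
      ∀ i ≤ 3, ∀ x, ‖iteratedFDeriv ℝ i (fun x : Fin k → ℂ => ∏ j, f j (x j)) x‖ ≤
        A ^ k * (2 ^ k * a) ^ i := by
  have hproj : ∀ j, ContDiff ℝ 3 fun x : Fin k → ℂ => f j (x j) := fun j =>
    (hf j).comp (contDiff_apply ℝ ℂ j)
  have hprojb : ∀ j, ∀ i ≤ 3, ∀ x, ‖iteratedFDeriv ℝ i (fun x : Fin k → ℂ => f j (x j)) x‖ ≤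
      A * a ^ i := by
    intro j i hi x
    have h1 := (ContinuousLinearMap.proj (R := ℝ) (φ := fun _ : Fin k => ℂ) j).iteratedFDeriv_comp_right
      (hf j) x (i := i) (by exact_mod_cast hi)
    have h2 : (fun x : Fin k → ℂ => f j (x j)) =
      f j ∘ (ContinuousLinearMap.proj (R := ℝ) (φ := fun _ : Fin k => ℂ) j) := rfl
    rw [h2, h1]
    refine (ContinuousMultilinearMap.norm_compContinuousLinearMap_le _ _).trans ?_
    refine (mul_le_of_le_one_right (norm_nonneg _) ?_).trans (hb j i hi _)
    refine Finset.prod_le_one (fun _ _ => norm_nonneg _) fun _ _ => ?_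
    exact ContinuousLinearMap.opNorm_le_bound _ zero_le_one fun v => by
      rw [one_mul]; exact norm_le_pi_norm v j
  have key : ∀ s : Finset (Fin k), ∀ i ≤ 3, ∀ x,
      ‖iteratedFDeriv ℝ i (fun x : Fin k → ℂ => ∏ j ∈ s, f j (x j)) x‖ ≤
        A ^ s.card * (2 ^ s.card * a) ^ i := by
    classical
    intro s
    induction s using Finset.induction_on with
    | empty =>
      intro i hi x
      simp only [Finset.prod_empty, Finset.card_empty, pow_zero, one_mul]
      rcases Nat.eq_zero_or_pos i with rfl | hi0
      · simp
      · rw [iteratedFDeriv_const_of_ne (by omega)]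
        simpa using pow_nonneg ha i
    | insert j s hj ih =>
      intro i hi x
      simp only [Finset.prod_insert hj, Finset.card_insert_of_notMem hj]
      have hps : ContDiff ℝ 3 fun x : Fin k → ℂ => ∏ j ∈ s, f j (x j) :=
        contDiff_prod fun j _ => hproj j
      refine (norm_iteratedFDeriv_mul_le (hproj j) hps x (by exact_mod_cast hi)).trans ?_
      have hterm : ∀ l ∈ Finset.range (i + 1), (i.choose l : ℝ) *
          ‖iteratedFDeriv ℝ l (fun x : Fin k → ℂ => f j (x j)) x‖ *
          ‖iteratedFDeriv ℝ (i - l) (fun x : Fin k → ℂ => ∏ j ∈ s, f j (x j)) x‖ ≤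
          (i.choose l : ℝ) * (A ^ (s.card + 1) * (2 ^ s.card * a) ^ i) := by
        intro l hl
        have hli : l ≤ i := by rw [Finset.mem_range] at hl; omega
        have h2 : (1 : ℝ) ≤ 2 ^ s.card := one_le_pow₀ one_le_two
        rw [mul_assoc]
        refine mul_le_mul_of_nonneg_left ?_ (by positivity)
        calc _ ≤ (A * a ^ l) * (A ^ s.card * (2 ^ s.card * a) ^ (i - l)) :=
              mul_le_mul (hprojb j l (hli.trans hi) x) (ih (i - l) (by omega) x) (norm_nonneg _)
                (by positivity)
          _ ≤ (A * (2 ^ s.card * a) ^ l) * (A ^ s.card * (2 ^ s.card * a) ^ (i - l)) := by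
              gcongr
              exact le_mul_of_one_le_left ha h2
          _ = A ^ (s.card + 1) * (2 ^ s.card * a) ^ i := by
              rw [← Nat.add_sub_cancel' hli, pow_add (2 ^ s.card * a) l (i - l),
                Nat.add_sub_cancel']
              · ring
              · omega
      refine (Finset.sum_le_sum hterm).trans (le_of_eq ?_)
      rw [← Finset.sum_mul]
      have h3 : ∑ l ∈ Finset.range (i + 1), (i.choose l : ℝ) = 2 ^ i := by
        exact_mod_cast Nat.sum_range_choose i
      rw [h3, pow_succ 2, mul_pow _ a, mul_pow (2 ^ s.card * 2) a, mul_pow]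
      ring
  refine ⟨contDiff_prod fun j _ => hproj j, fun i hi x => ?_⟩
  have := key Finset.univ i hi x
  rwa [Finset.card_univ, Fintype.card_fin] at this

/-! ### Exchanging independent summands one at a time -/

section Exchange

variable {E : Type*} [NormedAddCommGroup E] [NormedSpace ℝ E]

/-- Taylor expansion with a remainder in terms of the next derivative; the factor `1 / (n + 1)!` is
given away. -/
lemma norm_sub_taylor_le {H : E → ℝ} {n : ℕ} {L : ℝ} (hH : ContDiff ℝ (n + 1 : ℕ) H)
    (hL : ∀ x, ‖iteratedFDeriv ℝ (n + 1) H x‖ ≤ L) (x h : E) :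
    |H (x + h) - ∑ i ∈ Finset.range (n + 1),
      ((i.factorial : ℝ))⁻¹ • iteratedFDeriv ℝ i H x (fun _ => h)| ≤ L * ‖h‖ ^ (n + 1) := by
  have hL0 : 0 ≤ L := (norm_nonneg _).trans (hL x)
  rw [map_add_eq_sum_add_integral_iteratedFDeriv (f := H) (x := x) (y := h) (n := n)
    (fun t _ => by exact_mod_cast hH.contDiffAt), add_sub_cancel_left, ← Real.norm_eq_abs,
    norm_smul]
  have h1 : ‖∫ t in (0:ℝ)..1, (1 - t) ^ n • iteratedFDeriv ℝ (n + 1) H (x + t • h) fun _ => h‖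
      ≤ L * ‖h‖ ^ (n + 1) * |(1:ℝ) - 0| := by
    refine intervalIntegral.norm_integral_le_of_norm_le_const fun t ht => ?_
    rw [Set.uIoc_of_le zero_le_one] at ht
    rw [norm_smul]
    have h2 : ‖(1 - t) ^ n‖ ≤ 1 := by
      rw [norm_pow]
      refine pow_le_one₀ (norm_nonneg _) ?_
      rw [Real.norm_eq_abs, abs_le]
      constructor <;> linarith [ht.1, ht.2]
    have h3 := (iteratedFDeriv ℝ (n + 1) H (x + t • h)).le_opNorm (fun _ => h)
    simp only [Finset.prod_const, Finset.card_univ, Fintype.card_fin] at h3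
    calc _ ≤ 1 * (‖iteratedFDeriv ℝ (n + 1) H (x + t • h)‖ * ‖h‖ ^ (n + 1)) := by gcongr
      _ ≤ 1 * (L * ‖h‖ ^ (n + 1)) := by gcongr; exact hL _
      _ = _ := one_mul _
  have h4 : ‖((n.factorial : ℝ))⁻¹‖ ≤ 1 := by
    rw [norm_inv]
    refine inv_le_one_of_one_le₀ ?_
    rw [Real.norm_natCast]
    exact_mod_cast n.factorial_pos
  calc _ ≤ 1 * (L * ‖h‖ ^ (n + 1) * |(1:ℝ) - 0|) := by gcongr
    _ = _ := by norm_num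

/-- The second order Taylor polynomial of a function with scaled derivative bounds approximates to
any order between two and three. -/
lemma abs_sub_taylor_two_le {H : E → ℝ} {A a ε : ℝ} (hA : 0 ≤ A) (ha : 0 ≤ a) (hε0 : 0 ≤ ε)
    (hε1 : ε ≤ 1) (hH : ContDiff ℝ 3 H)
    (hb : ∀ i ≤ 3, ∀ x, ‖iteratedFDeriv ℝ i H x‖ ≤ A * a ^ i) (x h : E) :
    |H (x + h) - ∑ i ∈ Finset.range 3,
      ((i.factorial : ℝ))⁻¹ • iteratedFDeriv ℝ i H x (fun _ => h)| ≤
      2 * A * (a * ‖h‖) ^ (2 + ε) := by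
  have h3 := norm_sub_taylor_le (n := 2) (by exact_mod_cast hH) (hb 3 le_rfl) x h
  have h2 := norm_sub_taylor_le (n := 1) (hH.of_le (by norm_num)) (hb 2 (by norm_num)) x h
  have hD : |((Nat.factorial 2 : ℕ) : ℝ)⁻¹ • iteratedFDeriv ℝ 2 H x (fun _ => h)| ≤
      A * a ^ 2 * ‖h‖ ^ 2 := by
    have h5 := (iteratedFDeriv ℝ 2 H x).le_opNorm (fun _ => h)
    simp only [Finset.prod_const, Finset.card_univ, Fintype.card_fin] at h5
    rw [← Real.norm_eq_abs, norm_smul]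
    calc _ ≤ 1 * (‖iteratedFDeriv ℝ 2 H x‖ * ‖h‖ ^ 2) := by
          gcongr; norm_num
      _ ≤ 1 * ((A * a ^ 2) * ‖h‖ ^ 2) := by gcongr; exact hb 2 (by norm_num) x
      _ = _ := by ring
  set u := a * ‖h‖ with hu
  have hu0 : 0 ≤ u := by positivity
  rcases le_total u 1 with hu1 | hu1
  · refine h3.trans ?_
    have : u ^ (3 : ℝ) ≤ u ^ (2 + ε) := by
      rcases hu0.eq_or_lt with h0 | h0
      · rw [← h0, Real.zero_rpow (by norm_num), Real.zero_rpow (by positivity)]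
      · exact Real.rpow_le_rpow_of_exponent_ge h0 hu1 (by linarith)
    rw [show (3:ℝ) = (3:ℕ) by norm_num, Real.rpow_natCast] at this
    calc A * a ^ 3 * ‖h‖ ^ 3 = A * u ^ 3 := by rw [hu]; ring
      _ ≤ A * u ^ (2 + ε) := by gcongr
      _ ≤ _ := by nlinarith [mul_nonneg hA (Real.rpow_nonneg hu0 (2 + ε))]
  · have : u ^ (2 : ℝ) ≤ u ^ (2 + ε) := Real.rpow_le_rpow_of_exponent_le hu1 (by linarith)
    rw [show (2:ℝ) = (2:ℕ) by norm_num, Real.rpow_natCast] at this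
    rw [Finset.sum_range_succ, ← sub_sub]
    refine (abs_sub _ _).trans ?_
    calc _ ≤ A * a ^ 2 * ‖h‖ ^ 2 + A * a ^ 2 * ‖h‖ ^ 2 := add_le_add h2 hD
      _ = 2 * A * u ^ 2 := by rw [hu]; ring
      _ ≤ _ := by
        have : u ^ 2 ≤ u ^ (((2:ℕ):ℝ) + ε) := this
        gcongr; exact_mod_cast this

/-- Along a complex line the second order Taylor polynomial is a real quadratic polynomial in the
real and imaginary parts of the parameter. -/
lemma exists_taylor_two_eq {k : ℕ} {H : (Fin k → ℂ) → ℝ} (x v : Fin k → ℂ) (m : ℂ) :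
    ∃ c : Fin 6 → ℝ, ∀ t : ℂ, ∑ i ∈ Finset.range 3,
      ((i.factorial : ℝ))⁻¹ • iteratedFDeriv ℝ i H x (fun _ => (t - m) • v) =
        c 0 + c 1 * t.re + c 2 * t.im + c 3 * t.re ^ 2 + c 4 * (t.re * t.im) + c 5 * t.im ^ 2 := by
  set L := fderiv ℝ H x with hL
  set B := fderiv ℝ (fderiv ℝ H) x with hB
  set v' : Fin k → ℂ := Complex.I • v with hv'
  set d : Fin k → ℂ := m • v with hd
  refine ⟨![H x - L d + (B d d) / 2, L v - (B v d + B d v) / 2, L v' - (B v' d + B d v') / 2,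
    B v v / 2, (B v v' + B v' v) / 2, B v' v' / 2], fun t => ?_⟩
  have ht : (t - m) • v = t.re • v + t.im • v' - d := by
    rw [sub_smul, hv', hd]
    congr 1
    ext j
    simp only [Pi.smul_apply, Pi.add_apply, smul_eq_mul, Complex.real_smul]
    conv_lhs => rw [← Complex.re_add_im t]
    ring
  rw [ht]
  simp only [Finset.sum_range_succ, Finset.range_zero, Finset.sum_empty, zero_add,
    iteratedFDeriv_zero_apply, iteratedFDeriv_one_apply, iteratedFDeriv_two_apply]
  rw [← hL, ← hB]
  simp only [map_add, map_sub, map_smul, add_apply, sub_apply, smul_apply, smul_eq_mul]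
  simp [Nat.factorial]
  ring

end Exchange

section Moments

variable {Ω : Type*} [MeasurableSpace Ω] {P : Measure Ω}

lemma integrable_rpow_and_integral_le {X : Ω → ℂ} (hX : AEStronglyMeasurable X P) {p τ : ℝ}
    (hp : 0 ≤ p) (hτ : 0 ≤ τ) (h : ∫⁻ ω, ‖X ω‖ₑ ^ p ∂P ≤ ENNReal.ofReal τ) :
    Integrable (fun ω => ‖X ω‖ ^ p) P ∧ ∫ ω, ‖X ω‖ ^ p ∂P ≤ τ := by
  have hm : AEStronglyMeasurable (fun ω => ‖X ω‖ ^ p) P :=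
    (hX.norm.aemeasurable.pow_const p).aestronglyMeasurable
  have he : ∀ ω, ENNReal.ofReal (‖X ω‖ ^ p) = ‖X ω‖ₑ ^ p := fun ω => by
    rw [← ENNReal.ofReal_rpow_of_nonneg (norm_nonneg _) hp, ofReal_norm]
  have h0 : 0 ≤ᵐ[P] fun ω => ‖X ω‖ ^ p := Eventually.of_forall fun ω => by positivity
  constructor
  · rw [← lintegral_ofReal_ne_top_iff_integrable hm h0]
    simp_rw [he]
    exact (h.trans_lt ENNReal.ofReal_lt_top).ne
  · rw [integral_eq_lintegral_of_nonneg_ae h0 hm]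
    simp_rw [he]
    exact ENNReal.toReal_le_of_le_ofReal hτ h

lemma integral_re_im {X : Ω → ℂ} (hX : Integrable X P) :
    ∫ ω, X ω ∂P = ⟨∫ ω, (X ω).re ∂P, ∫ ω, (X ω).im ∂P⟩ := by
  apply Complex.ext
  · simpa using (integral_re hX).symm
  · simpa using (integral_im hX).symm

lemma memLp_re_im {X : Ω → ℂ} (hX : MemLp X 2 P) :
    MemLp (fun ω => (X ω).re) 2 P ∧ MemLp (fun ω => (X ω).im) 2 P :=
  ⟨hX.re, hX.im⟩

lemma integral_norm_sub_le_one [IsProbabilityMeasure P] {X : Ω → ℂ} (hX : MemLp X 2 P) {m : ℂ}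
    (h1 : ∫ ω, ‖X ω - m‖ ^ 2 ∂P = 1) : ∫ ω, ‖X ω - m‖ ∂P ≤ 1 := by
  have hXm : MemLp (fun ω => X ω - m) 2 P := hX.sub (memLp_const m)
  have hi : Integrable (fun ω => ‖X ω - m‖) P := (hXm.integrable (by norm_num)).norm
  have hi2 : Integrable (fun ω => ‖X ω - m‖ ^ 2) P := hXm.integrable_norm_pow (by norm_num)
  have h2 : ∫ ω, 2 * ‖X ω - m‖ ∂P ≤ ∫ ω, (‖X ω - m‖ ^ 2 + 1) ∂P :=
    integral_mono (hi.const_mul 2) (hi2.add (integrable_const 1)) fun ω => by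
      nlinarith [sq_nonneg (‖X ω - m‖ - 1)]
  rw [integral_const_mul, integral_add hi2 (integrable_const 1), h1] at h2
  simp at h2
  linarith

end Moments

section Exchange

variable {Ω Ω' : Type*} [MeasurableSpace Ω] [MeasurableSpace Ω'] {P : Measure Ω} {P' : Measure Ω'}
  [IsProbabilityMeasure P] [IsProbabilityMeasure P'] {k : ℕ}

lemma integrable_comp_add_smul {H : (Fin k → ℂ) → ℝ} {A : ℝ} (hH : Continuous H)
    (hb : ∀ x, |H x| ≤ A) {X : Ω → ℂ} (hX : AEStronglyMeasurable X P) (y v : Fin k → ℂ) :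
    Integrable (fun ω => H (y + X ω • v)) P := by
  refine Integrable.of_bound
    (((by fun_prop : Continuous fun t : ℂ => H (y + t • v)).comp_aestronglyMeasurable hX)) A
    (Eventually.of_forall fun ω => hb _)

/-- The mean of a smooth function of a random coefficient times a vector, expanded to second order
around `m`. The numbers `c` are the coefficients of the second order Taylor polynomial as a
polynomial in the real and imaginary part of the coefficient, so that only the moments enter. -/
lemma abs_integral_sub_taylor_le {H : (Fin k → ℂ) → ℝ} {A a ε τ : ℝ} (hA : 0 ≤ A) (ha : 0 ≤ a)
    (hε0 : 0 ≤ ε) (hε1 : ε ≤ 1) (hH : ContDiff ℝ 3 H)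
    (hb : ∀ i ≤ 3, ∀ x, ‖iteratedFDeriv ℝ i H x‖ ≤ A * a ^ i) {X : Ω → ℂ} (hX : MemLp X 2 P)
    (y v : Fin k → ℂ) (m : ℂ) (c : Fin 6 → ℝ)
    (hc : ∀ t : ℂ, ∑ i ∈ Finset.range 3, ((i.factorial : ℝ))⁻¹ •
      iteratedFDeriv ℝ i H (y + m • v) (fun _ => (t - m) • v) =
        c 0 + c 1 * t.re + c 2 * t.im + c 3 * t.re ^ 2 + c 4 * (t.re * t.im) + c 5 * t.im ^ 2)
    (hτ : 0 ≤ τ) (hmom : ∫⁻ ω, ‖X ω - m‖ₑ ^ (2 + ε) ∂P ≤ ENNReal.ofReal τ) :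
    |∫ ω, H (y + X ω • v) ∂P - (c 0 + c 1 * ∫ ω, (X ω).re ∂P + c 2 * ∫ ω, (X ω).im ∂P +
      c 3 * ∫ ω, (X ω).re ^ 2 ∂P + c 4 * ∫ ω, (X ω).re * (X ω).im ∂P +
      c 5 * ∫ ω, (X ω).im ^ 2 ∂P)| ≤ 2 * A * (a * ‖v‖) ^ (2 + ε) * τ := by
  obtain ⟨hre, him⟩ := memLp_re_im hX
  have hbound : ∀ x, |H x| ≤ A := fun x => by
    have := hb 0 (by norm_num) x
    rwa [norm_iteratedFDeriv_zero, pow_zero, mul_one] at this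
  have hi0 := integrable_comp_add_smul hH.continuous hbound hX.aestronglyMeasurable y v
  have i1 : Integrable (fun ω => c 1 * (X ω).re) P := (hre.integrable (by norm_num)).const_mul _
  have i2 : Integrable (fun ω => c 2 * (X ω).im) P := (him.integrable (by norm_num)).const_mul _
  have i3 : Integrable (fun ω => c 3 * (X ω).re ^ 2) P := hre.integrable_sq.const_mul _
  have i4 : Integrable (fun ω => c 4 * ((X ω).re * (X ω).im)) P :=
    (hre.integrable_mul him).const_mul _
  have i5 : Integrable (fun ω => c 5 * (X ω).im ^ 2) P := him.integrable_sq.const_mul _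
  have i0 : Integrable (fun _ : Ω => c 0) P := integrable_const _
  have j1 : Integrable (fun ω => c 0 + c 1 * (X ω).re) P := i0.add i1
  have j2 : Integrable (fun ω => c 0 + c 1 * (X ω).re + c 2 * (X ω).im) P := j1.add i2
  have j3 : Integrable (fun ω => c 0 + c 1 * (X ω).re + c 2 * (X ω).im +
      c 3 * (X ω).re ^ 2) P := j2.add i3
  have j4 : Integrable (fun ω => c 0 + c 1 * (X ω).re + c 2 * (X ω).im + c 3 * (X ω).re ^ 2 +
      c 4 * ((X ω).re * (X ω).im)) P := j3.add i4
  have j5 : Integrable (fun ω => c 0 + c 1 * (X ω).re + c 2 * (X ω).im + c 3 * (X ω).re ^ 2 +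
      c 4 * ((X ω).re * (X ω).im) + c 5 * (X ω).im ^ 2) P := j4.add i5
  have hT : ∫ ω, (c 0 + c 1 * (X ω).re + c 2 * (X ω).im + c 3 * (X ω).re ^ 2 +
      c 4 * ((X ω).re * (X ω).im) + c 5 * (X ω).im ^ 2) ∂P =
      c 0 + c 1 * ∫ ω, (X ω).re ∂P + c 2 * ∫ ω, (X ω).im ∂P +
      c 3 * ∫ ω, (X ω).re ^ 2 ∂P + c 4 * ∫ ω, (X ω).re * (X ω).im ∂P +
      c 5 * ∫ ω, (X ω).im ^ 2 ∂P := by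
    rw [integral_add j4 i5, integral_add j3 i4, integral_add j2 i3, integral_add j1 i2,
      integral_add i0 i1]
    simp only [integral_const_mul, integral_const, probReal_univ, one_smul]
  rw [← hT, ← integral_sub hi0 j5]
  obtain ⟨hmi, hml⟩ := integrable_rpow_and_integral_le
    (hX.aestronglyMeasurable.sub aestronglyMeasurable_const) (by positivity) hτ hmom
  rw [← Real.norm_eq_abs]
  have key : ∀ ω, ‖H (y + X ω • v) - (c 0 + c 1 * (X ω).re + c 2 * (X ω).im + c 3 * (X ω).re ^ 2 +
      c 4 * ((X ω).re * (X ω).im) + c 5 * (X ω).im ^ 2)‖ ≤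
      2 * A * (a * ‖v‖) ^ (2 + ε) * ‖X ω - m‖ ^ (2 + ε) := fun ω => by
    have h := abs_sub_taylor_two_le hA ha hε0 hε1 hH hb (y + m • v) ((X ω - m) • v)
    rw [hc, add_assoc, ← add_smul, add_sub_cancel] at h
    refine h.trans (le_of_eq ?_)
    rw [norm_smul, show a * (‖X ω - m‖ * ‖v‖) = (a * ‖v‖) * ‖X ω - m‖ by ring,
      Real.mul_rpow (by positivity) (norm_nonneg _)]
    ring
  calc _ ≤ ∫ ω, 2 * A * (a * ‖v‖) ^ (2 + ε) * ‖X ω - m‖ ^ (2 + ε) ∂P :=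
        norm_integral_le_of_norm_le (hmi.const_mul _) (Eventually.of_forall key)
    _ ≤ _ := by
      rw [integral_const_mul]
      exact mul_le_mul_of_nonneg_left hml (by positivity)

/-- Replacing one random coefficient by another one with the same moments up to order two. -/
lemma abs_integral_sub_integral_le_of_matching {H : (Fin k → ℂ) → ℝ} {A a ε τ : ℝ} (hA : 0 ≤ A)
    (ha : 0 ≤ a) (hε0 : 0 ≤ ε) (hε1 : ε ≤ 1) (hH : ContDiff ℝ 3 H)
    (hb : ∀ i ≤ 3, ∀ x, ‖iteratedFDeriv ℝ i H x‖ ≤ A * a ^ i) {X : Ω → ℂ} {X' : Ω' → ℂ}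
    (hX : MemLp X 2 P) (hX' : MemLp X' 2 P')
    (hτ : 0 ≤ τ) (hmom : ∫⁻ ω, ‖X ω - ∫ ω', X ω' ∂P‖ₑ ^ (2 + ε) ∂P ≤ ENNReal.ofReal τ)
    (hmom' : ∫⁻ ω, ‖X' ω - ∫ ω', X' ω' ∂P'‖ₑ ^ (2 + ε) ∂P' ≤ ENNReal.ofReal τ)
    (hmatch : ∀ a b : ℕ, a + b ≤ 2 →
      ∫ ω, (X ω).re ^ a * (X ω).im ^ b ∂P = ∫ ω, (X' ω).re ^ a * (X' ω).im ^ b ∂P')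
    (y v : Fin k → ℂ) :
    |∫ ω, H (y + X ω • v) ∂P - ∫ ω, H (y + X' ω • v) ∂P'| ≤
      4 * A * (a * ‖v‖) ^ (2 + ε) * τ := by
  have h10 := hmatch 1 0 (by norm_num)
  have h01 := hmatch 0 1 (by norm_num)
  have h20 := hmatch 2 0 (by norm_num)
  have h11 := hmatch 1 1 (by norm_num)
  have h02 := hmatch 0 2 (by norm_num)
  simp only [pow_one, pow_zero, mul_one, one_mul] at h10 h01 h20 h11 h02
  have hm : ∫ ω, X' ω ∂P' = ∫ ω, X ω ∂P := by
    rw [integral_re_im (hX.integrable (by norm_num)), integral_re_im (hX'.integrable (by norm_num)),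
      h10, h01]
  rw [hm] at hmom'
  obtain ⟨c, hc⟩ := exists_taylor_two_eq (H := H) (y + (∫ ω, X ω ∂P) • v) v (∫ ω, X ω ∂P)
  have e1 := abs_integral_sub_taylor_le hA ha hε0 hε1 hH hb hX y v _ c hc hτ hmom
  have e2 := abs_integral_sub_taylor_le hA ha hε0 hε1 hH hb hX' y v _ c hc hτ hmom'
  rw [← h10, ← h01, ← h20, ← h11, ← h02] at e2
  rw [abs_le] at e1 e2 ⊢
  constructor <;> linarith [e1.1, e1.2, e2.1, e2.2]

/-- First order replacement of a random coefficient by its mean. -/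
lemma abs_integral_comp_sub_le {H : (Fin k → ℂ) → ℝ} {L A : ℝ}
    (hA : ∀ x, |H x| ≤ A) (hH : ContDiff ℝ 1 H)
    (hL : ∀ x, ‖iteratedFDeriv ℝ 1 H x‖ ≤ L) {X : Ω → ℂ} (hX : MemLp X 2 P)
    (h1 : ∫ ω, ‖X ω - ∫ ω', X ω' ∂P‖ ^ 2 ∂P = 1) (y v : Fin k → ℂ) :
    |∫ ω, H (y + X ω • v) ∂P - H (y + (∫ ω, X ω ∂P) • v)| ≤ L * ‖v‖ := by
  have hlip : ∀ x h, |H (x + h) - H x| ≤ L * ‖h‖ := fun x h => by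
    simpa using norm_sub_taylor_le (n := 0) (by exact_mod_cast hH) hL x h
  have hL0 : 0 ≤ L := (norm_nonneg _).trans (hL 0)
  set m := ∫ ω, X ω ∂P with hmdef
  have hi := integrable_comp_add_smul hH.continuous hA hX.aestronglyMeasurable y v
  have hXi : Integrable (fun ω => ‖X ω - m‖) P :=
    ((hX.sub (memLp_const m)).integrable (by norm_num)).norm
  have h2 : ∫ ω, (H (y + X ω • v) - H (y + m • v)) ∂P =
      ∫ ω, H (y + X ω • v) ∂P - H (y + m • v) := by
    rw [integral_sub hi (integrable_const _)]; simp
  rw [← h2, ← Real.norm_eq_abs]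
  calc _ ≤ ∫ ω, L * ‖v‖ * ‖X ω - m‖ ∂P := by
        refine norm_integral_le_of_norm_le (hXi.const_mul _) (Eventually.of_forall fun ω => ?_)
        have h := hlip (y + m • v) ((X ω - m) • v)
        rw [add_assoc, ← add_smul, add_sub_cancel, norm_smul] at h
        rw [Real.norm_eq_abs]
        linarith
    _ ≤ L * ‖v‖ * 1 := by
        rw [integral_const_mul]
        exact mul_le_mul_of_nonneg_left (integral_norm_sub_le_one hX h1) (by positivity)
    _ = _ := mul_one _

/-- Replacing one random coefficient by another one whose mean is not too different. -/
lemma abs_integral_sub_integral_le_of_mean {H : (Fin k → ℂ) → ℝ} {L τ : ℝ} {A : ℝ}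
    (hA : ∀ x, |H x| ≤ A) (hH : ContDiff ℝ 1 H)
    (hL : ∀ x, ‖iteratedFDeriv ℝ 1 H x‖ ≤ L) {X : Ω → ℂ} {X' : Ω' → ℂ}
    (hX : MemLp X 2 P) (hX' : MemLp X' 2 P')
    (h1 : ∫ ω, ‖X ω - ∫ ω', X ω' ∂P‖ ^ 2 ∂P = 1)
    (h1' : ∫ ω, ‖X' ω - ∫ ω', X' ω' ∂P'‖ ^ 2 ∂P' = 1)
    (hm : ‖(∫ ω, X ω ∂P) - ∫ ω, X' ω ∂P'‖ ≤ τ) (y v : Fin k → ℂ) :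
    |∫ ω, H (y + X ω • v) ∂P - ∫ ω, H (y + X' ω • v) ∂P'| ≤ L * ‖v‖ * (2 + τ) := by
  have hlip : ∀ x h, |H (x + h) - H x| ≤ L * ‖h‖ := fun x h => by
    simpa using norm_sub_taylor_le (n := 0) (by exact_mod_cast hH) hL x h
  have hL0 : 0 ≤ L := (norm_nonneg _).trans (hL 0)
  have e1 := abs_integral_comp_sub_le hA hH hL hX h1 y v
  have e2 := abs_integral_comp_sub_le hA hH hL hX' h1' y v
  have e3 : |H (y + (∫ ω, X ω ∂P) • v) - H (y + (∫ ω, X' ω ∂P') • v)| ≤ L * ‖v‖ * τ := by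
    have h := hlip (y + (∫ ω, X' ω ∂P') • v) (((∫ ω, X ω ∂P) - ∫ ω, X' ω ∂P') • v)
    rw [add_assoc, ← add_smul, add_sub_cancel, norm_smul] at h
    refine h.trans ?_
    calc L * (_ * ‖v‖) ≤ L * (τ * ‖v‖) := by gcongr
      _ = _ := by ring
  rw [abs_le] at e1 e2 e3 ⊢
  constructor <;> nlinarith [e1.1, e1.2, e2.1, e2.2, e3.1, e3.2]

lemma integral_comp_add_eq_of_indepFun {E : Type*} [NormedAddCommGroup E] [MeasurableSpace E]
    [BorelSpace E] [SecondCountableTopology E] {H : E → ℝ} {A : ℝ} (hH : Continuous H)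
    (hb : ∀ x, |H x| ≤ A) {X Y : Ω → E} (hX : Measurable X) (hY : Measurable Y)
    (hind : IndepFun X Y P) (y : E) :
    ∫ ω, H (y + (X ω + Y ω)) ∂P = ∫ ω, ∫ ω', H (y + (X ω + Y ω')) ∂P ∂P := by
  have h1 := hind.map_prod_eq_prod_map_map hX.aemeasurable hY.aemeasurable
  have : IsProbabilityMeasure (P.map X) := Measure.isProbabilityMeasure_map hX.aemeasurable
  have : IsProbabilityMeasure (P.map Y) := Measure.isProbabilityMeasure_map hY.aemeasurable
  have hc : Continuous fun p : E × E => H (y + (p.1 + p.2)) := by fun_prop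
  have hi : Integrable (fun p : E × E => H (y + (p.1 + p.2))) ((P.map X).prod (P.map Y)) :=
    Integrable.of_bound hc.aestronglyMeasurable A (Eventually.of_forall fun p => hb _)
  calc ∫ ω, H (y + (X ω + Y ω)) ∂P
      = ∫ p, H (y + (p.1 + p.2)) ∂(P.map fun ω => (X ω, Y ω)) :=
        (integral_map (hX.prodMk hY).aemeasurable hc.aestronglyMeasurable).symm
    _ = ∫ x, ∫ x', H (y + (x + x')) ∂(P.map Y) ∂(P.map X) := by rw [h1, integral_prod _ hi]
    _ = ∫ ω, ∫ x', H (y + (X ω + x')) ∂(P.map Y) ∂P :=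
        integral_map hX.aemeasurable hi.aestronglyMeasurable.integral_prod_right'
    _ = _ := by
        congr with ω
        exact integral_map hY.aemeasurable
          ((by fun_prop : Continuous fun x' => H (y + (X ω + x'))).aestronglyMeasurable)

/-- Lindeberg's exchange argument: the errors made in exchanging the independent summands one at a
time add up. The two families may live on different probability spaces. -/
lemma abs_integral_sum_sub_le {E : Type*} [NormedAddCommGroup E] [MeasurableSpace E]
    [BorelSpace E] [SecondCountableTopology E] {H : E → ℝ} {A : ℝ} (hH : Continuous H)
    (hb : ∀ x, |H x| ≤ A) {ι : Type*} {X : ι → Ω → E} {X' : ι → Ω' → E}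
    (hX : ∀ i, Measurable (X i)) (hX' : ∀ i, Measurable (X' i)) (hind : iIndepFun X P)
    (hind' : iIndepFun X' P') {err : ι → ℝ}
    (herr : ∀ i y, |∫ ω, H (y + X i ω) ∂P - ∫ ω, H (y + X' i ω) ∂P'| ≤ err i)
    (s : Finset ι) (y : E) :
    |∫ ω, H (y + ∑ i ∈ s, X i ω) ∂P - ∫ ω, H (y + ∑ i ∈ s, X' i ω) ∂P'| ≤ ∑ i ∈ s, err i := by
  classical
  induction s using Finset.induction generalizing y with
  | empty => simp
  | insert j s hj ih =>
    have hS : Measurable fun ω => ∑ i ∈ s, X i ω := Finset.measurable_sum _ fun i _ => hX i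
    have hS' : Measurable fun ω => ∑ i ∈ s, X' i ω := Finset.measurable_sum _ fun i _ => hX' i
    have e1 : IndepFun (X j) (fun ω => ∑ i ∈ s, X i ω) P := by
      have := (hind.indepFun_finsetSum_of_notMem hX hj).symm
      rwa [Finset.sum_fn] at this
    have e2 : IndepFun (fun ω => ∑ i ∈ s, X' i ω) (X' j) P' := by
      have := hind'.indepFun_finsetSum_of_notMem hX' hj
      rwa [Finset.sum_fn] at this
    simp only [Finset.sum_insert hj]
    have hFub : Integrable (Function.uncurry fun ω ω' => H (y + (X j ω + ∑ i ∈ s, X' i ω')))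
        (P.prod P') := by
      refine Integrable.of_bound (hH.measurable.comp ?_).aestronglyMeasurable A
        (Eventually.of_forall fun p => hb _)
      exact measurable_const.add (((hX j).comp measurable_fst).add (hS'.comp measurable_snd))
    have hFub1 : Integrable (Function.uncurry fun ω ω' => H (y + (X j ω + ∑ i ∈ s, X i ω')))
        (P.prod P) := by
      refine Integrable.of_bound (hH.measurable.comp ?_).aestronglyMeasurable A
        (Eventually.of_forall fun p => hb _)
      exact measurable_const.add (((hX j).comp measurable_fst).add (hS.comp measurable_snd))
    have hFub2 : Integrable (Function.uncurry fun ω ω' => H (y + (∑ i ∈ s, X' i ω + X' j ω')))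
        (P'.prod P') := by
      refine Integrable.of_bound (hH.measurable.comp ?_).aestronglyMeasurable A
        (Eventually.of_forall fun p => hb _)
      exact measurable_const.add ((hS'.comp measurable_fst).add ((hX' j).comp measurable_snd))
    have g : Integrable (fun ω => ∫ ω', H (y + (X j ω + ∑ i ∈ s, X' i ω')) ∂P') P :=
      hFub.integral_prod_left
    have g' : Integrable (fun ω' => ∫ ω, H (y + (X j ω + ∑ i ∈ s, X' i ω')) ∂P) P' :=
      hFub.integral_prod_right
    have g1 : Integrable (fun ω => ∫ ω', H (y + (X j ω + ∑ i ∈ s, X i ω')) ∂P) P :=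
      hFub1.integral_prod_left
    have g2 : Integrable (fun ω => ∫ ω', H (y + (∑ i ∈ s, X' i ω + X' j ω')) ∂P') P' :=
      hFub2.integral_prod_left
    have s1 : |∫ ω, H (y + (X j ω + ∑ i ∈ s, X i ω)) ∂P -
        ∫ ω, ∫ ω', H (y + (X j ω + ∑ i ∈ s, X' i ω')) ∂P' ∂P| ≤ ∑ i ∈ s, err i := by
      rw [integral_comp_add_eq_of_indepFun hH hb (hX j) hS e1, ← integral_sub g1 g,
        ← Real.norm_eq_abs]
      refine (norm_integral_le_of_norm_le_const (C := ∑ i ∈ s, err i)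
        (Eventually.of_forall fun ω => ?_)).trans (by simp)
      have := ih (y + X j ω)
      simpa only [add_assoc, Real.norm_eq_abs] using this
    have s2 : |∫ ω, ∫ ω', H (y + (X j ω + ∑ i ∈ s, X' i ω')) ∂P' ∂P -
        ∫ ω, H (y + (X' j ω + ∑ i ∈ s, X' i ω)) ∂P'| ≤ err j := by
      have : ∫ ω, H (y + (X' j ω + ∑ i ∈ s, X' i ω)) ∂P' =
          ∫ ω, ∫ ω', H (y + (∑ i ∈ s, X' i ω + X' j ω')) ∂P' ∂P' := by
        rw [← integral_comp_add_eq_of_indepFun hH hb hS' (hX' j) e2]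
        simp only [add_comm (X' j _)]
      rw [this, integral_integral_swap hFub, ← integral_sub g' g2,
        ← Real.norm_eq_abs]
      refine (norm_integral_le_of_norm_le_const (C := err j)
        (Eventually.of_forall fun ω => ?_)).trans (by simp)
      have := herr j (y + ∑ i ∈ s, X' i ω)
      simp only [add_comm (X j _)]
      simpa only [add_assoc, Real.norm_eq_abs] using this
    rw [abs_le] at s1 s2 ⊢
    constructor <;> linarith [s1.1, s1.2, s2.1, s2.2]

end Exchange

/-! ### Small ball probabilities of sums of independent variables -/

section SmallBall

/-- The second order expansion of the exponential, with an error interpolated between orders two and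
three. -/
lemma norm_exp_mul_I_sub_le {ε : ℝ} (hε0 : 0 ≤ ε) (hε1 : ε ≤ 1) (x : ℝ) :
    ‖Complex.exp (x * Complex.I) - (1 + x * Complex.I - x ^ 2 / 2)‖ ≤ 4 * |x| ^ (2 + ε) := by
  have hxn : ‖(x : ℂ) * Complex.I‖ = |x| := by simp
  rcases le_total |x| 1 with h1 | h1
  · have h := Complex.norm_exp_sub_sum_le_norm_mul_exp (x * Complex.I) 3
    have hs : ∑ m ∈ Finset.range 3, ((x : ℂ) * Complex.I) ^ m / m.factorial =
        1 + x * Complex.I - x ^ 2 / 2 := by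
      simp only [Finset.sum_range_succ, Finset.range_zero, Finset.sum_empty, zero_add, pow_zero,
        pow_one, mul_pow, Complex.I_sq, Nat.factorial]
      push_cast
      ring
    rw [hs, hxn] at h
    refine h.trans ?_
    have he : Real.exp |x| ≤ 4 := by
      have := Real.exp_one_lt_d9
      linarith [Real.exp_le_exp.2 h1]
    have hp : |x| ^ 3 ≤ |x| ^ (2 + ε) := by
      rcases (abs_nonneg x).eq_or_lt with h0 | h0
      · rw [← h0, Real.zero_rpow (by positivity)]; norm_num
      · have := Real.rpow_le_rpow_of_exponent_ge h0 h1 (show 2 + ε ≤ (3 : ℕ) by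
          push_cast; linarith)
        rwa [Real.rpow_natCast] at this
    nlinarith [Real.exp_pos |x|, Real.rpow_nonneg (abs_nonneg x) (2 + ε)]
  · have hp : |x| ^ 2 ≤ |x| ^ (2 + ε) := by
      have := Real.rpow_le_rpow_of_exponent_le h1 (show ((2 : ℕ) : ℝ) ≤ 2 + ε by
        push_cast; linarith)
      rwa [Real.rpow_natCast] at this
    have h2 : ‖(1 : ℂ) + x * Complex.I - x ^ 2 / 2‖ ≤ 1 + |x| + |x| ^ 2 / 2 := by
      refine (norm_sub_le _ _).trans (add_le_add ((norm_add_le _ _).trans ?_) ?_)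
      · rw [hxn]; simp
      · simp
    refine (norm_sub_le _ _).trans ?_
    rw [Complex.norm_exp_ofReal_mul_I]
    nlinarith

variable {Ω : Type*} [MeasurableSpace Ω] {P : Measure Ω} [IsProbabilityMeasure P]

/-- Gaussian decay of the characteristic function of a centred variable near the origin. -/
lemma norm_integral_exp_le_of_centered {Z : Ω → ℝ} {ε β s : ℝ} (hε0 : 0 ≤ ε) (hε1 : ε ≤ 1)
    (hZ : MemLp Z 2 P) (h0 : ∫ ω, Z ω ∂P = 0) (hp : Integrable (fun ω => |Z ω| ^ (2 + ε)) P)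
    (hβ : ∫ ω, |Z ω| ^ (2 + ε) ∂P ≤ β) (hs : s ^ 2 * ∫ ω, Z ω ^ 2 ∂P ≤ 2) :
    ‖∫ ω, Complex.exp ((s * Z ω : ℝ) * Complex.I) ∂P‖ ≤
      Real.exp (-(s ^ 2 * (∫ ω, Z ω ^ 2 ∂P) / 2) + 4 * |s| ^ (2 + ε) * β) := by
  have hZ1 : Integrable Z P := hZ.integrable (by norm_num)
  have hZ2 : Integrable (fun ω => Z ω ^ 2) P := hZ.integrable_sq
  have hi1 : Integrable (fun ω => ((s * Z ω : ℝ) : ℂ) * Complex.I) P :=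
    ((hZ1.const_mul s).ofReal).mul_const _
  have hi2 : Integrable (fun ω => (((s * Z ω) ^ 2 / 2 : ℝ) : ℂ)) P := by
    have : Integrable (fun ω => (s * Z ω) ^ 2 / 2) P := by
      refine (hZ2.const_mul (s ^ 2 / 2)).congr (Eventually.of_forall fun ω => ?_)
      change s ^ 2 / 2 * Z ω ^ 2 = (s * Z ω) ^ 2 / 2
      ring
    exact this.ofReal
  have hi12 : Integrable (fun ω => (1 : ℂ) + ((s * Z ω : ℝ) : ℂ) * Complex.I) P :=
    (integrable_const 1).add hi1
  have hiq : Integrable (fun ω => (1 : ℂ) + ((s * Z ω : ℝ) : ℂ) * Complex.I -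
      (((s * Z ω) ^ 2 / 2 : ℝ) : ℂ)) P := hi12.sub hi2
  have hie : Integrable (fun ω => Complex.exp ((s * Z ω : ℝ) * Complex.I)) P := by
    refine Integrable.of_bound (C := 1) ?_ (Eventually.of_forall fun ω => ?_)
    · exact (by fun_prop : Continuous fun x : ℝ => Complex.exp ((s * x : ℝ) *
        Complex.I)).comp_aestronglyMeasurable hZ.aestronglyMeasurable
    · rw [Complex.norm_exp_ofReal_mul_I]
  have hval : ∫ ω, ((1 : ℂ) + ((s * Z ω : ℝ) : ℂ) * Complex.I - (((s * Z ω) ^ 2 / 2 : ℝ) : ℂ)) ∂P =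
      ((1 - s ^ 2 * (∫ ω, Z ω ^ 2 ∂P) / 2 : ℝ) : ℂ) := by
    rw [integral_sub hi12 hi2, integral_add (integrable_const 1) hi1, integral_mul_const,
      integral_complex_ofReal, integral_complex_ofReal, integral_const_mul, h0]
    have : ∫ ω, (s * Z ω) ^ 2 / 2 ∂P = s ^ 2 * (∫ ω, Z ω ^ 2 ∂P) / 2 := by
      rw [← integral_const_mul, ← integral_div]
      congr with ω; ring
    rw [this]
    simp
  have hdiff : ‖∫ ω, Complex.exp ((s * Z ω : ℝ) * Complex.I) ∂P -
      ((1 - s ^ 2 * (∫ ω, Z ω ^ 2 ∂P) / 2 : ℝ) : ℂ)‖ ≤ 4 * |s| ^ (2 + ε) * β := by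
    rw [← hval, ← integral_sub hie hiq]
    calc _ ≤ ∫ ω, 4 * |s| ^ (2 + ε) * |Z ω| ^ (2 + ε) ∂P := by
          refine norm_integral_le_of_norm_le (hp.const_mul _) (Eventually.of_forall fun ω => ?_)
          have h := norm_exp_mul_I_sub_le hε0 hε1 (s * Z ω)
          rw [abs_mul, Real.mul_rpow (abs_nonneg _) (abs_nonneg _), ← mul_assoc] at h
          refine le_trans (le_of_eq ?_) h
          push_cast
          rfl
      _ ≤ _ := by
          rw [integral_const_mul]
          exact mul_le_mul_of_nonneg_left hβ (by positivity)
  have hnn : ‖((1 - s ^ 2 * (∫ ω, Z ω ^ 2 ∂P) / 2 : ℝ) : ℂ)‖ =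
      1 - s ^ 2 * (∫ ω, Z ω ^ 2 ∂P) / 2 := by
    rw [Complex.norm_real, Real.norm_of_nonneg]
    linarith
  have := norm_le_insert' (∫ ω, Complex.exp ((s * Z ω : ℝ) * Complex.I) ∂P)
    ((1 - s ^ 2 * (∫ ω, Z ω ^ 2 ∂P) / 2 : ℝ) : ℂ)
  rw [hnn] at this
  have he := Real.add_one_le_exp (-(s ^ 2 * (∫ ω, Z ω ^ 2 ∂P) / 2) + 4 * |s| ^ (2 + ε) * β)
  linarith

/-- The characteristic function of the real part of `a X`, for frequencies at which `a X` is of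
order one. -/
lemma norm_charFun_re_mul_le {X : Ω → ℂ} {ε τ s : ℝ} {a : ℂ} (hε0 : 0 ≤ ε) (hε1 : ε ≤ 1)
    (hτ : 0 ≤ τ) (hX : MemLp X 2 P) (h1 : ∫ ω, ‖X ω - ∫ ω', X ω' ∂P‖ ^ 2 ∂P = 1)
    (hmom : ∫⁻ ω, ‖X ω - ∫ ω', X ω' ∂P‖ₑ ^ (2 + ε) ∂P ≤ ENNReal.ofReal τ)
    (hs : |s| * ‖a‖ ≤ 1) :
    ‖charFun (P.map fun ω => (a * X ω).re) s‖ ≤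
      Real.exp (-(s ^ 2 * (∫ ω, ((a * (X ω - ∫ ω', X ω' ∂P)).re) ^ 2 ∂P) / 2) +
        4 * (|s| * ‖a‖) ^ (2 + ε) * τ) := by
  set m := ∫ ω', X ω' ∂P with hm
  set Z : Ω → ℝ := fun ω => (a * (X ω - m)).re with hZdef
  have hXm : MemLp (fun ω => X ω - m) 2 P := hX.sub (memLp_const m)
  have haX : MemLp (fun ω => a * (X ω - m)) 2 P := hXm.const_mul a
  have hZ : MemLp Z 2 P := haX.re
  have hZ0 : ∫ ω, Z ω ∂P = 0 := by
    have e1 : ∫ ω, a * (X ω - m) ∂P = 0 := by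
      rw [integral_const_mul, integral_sub (hX.integrable (by norm_num)) (integrable_const _)]
      simp [hm]
    have e2 := integral_re (𝕜 := ℂ) (haX.integrable (by norm_num))
    rw [e1] at e2
    exact e2.trans (by simp)
  obtain ⟨hmi, hml⟩ := integrable_rpow_and_integral_le (X := fun ω => X ω - m)
    (hX.aestronglyMeasurable.sub aestronglyMeasurable_const) (by positivity) hτ hmom
  have hZle : ∀ ω, |Z ω| ≤ ‖a‖ * ‖X ω - m‖ := fun ω =>
    (Complex.abs_re_le_norm _).trans (norm_mul_le _ _)
  have hZp : ∀ ω, |Z ω| ^ (2 + ε) ≤ ‖a‖ ^ (2 + ε) * ‖X ω - m‖ ^ (2 + ε) := fun ω => by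
    rw [← Real.mul_rpow (norm_nonneg _) (norm_nonneg _)]
    exact Real.rpow_le_rpow (abs_nonneg _) (hZle ω) (by positivity)
  have hpi : Integrable (fun ω => |Z ω| ^ (2 + ε)) P := by
    refine (hmi.const_mul (‖a‖ ^ (2 + ε))).mono' ?_ (Eventually.of_forall fun ω => ?_)
    · exact (hZ.aestronglyMeasurable.norm.aemeasurable.pow_const _).aestronglyMeasurable
    · rw [Real.norm_of_nonneg (by positivity)]
      exact hZp ω
  have hpβ : ∫ ω, |Z ω| ^ (2 + ε) ∂P ≤ ‖a‖ ^ (2 + ε) * τ := by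
    calc _ ≤ ∫ ω, ‖a‖ ^ (2 + ε) * ‖X ω - m‖ ^ (2 + ε) ∂P :=
          integral_mono hpi (hmi.const_mul _) hZp
      _ ≤ _ := by
        rw [integral_const_mul]
        exact mul_le_mul_of_nonneg_left hml (by positivity)
  have hsq : ∫ ω, Z ω ^ 2 ∂P ≤ ‖a‖ ^ 2 := by
    have hi2 : Integrable (fun ω => ‖X ω - m‖ ^ 2) P := hXm.integrable_norm_pow (by norm_num)
    calc _ ≤ ∫ ω, ‖a‖ ^ 2 * ‖X ω - m‖ ^ 2 ∂P := by
          refine integral_mono hZ.integrable_sq (hi2.const_mul _) fun ω => ?_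
          change Z ω ^ 2 ≤ _
          rw [← mul_pow, ← sq_abs (Z ω)]
          exact pow_le_pow_left₀ (abs_nonneg _) (hZle ω) 2
      _ = _ := by rw [integral_const_mul, h1, mul_one]
  have hs2 : s ^ 2 * ∫ ω, Z ω ^ 2 ∂P ≤ 2 := by
    calc _ ≤ s ^ 2 * ‖a‖ ^ 2 := by gcongr
      _ = (|s| * ‖a‖) ^ 2 := by rw [mul_pow, sq_abs]
      _ ≤ 1 := pow_le_one₀ (by positivity) hs
      _ ≤ 2 := by norm_num
  have key := norm_integral_exp_le_of_centered hε0 hε1 hZ hZ0 hpi hpβ hs2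
  rw [charFun_apply_real, integral_map ((haX.re.aestronglyMeasurable.aemeasurable.add_const
    (a * m).re).congr (Eventually.of_forall fun ω => by simp [mul_sub]))
    (by fun_prop : Continuous fun x : ℝ =>
      Complex.exp (s * x * Complex.I)).aestronglyMeasurable]
  have heq : ∀ ω, Complex.exp (s * ((a * X ω).re : ℝ) * Complex.I) =
      Complex.exp ((s * (a * m).re : ℝ) * Complex.I) *
        Complex.exp ((s * Z ω : ℝ) * Complex.I) := fun ω => by
    rw [← Complex.exp_add]
    congr 1
    simp only [hZdef, mul_sub, Complex.sub_re]
    push_cast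
    ring
  simp_rw [heq]
  rw [integral_const_mul, norm_mul, Complex.norm_exp_ofReal_mul_I, one_mul]
  refine key.trans (le_of_eq ?_)
  rw [Real.mul_rpow (abs_nonneg _) (norm_nonneg _)]
  congr 1
  ring

/-- A Gaussian upper bound for the characteristic function on a long interval gives an upper bound
for a Gaussian average of the distribution, by Fourier duality. -/
lemma integral_exp_neg_sq_le {Y : Ω → ℝ} (hY : Measurable Y) {T r : ℝ} (hT : 0 < T) (hr : 0 < r)
    (h : ∀ s, |s| ≤ T → ‖charFun (P.map Y) s‖ ≤ Real.exp (-(s ^ 2 / 16))) :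
    ∫ ω, Real.exp (-(Y ω ^ 2 / (2 * r ^ 2))) ∂P ≤ 8 * r + 1 / (r * T) ^ 2 := by
  set γ := gaussianReal 0 1 with hγ
  have hfub : Integrable (Function.uncurry fun (ω : Ω) (t : ℝ) =>
      Complex.exp (((Y ω / r) * t : ℝ) * Complex.I)) (P.prod γ) := by
    refine Integrable.of_bound (C := 1) ?_ (Eventually.of_forall fun p => ?_)
    · refine Measurable.aestronglyMeasurable ?_
      change Measurable fun p : Ω × ℝ => Complex.exp (((Y p.1 / r) * p.2 : ℝ) * Complex.I)
      exact (Complex.measurable_exp.comp ((Complex.measurable_ofReal.comp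
        (((hY.comp measurable_fst).div_const r).mul measurable_snd)).mul_const _))
    · simp only [Function.uncurry]
      rw [Complex.norm_exp_ofReal_mul_I]
  -- The Gaussian is its own Fourier transform; Fubini moves the average to the frequency.
  have hcast : ((∫ ω, Real.exp (-(Y ω ^ 2 / (2 * r ^ 2))) ∂P : ℝ) : ℂ) =
      ∫ t, charFun (P.map Y) (t / r) ∂γ := by
    rw [← integral_complex_ofReal]
    have e1 : ∀ ω, ((Real.exp (-(Y ω ^ 2 / (2 * r ^ 2))) : ℝ) : ℂ) =
        ∫ t, Complex.exp (((Y ω / r) * t : ℝ) * Complex.I) ∂γ := fun ω => by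
      have := charFun_gaussianReal (μ := 0) (v := 1) (Y ω / r)
      rw [charFun_apply_real] at this
      push_cast at this ⊢
      rw [this]
      congr 1
      have : (r : ℂ) ≠ 0 := by exact_mod_cast hr.ne'
      field_simp
      ring
    simp_rw [e1]
    rw [integral_integral_swap hfub]
    congr with t
    rw [charFun_apply_real, integral_map hY.aemeasurable (by fun_prop : Continuous fun x : ℝ =>
      Complex.exp ((t / r : ℝ) * x * Complex.I)).aestronglyMeasurable]
    congr with ω
    congr 2
    push_cast
    ring
  have hL : ∫ ω, Real.exp (-(Y ω ^ 2 / (2 * r ^ 2))) ∂P =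
      ‖∫ t, charFun (P.map Y) (t / r) ∂γ‖ := by
    rw [← hcast, Complex.norm_real, Real.norm_of_nonneg]
    exact integral_nonneg fun ω => (Real.exp_pos _).le
  have hPm : IsProbabilityMeasure (P.map Y) := Measure.isProbabilityMeasure_map hY.aemeasurable
  have hpt : ∀ t, ‖charFun (P.map Y) (t / r)‖ ≤
      Real.exp (-(1 / (16 * r ^ 2)) * t ^ 2) + t ^ 2 / (r * T) ^ 2 := fun t => by
    rcases le_or_gt |t / r| T with h1 | h1
    · refine (h _ h1).trans ?_
      have : -((t / r) ^ 2 / 16) = -(1 / (16 * r ^ 2)) * t ^ 2 := by field_simp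
      rw [this]
      have : 0 ≤ t ^ 2 / (r * T) ^ 2 := by positivity
      linarith
    · refine (norm_charFun_le_one _).trans ?_
      have h2 : r * T ≤ |t| := by
        rw [abs_div, abs_of_pos hr, lt_div_iff₀ hr] at h1
        linarith
      have h3 : 1 ≤ t ^ 2 / (r * T) ^ 2 := by
        rw [one_le_div (by positivity), ← sq_abs t]
        exact pow_le_pow_left₀ (by positivity) h2 2
      linarith [Real.exp_pos (-(1 / (16 * r ^ 2)) * t ^ 2)]
  have hsqi : Integrable (fun t : ℝ => t ^ 2) γ :=
    (memLp_id_gaussianReal' 2 (by norm_num)).integrable_sq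
  have hsq : ∫ t : ℝ, t ^ 2 ∂γ = 1 := by
    have := variance_fun_id_gaussianReal (μ := 0) (v := 1)
    rw [variance_eq_integral measurable_id'.aemeasurable] at this
    simpa using this
  have hgi : Integrable (fun t : ℝ => Real.exp (-(1 / (16 * r ^ 2)) * t ^ 2)) :=
    integrable_exp_neg_mul_sq (by positivity)
  have hgγ : Integrable (fun t : ℝ => Real.exp (-(1 / (16 * r ^ 2)) * t ^ 2)) γ := by
    refine Integrable.of_bound (C := 1) (by fun_prop) (Eventually.of_forall fun t => ?_)
    rw [Real.norm_of_nonneg (Real.exp_pos _).le]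
    refine Real.exp_le_one_iff.2 ?_
    have : 0 ≤ 1 / (16 * r ^ 2) * t ^ 2 := by positivity
    linarith
  have hg : ∫ t, Real.exp (-(1 / (16 * r ^ 2)) * t ^ 2) ∂γ ≤ 8 * r := by
    have hpdf : ∀ t, gaussianPDFReal 0 1 t ≤ 1 := fun t => by
      rw [gaussianPDFReal_def]
      have h1 : (√(2 * Real.pi * (1 : NNReal)))⁻¹ ≤ 1 := by
        refine inv_le_one_of_one_le₀ (Real.one_le_sqrt.2 ?_)
        have := Real.pi_gt_three
        push_cast
        linarith
      have h2 : Real.exp (-(t - 0) ^ 2 / (2 * (1 : NNReal))) ≤ 1 := by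
        refine Real.exp_le_one_iff.2 ?_
        push_cast
        nlinarith [sq_nonneg t]
      calc _ ≤ 1 * 1 := mul_le_mul h1 h2 (Real.exp_pos _).le zero_le_one
        _ = 1 := one_mul 1
    calc ∫ t, Real.exp (-(1 / (16 * r ^ 2)) * t ^ 2) ∂γ
        = ∫ t, gaussianPDFReal 0 1 t • Real.exp (-(1 / (16 * r ^ 2)) * t ^ 2) :=
          integral_gaussianReal_eq_integral_smul one_ne_zero
      _ ≤ ∫ t, Real.exp (-(1 / (16 * r ^ 2)) * t ^ 2) := by
          refine integral_mono_of_nonneg (Eventually.of_forall fun t => ?_) hgi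
            (Eventually.of_forall fun t => ?_)
          · exact smul_nonneg (gaussianPDFReal_nonneg _ _ _) (Real.exp_pos _).le
          · simp only [smul_eq_mul]
            exact mul_le_of_le_one_left (Real.exp_pos _).le (hpdf t)
      _ = √(Real.pi / (1 / (16 * r ^ 2))) := integral_gaussian _
      _ ≤ 8 * r := by
          rw [Real.sqrt_le_left (by positivity)]
          have := Real.pi_lt_four
          rw [div_div_eq_mul_div, div_one]
          nlinarith [sq_nonneg r]
  rw [hL]
  calc _ ≤ ∫ t, (Real.exp (-(1 / (16 * r ^ 2)) * t ^ 2) + t ^ 2 / (r * T) ^ 2) ∂γ :=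
        norm_integral_le_of_norm_le (hgγ.add (hsqi.div_const _)) (Eventually.of_forall hpt)
    _ ≤ _ := by
        rw [integral_add hgγ (hsqi.div_const _), integral_div, hsq]
        linarith

/-- Small ball estimate, in the form of a bound for a Gaussian average, for the real part of a sum of
independent complex variables, provided that this real part carries a share of the variance. -/
lemma integral_exp_neg_sq_re_sum_le {ι : Type*} {X : ι → Ω → ℂ} {ε τ η r : ℝ} (hε0 : 0 < ε)
    (hε1 : ε ≤ 1) (hτ : 0 < τ) (hη : 0 < η) (hr : 0 < r) (hXm : ∀ i, Measurable (X i))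
    (hX : ∀ i, MemLp (X i) 2 P) (hind : iIndepFun X P)
    (h1 : ∀ i, ∫ ω, ‖X i ω - ∫ ω', X i ω' ∂P‖ ^ 2 ∂P = 1)
    (hmom : ∀ i, ∫⁻ ω, ‖X i ω - ∫ ω', X i ω' ∂P‖ₑ ^ (2 + ε) ∂P ≤ ENNReal.ofReal τ)
    (s : Finset ι) (a : ι → ℂ) (ha : ∀ i ∈ s, ‖a i‖ ≤ η) (hsum : ∑ i ∈ s, ‖a i‖ ^ 2 ≤ 1)
    (hvar : 1 / 4 ≤ ∑ i ∈ s, ∫ ω, ((a i * (X i ω - ∫ ω', X i ω' ∂P)).re) ^ 2 ∂P) :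
    ∫ ω, Real.exp (-((∑ i ∈ s, a i * X i ω).re ^ 2 / (2 * r ^ 2))) ∂P ≤
      8 * r + (η / (r * min 1 ((1 / (64 * τ)) ^ (1 / ε)))) ^ 2 := by
  set c := min 1 ((1 / (64 * τ)) ^ (1 / ε)) with hc
  have hc0 : 0 < c := lt_min one_pos (by positivity)
  have hc1 : c ≤ 1 := min_le_left _ _
  have hcε : c ^ ε ≤ 1 / (64 * τ) := by
    calc c ^ ε ≤ ((1 / (64 * τ)) ^ (1 / ε)) ^ ε :=
          Real.rpow_le_rpow hc0.le (min_le_right _ _) hε0.le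
      _ = _ := by rw [← Real.rpow_mul (by positivity), one_div_mul_cancel hε0.ne', Real.rpow_one]
  have hYm : ∀ i, Measurable fun ω => (a i * X i ω).re := fun i =>
    Complex.measurable_re.comp ((hXm i).const_mul _)
  have hYind : iIndepFun (fun i ω => (a i * X i ω).re) P :=
    hind.comp (fun i x => (a i * x).re) fun i => by fun_prop
  have hSm : Measurable fun ω => ∑ i ∈ s, (a i * X i ω).re :=
    Finset.measurable_sum _ fun i _ => hYm i
  have hre : ∀ ω, (∑ i ∈ s, a i * X i ω).re = ∑ i ∈ s, (a i * X i ω).re := fun ω =>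
    Complex.re_sum _ _
  simp_rw [hre]
  -- At frequencies up to `c / η`, with this choice of `c`, the third order term of each factor is
  -- absorbed by the variance.
  have h := integral_exp_neg_sq_le hSm (T := c / η) (r := r) (P := P) (by positivity) hr ?_
  · refine h.trans (le_of_eq ?_)
    congr 1
    field_simp
  intro t ht
  have htη : |t| * η ≤ c := by rwa [le_div_iff₀ hη] at ht
  rw [(hYind.restrict s).charFun_map_fun_finsetSum_eq_prod (fun i _ => (hYm i).aemeasurable),
    Finset.prod_apply, norm_prod]
  have hstep : ∀ i ∈ s, ‖charFun (P.map fun ω => (a i * X i ω).re) t‖ ≤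
      Real.exp (-(t ^ 2 / 2 * (∫ ω, ((a i * (X i ω - ∫ ω', X i ω' ∂P)).re) ^ 2 ∂P)) +
        t ^ 2 / 16 * ‖a i‖ ^ 2) := fun i hi => by
    have hta : |t| * ‖a i‖ ≤ c := (by gcongr; exact ha i hi : |t| * ‖a i‖ ≤ |t| * η).trans htη
    refine (norm_charFun_re_mul_le hε0.le hε1 hτ.le (hX i) (h1 i) (hmom i)
      (hta.trans hc1)).trans (Real.exp_le_exp.2 ?_)
    have hu0 : 0 ≤ |t| * ‖a i‖ := by positivity
    have hpow : (|t| * ‖a i‖) ^ (2 + ε) ≤ t ^ 2 * ‖a i‖ ^ 2 * (1 / (64 * τ)) := by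
      rw [Real.rpow_add_of_nonneg hu0 (by norm_num) hε0.le]
      have e1 : (|t| * ‖a i‖) ^ (2 : ℝ) = t ^ 2 * ‖a i‖ ^ 2 := by
        rw [show (2 : ℝ) = (2 : ℕ) by norm_num, Real.rpow_natCast, mul_pow, sq_abs]
      rw [e1]
      gcongr
      exact (Real.rpow_le_rpow hu0 hta hε0.le).trans hcε
    have : 4 * (|t| * ‖a i‖) ^ (2 + ε) * τ ≤ t ^ 2 / 16 * ‖a i‖ ^ 2 := by
      calc 4 * (|t| * ‖a i‖) ^ (2 + ε) * τ ≤ 4 * (t ^ 2 * ‖a i‖ ^ 2 * (1 / (64 * τ))) * τ := by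
            gcongr
        _ = _ := by field_simp; ring
    linarith
  refine (Finset.prod_le_prod (fun _ _ => norm_nonneg _) hstep).trans ?_
  rw [← Real.exp_sum]
  refine Real.exp_le_exp.2 ?_
  rw [Finset.sum_add_distrib, Finset.sum_neg_distrib, ← Finset.mul_sum, ← Finset.mul_sum]
  have h2 : 0 ≤ t ^ 2 := sq_nonneg t
  nlinarith [mul_le_mul_of_nonneg_left hsum h2, mul_le_mul_of_nonneg_left hvar h2]

/-- Small ball estimate, in the form of a bound for a Gaussian average, for a normalised sum of
independent complex variables with small coefficients: the real or the imaginary part carries half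
of the variance. -/
lemma integral_exp_neg_norm_sq_sum_le {ι : Type*} {X : ι → Ω → ℂ} {ε τ η r : ℝ} (hε0 : 0 < ε)
    (hε1 : ε ≤ 1) (hτ : 0 < τ) (hη : 0 < η) (hr : 0 < r) (hXm : ∀ i, Measurable (X i))
    (hX : ∀ i, MemLp (X i) 2 P) (hind : iIndepFun X P)
    (h1 : ∀ i, ∫ ω, ‖X i ω - ∫ ω', X i ω' ∂P‖ ^ 2 ∂P = 1)
    (hmom : ∀ i, ∫⁻ ω, ‖X i ω - ∫ ω', X i ω' ∂P‖ₑ ^ (2 + ε) ∂P ≤ ENNReal.ofReal τ)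
    (s : Finset ι) (a : ι → ℂ) (ha : ∀ i ∈ s, ‖a i‖ ≤ η) (hsum : ∑ i ∈ s, ‖a i‖ ^ 2 ≤ 1)
    (hsum' : 1 / 2 ≤ ∑ i ∈ s, ‖a i‖ ^ 2) :
    ∫ ω, Real.exp (-(‖∑ i ∈ s, a i * X i ω‖ ^ 2 / (2 * r ^ 2))) ∂P ≤
      8 * r + (η / (r * min 1 ((1 / (64 * τ)) ^ (1 / ε)))) ^ 2 := by
  have hmono : ∀ b : ℂ, ‖b‖ = 1 →
      ∫ ω, Real.exp (-(‖∑ i ∈ s, a i * X i ω‖ ^ 2 / (2 * r ^ 2))) ∂P ≤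
      ∫ ω, Real.exp (-((∑ i ∈ s, (b * a i) * X i ω).re ^ 2 / (2 * r ^ 2))) ∂P := fun b hb => by
    have hle : ∀ x : ℝ, ‖Real.exp (-(x ^ 2 / (2 * r ^ 2)))‖ ≤ 1 := fun x => by
      rw [Real.norm_of_nonneg (Real.exp_pos _).le]
      refine Real.exp_le_one_iff.2 ?_
      have : 0 ≤ x ^ 2 / (2 * r ^ 2) := by positivity
      linarith
    have hm : Measurable fun ω => ∑ i ∈ s, a i * X i ω :=
      Finset.measurable_sum _ fun i _ => (hXm i).const_mul _
    have hm' : Measurable fun ω => (∑ i ∈ s, (b * a i) * X i ω).re :=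
      Complex.measurable_re.comp (Finset.measurable_sum _ fun i _ => (hXm i).const_mul _)
    refine integral_mono (Integrable.of_bound (C := 1) ?_ (Eventually.of_forall fun ω => hle _))
      (Integrable.of_bound (C := 1) ?_ (Eventually.of_forall fun ω => hle _)) fun ω => ?_
    · exact (Real.measurable_exp.comp ((hm.norm.pow_const 2).div_const _).neg).aestronglyMeasurable
    · exact (Real.measurable_exp.comp ((hm'.pow_const 2).div_const _).neg).aestronglyMeasurable
    · refine Real.exp_le_exp.2 (neg_le_neg ?_)
      refine div_le_div_of_nonneg_right ?_ (by positivity)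
      rw [← sq_abs (Complex.re _)]
      refine pow_le_pow_left₀ (abs_nonneg _) ((Complex.abs_re_le_norm _).trans (le_of_eq ?_)) 2
      simp_rw [mul_assoc]
      rw [← Finset.mul_sum, norm_mul, hb, one_mul]
  have hfin : ∀ b : ℂ, ‖b‖ = 1 →
      1 / 4 ≤ ∑ i ∈ s, ∫ ω, ((b * a i * (X i ω - ∫ ω', X i ω' ∂P)).re) ^ 2 ∂P →
      ∫ ω, Real.exp (-(‖∑ i ∈ s, a i * X i ω‖ ^ 2 / (2 * r ^ 2))) ∂P ≤
        8 * r + (η / (r * min 1 ((1 / (64 * τ)) ^ (1 / ε)))) ^ 2 := fun b hb hv => by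
    have hn : ∀ i, ‖b * a i‖ = ‖a i‖ := fun i => by rw [norm_mul, hb, one_mul]
    exact (hmono b hb).trans (integral_exp_neg_sq_re_sum_le hε0 hε1 hτ hη hr hXm hX hind h1 hmom s
      (fun i => b * a i) (fun i hi => (hn i).trans_le (ha i hi)) (by simpa only [hn] using hsum) hv)
  have htot : ∑ i ∈ s, ∫ ω, ((1 * a i * (X i ω - ∫ ω', X i ω' ∂P)).re) ^ 2 ∂P +
      ∑ i ∈ s, ∫ ω, ((-Complex.I * a i * (X i ω - ∫ ω', X i ω' ∂P)).re) ^ 2 ∂P =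
      ∑ i ∈ s, ‖a i‖ ^ 2 := by
    rw [← Finset.sum_add_distrib]
    refine Finset.sum_congr rfl fun i _ => ?_
    have hm : ∀ b : ℂ, MemLp (fun ω => (b * a i * (X i ω - ∫ ω', X i ω' ∂P)).re) 2 P := fun b =>
      (((hX i).sub (memLp_const _)).const_mul (b * a i)).re
    rw [← integral_add (hm 1).integrable_sq (hm (-Complex.I)).integrable_sq]
    calc _ = ∫ ω, ‖a i‖ ^ 2 * ‖X i ω - ∫ ω', X i ω' ∂P‖ ^ 2 ∂P := by
          congr with ω
          rw [← mul_pow, ← norm_mul, one_mul, mul_assoc, ← Complex.normSq_eq_norm_sq,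
            Complex.normSq_apply]
          set u := a i * (X i ω - ∫ ω', X i ω' ∂P)
          simp
          ring
      _ = _ := by rw [integral_const_mul, h1, mul_one]
  rcases le_or_gt (1 / 4)
    (∑ i ∈ s, ∫ ω, ((1 * a i * (X i ω - ∫ ω', X i ω' ∂P)).re) ^ 2 ∂P) with h | h
  · exact hfin 1 (by simp) h
  · exact hfin (-Complex.I) (by simp) (by linarith)

end SmallBall

/-! ### Passage to random series -/

section Series

open scoped Classical in
/-- The indices of `{1, …, n}` that are at most `N`. -/
noncomputable def idxUpTo (n : ℕ∞) (N : ℕ) : Finset (idx n) :=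
  (Finset.range (N + 1)).subtype (fun i => i ∈ idx n)

lemma mem_idxUpTo {n : ℕ∞} {N : ℕ} {i : idx n} : i ∈ idxUpTo n N ↔ (i : ℕ) ≤ N := by
  simp [idxUpTo]

lemma partialSum_eq_sum {Ω : Type*} (n : ℕ∞) (ξ : ℕ → Ω → ℂ) (φ : ℕ → ℂ → ℂ) (ω : Ω) (w : ℂ)
    (N : ℕ) : partialSum n ξ φ ω w N = ∑ i ∈ idxUpTo n N, ξ i ω * φ i w := by
  classical
  rw [partialSum, idxUpTo, Finset.sum_subtype_eq_sum_filter (f := fun i => ξ i ω * φ i w)]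

lemma tendsto_idxUpTo (n : ℕ∞) : Tendsto (idxUpTo n) atTop atTop := by
  refine tendsto_atTop_finset_of_monotone (fun N N' h i hi => ?_) fun i =>
    ⟨i, mem_idxUpTo.2 le_rfl⟩
  rw [mem_idxUpTo] at hi ⊢
  exact hi.trans h

lemma SeriesConverges.tendsto {Ω : Type*} {n : ℕ∞} {ξ : ℕ → Ω → ℂ} {φ : ℕ → ℂ → ℂ} {ω : Ω} {w : ℂ}
    (h : SeriesConverges n ξ φ ω w) :
    Tendsto (partialSum n ξ φ ω w) atTop (𝓝 (randomFun n ξ φ ω w)) :=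
  tendsto_nhds_limUnder h

variable {Ω Ω' : Type*} [MeasurableSpace Ω] [MeasurableSpace Ω'] {P : Measure Ω} {P' : Measure Ω'}

lemma measurable_partialSum {n : ℕ∞} {ξ : ℕ → Ω → ℂ} (hξ : ∀ i ∈ idx n, Measurable (ξ i))
    (φ : ℕ → ℂ → ℂ) (w : ℂ) (N : ℕ) : Measurable fun ω => partialSum n ξ φ ω w N := by
  simp_rw [partialSum_eq_sum]
  exact Finset.measurable_sum _ fun i _ => (hξ i i.2).mul_const _

lemma aemeasurable_randomFun {n : ℕ∞} {ξ : ℕ → Ω → ℂ} (hξ : ∀ i ∈ idx n, Measurable (ξ i))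
    {φ : ℕ → ℂ → ℂ} {w : ℂ} (h : ∀ᵐ ω ∂P, SeriesConverges n ξ φ ω w) :
    AEMeasurable (fun ω => randomFun n ξ φ ω w) P :=
  aemeasurable_of_tendsto_metrizable_ae' (fun N => (measurable_partialSum hξ φ w N).aemeasurable)
    (h.mono fun _ h => h.tendsto)

variable [IsProbabilityMeasure P] [IsProbabilityMeasure P']

/-- Lindeberg exchange for finite sums of the coefficients with vector weights. -/
lemma ConditionC1.abs_integral_sum_smul_sub_le {n : ℕ∞} {ξ : ℕ → Ω → ℂ} {ξ' : ℕ → Ω' → ℂ} {N₀ : ℕ}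
    {τ ε : ℝ} (h : ConditionC1 P P' n ξ ξ' N₀ τ ε) (hτ : 0 < τ) (hε0 : 0 < ε) (hε1 : ε ≤ 1) {k : ℕ}
    {H : (Fin k → ℂ) → ℝ} {A a η K : ℝ} (hA : 0 ≤ A) (ha : 0 ≤ a) (hη : 0 ≤ η)
    (hH : ContDiff ℝ 3 H) (hb : ∀ i ≤ 3, ∀ x, ‖iteratedFDeriv ℝ i H x‖ ≤ A * a ^ i)
    (v : idx n → Fin k → ℂ) (hv : ∀ i, ‖v i‖ ≤ η) (s : Finset (idx n))
    (hK : ∑ i ∈ s, ‖v i‖ ^ 2 ≤ K) :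
    |∫ ω, H (∑ i ∈ s, ξ i ω • v i) ∂P - ∫ ω, H (∑ i ∈ s, ξ' i ω • v i) ∂P'| ≤
      A * (4 * τ * a ^ (2 + ε) * η ^ ε * K + N₀ * (a * η * (2 + τ))) := by
  have hbound : ∀ x, |H x| ≤ A := fun x => by
    have := hb 0 (by norm_num) x
    rwa [norm_iteratedFDeriv_zero, pow_zero, mul_one] at this
  set err : idx n → ℝ := fun i =>
    A * (4 * τ * a ^ (2 + ε) * η ^ ε) * ‖v i‖ ^ 2 +
      if (i : ℕ) < N₀ then A * (a * η * (2 + τ)) else 0 with herr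
  have hswap : ∀ (i : idx n) y, |∫ ω, H (y + ξ i ω • v i) ∂P - ∫ ω, H (y + ξ' i ω • v i) ∂P'| ≤ err i := by
    intro i y
    simp only [herr]
    split_ifs with hi
    · have h1 := abs_integral_sub_integral_le_of_mean hbound (hH.of_le (by norm_num))
        (fun x => by simpa using hb 1 (by norm_num) x) (h.left.memLp_two i i.2)
        (h.right.memLp_two i i.2) (h.left.unit_variance i i.2) (h.right.unit_variance i i.2)
        (h.exceptions i i.2 hi) y (v i)
      have h2 : A * a * ‖v i‖ * (2 + τ) ≤ A * (a * η * (2 + τ)) := by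
        calc _ ≤ A * a * η * (2 + τ) := by gcongr; exact hv i
          _ = _ := by ring
      have h3 : 0 ≤ A * (4 * τ * a ^ (2 + ε) * η ^ ε) * ‖v i‖ ^ 2 := by positivity
      linarith
    · have h1 := abs_integral_sub_integral_le_of_matching hA ha hε0.le hε1 hH hb
        (h.left.memLp_two i i.2) (h.right.memLp_two i i.2) hτ.le (h.left.moment i i.2)
        (h.right.moment i i.2) (h.matching i i.2 (not_lt.1 hi)) y (v i)
      refine h1.trans ?_
      have hp : (a * ‖v i‖) ^ (2 + ε) ≤ a ^ (2 + ε) * (‖v i‖ ^ 2 * η ^ ε) := by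
        rw [Real.mul_rpow ha (norm_nonneg _)]
        refine mul_le_mul_of_nonneg_left ?_ (by positivity)
        rw [Real.rpow_add_of_nonneg (norm_nonneg _) (by norm_num) hε0.le,
          show (2 : ℝ) = (2 : ℕ) by norm_num, Real.rpow_natCast]
        exact mul_le_mul_of_nonneg_left (Real.rpow_le_rpow (norm_nonneg _) (hv i) hε0.le)
          (by positivity)
      calc 4 * A * (a * ‖v i‖) ^ (2 + ε) * τ
          ≤ 4 * A * (a ^ (2 + ε) * (‖v i‖ ^ 2 * η ^ ε)) * τ := by gcongr
        _ = _ := by ring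
  have main := abs_integral_sum_sub_le (X := fun i : idx n => fun ω => ξ i ω • v i)
    (X' := fun i : idx n => fun ω => ξ' i ω • v i) hH.continuous hbound
    (fun i => (h.left.measurable i i.2).smul_const _)
    (fun i => (h.right.measurable i i.2).smul_const _)
    (h.left.indep.comp (fun i x => x • v i) fun i => measurable_id.smul_const _)
    (h.right.indep.comp (fun i x => x • v i) fun i => measurable_id.smul_const _) hswap s 0
  simp only [zero_add] at main
  refine main.trans ?_
  have hs : ∑ i ∈ s, err i = A * (4 * τ * a ^ (2 + ε) * η ^ ε) * ∑ i ∈ s, ‖v i‖ ^ 2 +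
      ∑ i ∈ s, if (i : ℕ) < N₀ then A * (a * η * (2 + τ)) else 0 := by
    simp only [herr, Finset.sum_add_distrib, Finset.mul_sum]
  have hs1 : A * (4 * τ * a ^ (2 + ε) * η ^ ε) * ∑ i ∈ s, ‖v i‖ ^ 2 ≤
      A * (4 * τ * a ^ (2 + ε) * η ^ ε) * K := by gcongr
  have hs2 : (∑ i ∈ s, if (i : ℕ) < N₀ then A * (a * η * (2 + τ)) else 0) ≤
      A * (N₀ * (a * η * (2 + τ))) := by
    rw [← Finset.sum_filter, Finset.sum_const, nsmul_eq_mul]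
    have hcard : (s.filter fun i : idx n => (i : ℕ) < N₀).card ≤ N₀ := by
      calc _ = ((s.filter fun i : idx n => (i : ℕ) < N₀).image Subtype.val).card :=
            (Finset.card_image_of_injective _ Subtype.val_injective).symm
        _ ≤ (Finset.range N₀).card := by
            refine Finset.card_le_card fun i hi => ?_
            simp only [Finset.mem_image, Finset.mem_filter] at hi
            obtain ⟨j, ⟨_, hj⟩, rfl⟩ := hi
            exact Finset.mem_range.2 hj
        _ = N₀ := Finset.card_range _
    calc _ ≤ (N₀ : ℝ) * (A * (a * η * (2 + τ))) := by
          gcongr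
      _ = _ := by ring
  rw [hs]
  linarith

/-- Bounded continuous statistics of the partial sums converge in mean to those of the series. The
weights `b` rescale the coordinates. -/
lemma tendsto_integral_comp_partialSum {n : ℕ∞} {ξ : ℕ → Ω → ℂ} {φ : ℕ → ℂ → ℂ}
    (hξ : ∀ i ∈ idx n, Measurable (ξ i)) {k : ℕ} {w : Fin k → ℂ} {b : Fin k → ℝ}
    (hconv : ∀ j, ∀ᵐ ω ∂P, SeriesConverges n ξ φ ω (w j)) {H : (Fin k → ℂ) → ℝ} {A : ℝ}
    (hH : Continuous H) (hb : ∀ x, |H x| ≤ A) :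
    Tendsto (fun N => ∫ ω, H (∑ i ∈ idxUpTo n N, ξ i ω • fun j => (b j)⁻¹ • φ i (w j)) ∂P) atTop
      (𝓝 (∫ ω, H (fun j => (b j)⁻¹ • randomFun n ξ φ ω (w j)) ∂P)) := by
  have heq : ∀ N ω, (∑ i ∈ idxUpTo n N, ξ i ω • fun j => (b j)⁻¹ • φ i (w j)) =
      fun j => (b j)⁻¹ • partialSum n ξ φ ω (w j) N := fun N ω => by
    ext j
    rw [Finset.sum_apply, partialSum_eq_sum, Finset.smul_sum]
    refine Finset.sum_congr rfl fun i _ => ?_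
    simp only [Pi.smul_apply, smul_eq_mul, Complex.real_smul]
    ring
  simp_rw [heq]
  refine tendsto_integral_of_dominated_convergence (fun _ => A) (fun N => ?_) (integrable_const A)
    (fun N => Eventually.of_forall fun ω => hb _) ?_
  · refine (hH.measurable.comp (measurable_pi_lambda _ fun j => ?_)).aestronglyMeasurable
    exact (measurable_partialSum hξ φ (w j) N).const_smul (b j)⁻¹
  · filter_upwards [ae_all_iff.2 hconv] with ω hω
    refine (hH.tendsto _).comp (tendsto_pi_nhds.2 fun j => ?_)
    exact (hω j).tendsto.const_smul _

/-- A constant for the derivative bounds of the rescaled truncated logarithm. -/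
noncomputable def truncLogConst : ℝ := exists_contDiff_truncLog_rescaled.choose

/-- The constant in the universality estimate for truncated logarithms. -/
noncomputable def exchangeConst (N₀ : ℕ) (τ : ℝ) (k : ℕ) : ℝ :=
  truncLogConst ^ k * (4 * τ * (2 ^ k * truncLogConst) ^ 3 * k +
    N₀ * ((2 ^ k * truncLogConst) * (2 + τ)) + 1)

lemma one_le_truncLogConst : 1 ≤ truncLogConst := exists_contDiff_truncLog_rescaled.choose_spec.1

lemma exchangeConst_nonneg (N₀ : ℕ) {τ : ℝ} (hτ : 0 < τ) (k : ℕ) : 0 ≤ exchangeConst N₀ τ k := by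
  have := one_le_truncLogConst
  rw [exchangeConst]
  positivity

/-- Universality of the truncated logarithms: the expectation of a product of truncated logarithms
of values of the random series hardly depends on the distribution of the coefficients. -/
lemma ConditionC1.abs_integral_truncLog_sub_le {N₀ : ℕ} {τ ε : ℝ} {n : ℕ∞} {φ : ℕ → ℂ → ℂ}
    {ξ : ℕ → Ω → ℂ} {ξ' : ℕ → Ω' → ℂ} (hC1c : ConditionC1 P P' n ξ ξ' N₀ τ ε) (hτ : 0 < τ)
    (hε0 : 0 < ε) (hε1 : ε ≤ 1) {k : ℕ} {w : Fin k → ℂ}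
    (hconv : ∀ j, ∀ᵐ ω ∂P, SeriesConverges n ξ φ ω (w j))
    (hconv' : ∀ j, ∀ᵐ ω ∂P', SeriesConverges n ξ' φ ω (w j))
    (hsum : ∀ j, Summable fun i : idx n => ‖φ i (w j)‖ ^ 2) {η : ℝ} (hη : 0 ≤ η)
    (hdel : ∀ j, ∀ i : idx n, ‖φ i (w j)‖ ≤ η * √(∑' i : idx n, ‖φ i (w j)‖ ^ 2)) {M r : ℝ}
    (hM : 1 ≤ M) (hr : 0 < r) (hr1 : r ≤ 1) :
    |∫ ω, ∏ j, truncLog M (r * √(∑' i : idx n, ‖φ i (w j)‖ ^ 2)) (randomFun n ξ φ ω (w j)) ∂P -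
      ∫ ω, ∏ j, truncLog M (r * √(∑' i : idx n, ‖φ i (w j)‖ ^ 2))
        (randomFun n ξ' φ ω (w j)) ∂P'| ≤
      exchangeConst N₀ τ k * (M ^ k * (r⁻¹ ^ 3 * η ^ ε + r⁻¹ * η)) := by
  obtain ⟨hC1, hC⟩ := exists_contDiff_truncLog_rescaled.choose_spec
  rw [exchangeConst]
  change 1 ≤ truncLogConst at hC1
  set C := truncLogConst with hCdef
  have hC0 : 0 < C := by linarith
  set C₂ : ℝ := 2 ^ k * C with hC₂
  have hC₂1 : 1 ≤ C₂ := by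
    have : (1 : ℝ) ≤ 2 ^ k := one_le_pow₀ (by norm_num)
    nlinarith
  set b : Fin k → ℝ := fun j => √(∑' i : idx n, ‖φ i (w j)‖ ^ 2) with hbdef
  have hRHS : 0 ≤ M ^ k * (r⁻¹ ^ 3 * η ^ ε + r⁻¹ * η) := by positivity
  by_cases hall : ∀ j, 0 < b j
  · set H : (Fin k → ℂ) → ℝ := fun x => ∏ j, truncLog M (r * b j) (b j • x j) with hHdef
    obtain ⟨hH, hHb⟩ := norm_iteratedFDeriv_prod_coord_le (A := C * M) (a := C / r)
      (by positivity) (by positivity) (fun j => (hC M r (b j) hM hr (hall j)).1)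
      (fun j => (hC M r (b j) hM hr (hall j)).2)
    have ha1 : 2 ^ k * (C / r) = C₂ * r⁻¹ := by rw [hC₂]; ring
    have hbound : ∀ x, |H x| ≤ (C * M) ^ k := fun x => by
      have := hHb 0 (by norm_num) x
      rwa [norm_iteratedFDeriv_zero, pow_zero, mul_one] at this
    set v : idx n → Fin k → ℂ := fun i j => (b j)⁻¹ • φ i (w j) with hv
    have hvn : ∀ i j, ‖v i j‖ = ‖φ i (w j)‖ / b j := fun i j => by
      rw [hv, norm_smul, Real.norm_of_nonneg (inv_nonneg.2 (hall j).le)]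
      exact inv_mul_eq_div _ _
    have hvη : ∀ i, ‖v i‖ ≤ η := fun i => by
      refine (pi_norm_le_iff_of_nonneg hη).2 fun j => ?_
      rw [hvn, div_le_iff₀ (hall j)]
      exact hdel j i
    have hb2 : ∀ j, b j ^ 2 = ∑' i : idx n, ‖φ i (w j)‖ ^ 2 := fun j =>
      Real.sq_sqrt (tsum_nonneg fun _ => by positivity)
    have hvK : ∀ s : Finset (idx n), ∑ i ∈ s, ‖v i‖ ^ 2 ≤ k := fun s => by
      have h1 : ∀ i, ‖v i‖ ^ 2 ≤ ∑ j, ‖φ i (w j)‖ ^ 2 / b j ^ 2 := fun i => by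
        rw [← Real.le_sqrt (norm_nonneg _)]
        refine (pi_norm_le_iff_of_nonneg (Real.sqrt_nonneg _)).2 fun j => ?_
        rw [Real.le_sqrt (norm_nonneg _), hvn, div_pow]
        exact Finset.single_le_sum (f := fun j => ‖φ i (w j)‖ ^ 2 / b j ^ 2)
          (fun _ _ => by positivity) (Finset.mem_univ j)
        · positivity
        · positivity
      calc _ ≤ ∑ i ∈ s, ∑ j, ‖φ i (w j)‖ ^ 2 / b j ^ 2 := Finset.sum_le_sum fun i _ => h1 i
        _ = ∑ j, (∑ i ∈ s, ‖φ i (w j)‖ ^ 2) / b j ^ 2 := by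
            rw [Finset.sum_comm]
            simp_rw [Finset.sum_div]
        _ ≤ ∑ _j : Fin k, (1 : ℝ) := by
            refine Finset.sum_le_sum fun j _ => ?_
            rw [div_le_one (pow_pos (hall j) 2), hb2]
            exact (hsum j).sum_le_tsum s fun _ _ => by positivity
        _ = k := by simp
    have hfin : ∀ N, |∫ ω, H (∑ i ∈ idxUpTo n N, ξ i ω • v i) ∂P -
        ∫ ω, H (∑ i ∈ idxUpTo n N, ξ' i ω • v i) ∂P'| ≤ _ := fun N =>
      hC1c.abs_integral_sum_smul_sub_le hτ hε0 hε1 (by positivity) (by positivity) hη hH hHb v hvη _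
        (hvK (idxUpTo n N))
    have hlim := (tendsto_integral_comp_partialSum (b := b) hC1c.left.measurable hconv hH.continuous
      hbound).sub (tendsto_integral_comp_partialSum (b := b) hC1c.right.measurable hconv'
      hH.continuous hbound)
    have hle := le_of_tendsto hlim.abs (Eventually.of_forall hfin)
    have hval : ∀ x : Fin k → ℂ, H (fun j => (b j)⁻¹ • x j) =
        ∏ j, truncLog M (r * b j) (x j) := fun x => by
      refine Finset.prod_congr rfl fun j _ => ?_
      rw [smul_smul, mul_inv_cancel₀ (hall j).ne', one_smul]
    have hle' := hle
    rw [integral_congr_ae (Eventually.of_forall fun ω => hval fun j => randomFun n ξ φ ω (w j)),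
      integral_congr_ae (Eventually.of_forall fun ω => hval fun j => randomFun n ξ' φ ω (w j))]
      at hle'
    refine hle'.trans ?_
    rw [ha1]
    have hr1' : 1 ≤ r⁻¹ := (one_le_inv₀ hr).2 hr1
    have hpow : (C₂ * r⁻¹) ^ (2 + ε) ≤ C₂ ^ 3 * r⁻¹ ^ 3 := by
      have h1 : 1 ≤ C₂ * r⁻¹ := by nlinarith
      have := Real.rpow_le_rpow_of_exponent_le h1 (show 2 + ε ≤ (3 : ℕ) by push_cast; linarith)
      rwa [Real.rpow_natCast, mul_pow] at this
    have hηε : 0 ≤ η ^ ε := by positivity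
    calc (C * M) ^ k * (4 * τ * (C₂ * r⁻¹) ^ (2 + ε) * η ^ ε * k +
          N₀ * (C₂ * r⁻¹ * η * (2 + τ)))
        ≤ (C * M) ^ k * (4 * τ * (C₂ ^ 3 * r⁻¹ ^ 3) * η ^ ε * k +
          N₀ * (C₂ * r⁻¹ * η * (2 + τ))) := by gcongr
      _ = C ^ k * M ^ k * ((4 * τ * C₂ ^ 3 * k) * (r⁻¹ ^ 3 * η ^ ε) +
          (N₀ * (C₂ * (2 + τ))) * (r⁻¹ * η)) := by rw [mul_pow]; ring
      _ ≤ C ^ k * M ^ k * ((4 * τ * C₂ ^ 3 * k + N₀ * (C₂ * (2 + τ)) + 1) *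
          (r⁻¹ ^ 3 * η ^ ε + r⁻¹ * η)) := by
          have e1 : 0 ≤ 4 * τ * C₂ ^ 3 * k := by positivity
          have e2 : 0 ≤ (N₀ : ℝ) * (C₂ * (2 + τ)) := by positivity
          have e3 : 0 ≤ r⁻¹ ^ 3 * η ^ ε := by positivity
          have e4 : 0 ≤ r⁻¹ * η := by positivity
          refine mul_le_mul_of_nonneg_left ?_ (by positivity)
          nlinarith [mul_nonneg e1 e4, mul_nonneg e2 e3]
      _ = _ := by ring
  -- If the variance vanishes at one of the points, the truncated logarithm there is `0` by definition.
  · push Not at hall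
    obtain ⟨j₀, hj₀⟩ := hall
    have hz : b j₀ = 0 := le_antisymm hj₀ (Real.sqrt_nonneg _)
    have hzero : ∀ x : Fin k → ℂ, ∏ j, truncLog M (r * b j) (x j) = 0 := fun x =>
      Finset.prod_eq_zero (Finset.mem_univ j₀) (by rw [hz, mul_zero, truncLog, if_pos rfl])
    have e1 : ∀ (x : Fin k → ℂ), ∏ j, truncLog M (r * √(∑' i : idx n, ‖φ i (w j)‖ ^ 2)) (x j) = 0 :=
      hzero
    rw [integral_congr_ae (Eventually.of_forall fun ω => e1 fun j => randomFun n ξ φ ω (w j)),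
      integral_congr_ae (Eventually.of_forall fun ω => e1 fun j => randomFun n ξ' φ ω (w j))]
    simp only [integral_zero, sub_zero, abs_zero]
    positivity

/-- From a Gaussian average to the probability of a ball, by the inequality of Markov. -/
lemma measureReal_norm_lt_le {F : Ω → ℂ} (hF : AEMeasurable F P) {b r B : ℝ} (hb : 0 < b)
    (hr : 0 < r) (hB : ∫ ω, Real.exp (-(‖b⁻¹ • F ω‖ ^ 2 / (2 * r ^ 2))) ∂P ≤ B) :
    P.real {ω | ‖F ω‖ < r * b} ≤ 2 * B := by
  have hint : Integrable (fun ω => Real.exp (-(‖b⁻¹ • F ω‖ ^ 2 / (2 * r ^ 2)))) P := by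
    refine Integrable.of_bound (C := 1) ?_ (Eventually.of_forall fun ω => ?_)
    · have hc : Continuous fun x : ℂ => Real.exp (-(‖b⁻¹ • x‖ ^ 2 / (2 * r ^ 2))) := by fun_prop
      exact hc.comp_aestronglyMeasurable hF.aestronglyMeasurable
    · rw [Real.norm_of_nonneg (Real.exp_pos _).le]
      refine Real.exp_le_one_iff.2 ?_
      have : 0 ≤ ‖b⁻¹ • F ω‖ ^ 2 / (2 * r ^ 2) := by positivity
      linarith
  have hsub : {ω | ‖F ω‖ < r * b} ⊆
      {ω | 1 / 2 ≤ Real.exp (-(‖b⁻¹ • F ω‖ ^ 2 / (2 * r ^ 2)))} := fun ω hω => by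
    rw [Set.mem_ofPred_eq] at hω ⊢
    have h1 : ‖b⁻¹ • F ω‖ ≤ r := by
      rw [norm_smul, Real.norm_of_nonneg (inv_nonneg.2 hb.le), inv_mul_le_iff₀ hb]
      linarith
    have h2 : ‖b⁻¹ • F ω‖ ^ 2 / (2 * r ^ 2) ≤ 1 / 2 := by
      rw [div_le_iff₀ (by positivity)]
      have := pow_le_pow_left₀ (norm_nonneg _) h1 2
      linarith
    have h3 := Real.add_one_le_exp (-(‖b⁻¹ • F ω‖ ^ 2 / (2 * r ^ 2)))
    linarith
  have hM := mul_meas_ge_le_integral_of_nonneg (μ := P)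
    (Eventually.of_forall fun ω => (Real.exp_pos _).le) hint (1 / 2)
  have := measureReal_mono (μ := P) hsub
  linarith

/-- Small ball estimate for the values of the random series, at the scale of the standard
deviation. -/
lemma BoundedCentralMoments.measureReal_norm_randomFun_lt_le {n : ℕ∞} {φ : ℕ → ℂ → ℂ} {ξ : ℕ → Ω → ℂ}
    {τ ε : ℝ} (h : BoundedCentralMoments P n ξ τ ε) (hτ : 0 < τ) (hε0 : 0 < ε) (hε1 : ε ≤ 1)
    {w : ℂ} (hconv : ∀ᵐ ω ∂P, SeriesConverges n ξ φ ω w)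
    (hsum : Summable fun i : idx n => ‖φ i w‖ ^ 2) {η : ℝ} (hη : 0 < η)
    (hdel : ∀ i : idx n, ‖φ i w‖ ≤ η * √(∑' i : idx n, ‖φ i w‖ ^ 2))
    (hV : 0 < √(∑' i : idx n, ‖φ i w‖ ^ 2)) {r : ℝ} (hr : 0 < r) :
    P.real {ω | ‖randomFun n ξ φ ω w‖ < r * √(∑' i : idx n, ‖φ i w‖ ^ 2)} ≤
      2 * (8 * r + (η / (r * min 1 ((1 / (64 * τ)) ^ (1 / ε)))) ^ 2) := by
  set b := √(∑' i : idx n, ‖φ i w‖ ^ 2) with hb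
  have hb2 : b ^ 2 = ∑' i : idx n, ‖φ i w‖ ^ 2 := Real.sq_sqrt (tsum_nonneg fun _ => by positivity)
  set a : idx n → ℂ := fun i => b⁻¹ • φ i w with ha
  have han : ∀ i, ‖a i‖ = ‖φ i w‖ / b := fun i => by
    rw [ha, norm_smul, Real.norm_of_nonneg (inv_nonneg.2 hV.le)]
    exact inv_mul_eq_div _ _
  have haη : ∀ i, ‖a i‖ ≤ η := fun i => by
    rw [han, div_le_iff₀ hV]
    exact hdel i
  have hasum : HasSum (fun i => ‖a i‖ ^ 2) 1 := by
    have := hsum.hasSum.div_const (b ^ 2)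
    rw [← hb2, div_self (pow_pos hV 2).ne'] at this
    simpa only [han, div_pow] using this
  set H : (Fin 1 → ℂ) → ℝ := fun x => Real.exp (-(‖x 0‖ ^ 2 / (2 * r ^ 2))) with hH
  have hHc : Continuous H := by fun_prop
  have hHb : ∀ x, |H x| ≤ 1 := fun x => by
    rw [abs_of_pos (Real.exp_pos _)]
    refine Real.exp_le_one_iff.2 ?_
    have : 0 ≤ ‖x 0‖ ^ 2 / (2 * r ^ 2) := by positivity
    linarith
  have hlim := tendsto_integral_comp_partialSum (b := fun _ => b) (w := fun _ : Fin 1 => w)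
    h.measurable (fun _ => hconv) hHc hHb
  have hle : ∫ ω, Real.exp (-(‖b⁻¹ • randomFun n ξ φ ω w‖ ^ 2 / (2 * r ^ 2))) ∂P ≤
      8 * r + (η / (r * min 1 ((1 / (64 * τ)) ^ (1 / ε)))) ^ 2 := by
    refine le_of_tendsto hlim ?_
    have h2 : ∀ᶠ N in atTop, 1 / 2 ≤ ∑ i ∈ idxUpTo n N, ‖a i‖ ^ 2 :=
      (hasum.comp (tendsto_idxUpTo n)).eventually (le_mem_nhds (by norm_num))
    filter_upwards [h2] with N hN
    have := integral_exp_neg_norm_sq_sum_le (X := fun i : idx n => ξ i) hε0 hε1 hτ hη hr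
      (fun i => h.measurable i i.2) (fun i => h.memLp_two i i.2) h.indep
      (fun i => h.unit_variance i i.2) (fun i => h.moment i i.2) (idxUpTo n N) a
      (fun i _ => haη i) (sum_le_hasSum _ (fun _ _ => by positivity) hasum) hN
    refine le_trans (le_of_eq ?_) this
    simp only [hH, Finset.sum_apply, Pi.smul_apply, smul_eq_mul, ha, mul_comm]
  exact measureReal_norm_lt_le (aemeasurable_randomFun h.measurable hconv) hV hr hle

end Series

/-! ### Measurability of sums over zeros -/

section Congruence

lemma analyticOrderNatAt_congr_of_eqOn {f g : ℂ → ℂ} {z : ℂ} {R : ℝ}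
    (h : ∀ w ∈ Metric.ball z R, f w = g w) {w : ℂ} (hw : w ∈ Metric.ball z R) :
    analyticOrderNatAt f w = analyticOrderNatAt g w := by
  have : f =ᶠ[𝓝 w] g := by
    filter_upwards [Metric.isOpen_ball.mem_nhds hw] with x hx using h x hx
  rw [analyticOrderNatAt, analyticOrderNatAt, analyticOrderAt_congr this]

lemma rootSum_congr_of_eqOn {k : ℕ} {f g : ℂ → ℂ} {z : Fin k → ℂ} {R ρ : ℝ} (hρ : ρ < R)
    (h : ∀ j, ∀ w ∈ Metric.ball (z j) R, f w = g w) {G : (Fin k → ℂ) → ℂ}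
    (hGS : ∀ w ∉ Set.univ.pi fun j => Metric.closedBall (z j) ρ, G w = 0) :
    rootSum f G = rootSum g G := by
  refine finsum_congr fun w => ?_
  by_cases hw : w ∈ Set.univ.pi fun j => Metric.closedBall (z j) ρ
  · congr 1
    refine Finset.prod_congr rfl fun j _ => ?_
    rw [analyticOrderNatAt_congr_of_eqOn (h j)
      (Metric.closedBall_subset_ball hρ (hw j trivial))]
  · rw [hGS w hw, mul_zero, mul_zero]

lemma zeroCount_congr_of_eqOn {f g : ℂ → ℂ} {z : ℂ} {r R : ℝ} (hr : r ≤ R)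
    (h : ∀ w ∈ Metric.ball z R, f w = g w) : zeroCount f z r = zeroCount g z r := by
  refine tsum_congr fun w => ?_
  rw [analyticOrderNatAt_congr_of_eqOn h (Metric.ball_subset_ball hr w.2)]

end Congruence

section Version

variable {Ω : Type*} [MeasurableSpace Ω] {P : Measure Ω}

/-- The random series agrees almost surely, on a union of disks, with a jointly measurable function
that is analytic on these disks for every outcome. -/
lemma exists_measurable_analytic_version {n : ℕ∞} {ξ : ℕ → Ω → ℂ} {φ : ℕ → ℂ → ℂ}
    (hξ : ∀ i ∈ idx n, Measurable (ξ i)) {k : ℕ} (z : Fin k → ℂ)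
    (h : ∀ j, ∀ᵐ ω ∂P, (∀ w ∈ Metric.ball (z j) 2, SeriesConverges n ξ φ ω w) ∧
      AnalyticOnNhd ℂ (randomFun n ξ φ ω) (Metric.ball (z j) 2)) :
    ∃ f : Ω → ℂ → ℂ, Measurable (Function.uncurry f) ∧
      (∀ ω j, AnalyticOnNhd ℂ (f ω) (Metric.ball (z j) 2)) ∧
      ∀ᵐ ω ∂P, ∀ j, ∀ w ∈ Metric.ball (z j) 2, f ω w = randomFun n ξ φ ω w := by
  classical
  set p : Ω → Prop := fun ω => ∀ j, (∀ w ∈ Metric.ball (z j) 2, SeriesConverges n ξ φ ω w) ∧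
      AnalyticOnNhd ℂ (randomFun n ξ φ ω) (Metric.ball (z j) 2) with hp
  have hpae : ∀ᵐ ω ∂P, p ω := ae_all_iff.2 h
  set S : Set Ω := (toMeasurable P {ω | ¬ p ω})ᶜ with hS
  have hSm : MeasurableSet S := (measurableSet_toMeasurable _ _).compl
  have hSp : ∀ ω ∈ S, p ω := fun ω hω => by
    by_contra hc
    exact hω (subset_toMeasurable P _ hc)
  have hSae : ∀ᵐ ω ∂P, ω ∈ S := by
    rw [ae_iff]
    have : {ω | ¬ ω ∈ S} = toMeasurable P {ω | ¬ p ω} := by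
      ext ω; simp [hS]
    rw [this, measure_toMeasurable]
    exact ae_iff.1 hpae
  set U : Set ℂ := ⋃ j, Metric.ball (z j) 2 with hU
  have hUo : IsOpen U := isOpen_iUnion fun j => Metric.isOpen_ball
  -- On the exceptional null set and off the disks the version is set to zero.
  set f : Ω → ℂ → ℂ := fun ω w => if ω ∈ S ∧ w ∈ U then randomFun n ξ φ ω w else 0 with hf
  have hfeq : ∀ ω ∈ S, ∀ j, ∀ w ∈ Metric.ball (z j) 2, f ω w = randomFun n ξ φ ω w :=
    fun ω hω j w hw => if_pos ⟨hω, Set.mem_iUnion.2 ⟨j, hw⟩⟩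
  have hf0 : ∀ ω ∉ S, ∀ w, f ω w = 0 := fun ω hω w => if_neg fun h => hω h.1
  have hfan : ∀ ω j, AnalyticOnNhd ℂ (f ω) (Metric.ball (z j) 2) := fun ω j => by
    by_cases hω : ω ∈ S
    · exact ((hSp ω hω j).2).congr Metric.isOpen_ball fun w hw => (hfeq ω hω j w hw).symm
    · have : f ω = fun _ => 0 := funext (hf0 ω hω)
      rw [this]
      exact analyticOnNhd_const
  refine ⟨f, ?_, hfan, hSae.mono hfeq⟩
  have hmeas : ∀ w : U, Measurable fun ω => f ω w := fun w => by
    obtain ⟨j, hj⟩ := Set.mem_iUnion.1 w.2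
    refine measurable_of_tendsto_metrizable
      (f := fun N => S.indicator fun ω => partialSum n ξ φ ω w N)
      (fun N => (measurable_partialSum hξ φ w N).indicator hSm) ?_
    refine tendsto_pi_nhds.2 fun ω => ?_
    by_cases hω : ω ∈ S
    · simp only [Set.indicator_of_mem hω]
      rw [hfeq ω hω j w hj]
      exact ((hSp ω hω j).1 w hj).tendsto
    · simp only [Set.indicator_of_notMem hω]
      rw [hf0 ω hω]
      exact tendsto_const_nhds
  have hcont : ∀ ω, Continuous fun w : U => f ω w := fun ω =>
    continuousOn_iff_continuous_domRestrict.1 fun w hw => by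
      obtain ⟨j, hj⟩ := Set.mem_iUnion.1 hw
      exact (hfan ω j w hj).continuousAt.continuousWithinAt
  -- Continuity in `w` upgrades measurability in `ω` to joint measurability.
  have hun := measurable_uncurry_of_continuous_of_measurable (u := fun (w : U) ω => f ω w)
    hcont hmeas
  have hUm : MeasurableSet {q : Ω × ℂ | q.2 ∈ U} := measurable_snd hUo.measurableSet
  refine measurable_of_restrict_of_restrict_compl hUm ?_ ?_
  · have hg : Measurable fun q : {q : Ω × ℂ | q.2 ∈ U} => ((⟨q.1.2, q.2⟩ : U), q.1.1) :=
      (((measurable_snd.comp measurable_subtype_coe).subtype_mk).prodMk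
        (measurable_fst.comp measurable_subtype_coe))
    exact hun.comp hg
  · have : {q : Ω × ℂ | q.2 ∈ U}ᶜ.domRestrict (Function.uncurry f) = fun _ => 0 :=
      funext fun q => if_neg fun h => q.2 h.2
    rw [this]
    exact measurable_const

end Version

section RandomField

variable {Ω : Type*} [MeasurableSpace Ω] {k : ℕ} {z : Fin k → ℂ} {f : Ω → ℂ → ℂ}

lemma measurable_apply_of_uncurry (hf : Measurable (Function.uncurry f)) (w : ℂ) :
    Measurable fun ω => f ω w := hf.comp (measurable_id.prodMk measurable_const)

lemma measurable_uncurry_apply_coord {β : Type*} [MeasurableSpace β] (hf : Measurable (Function.uncurry f))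
    {g : ℂ → β} (hg : Measurable g) (j : Fin k) :
    Measurable fun q : Ω × (Fin k → ℂ) => g (f q.1 (q.2 j)) :=
  hg.comp (hf.comp (measurable_fst.prodMk ((measurable_pi_apply j).comp measurable_snd)))

/-- By continuity it suffices to test a countable dense set of points. -/
lemma measurableSet_exists_ne_zero (hf : Measurable (Function.uncurry f)) {z : ℂ} {R : ℝ}
    (hfan : ∀ ω, AnalyticOnNhd ℂ (f ω) (Metric.ball z R)) :
    MeasurableSet {ω | ∃ w ∈ Metric.ball z R, f ω w ≠ 0} := by
  obtain ⟨D, hDc, hDd⟩ := TopologicalSpace.exists_countable_dense ℂ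
  have : {ω | ∃ w ∈ Metric.ball z R, f ω w ≠ 0} =
      ⋃ w ∈ D ∩ Metric.ball z R, {ω | f ω w ≠ 0} := by
    ext ω
    simp only [Set.mem_iUnion, exists_prop]
    constructor
    · rintro ⟨w, hw, hne⟩
      have ho : IsOpen (Metric.ball z R ∩ f ω ⁻¹' {0}ᶜ) :=
        (hfan ω).continuousOn.isOpen_inter_preimage Metric.isOpen_ball isOpen_compl_singleton
      obtain ⟨x, hxD, hx⟩ := hDd.exists_mem_open ho ⟨w, hw, hne⟩
      exact ⟨x, ⟨hxD, hx.1⟩, hx.2⟩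
    · rintro ⟨w, hw, hne⟩
      exact ⟨w, hw.2, hne⟩
  rw [this]
  refine MeasurableSet.biUnion (hDc.mono Set.inter_subset_left) fun w _ => ?_
  exact (measurable_apply_of_uncurry hf w) (MeasurableSet.singleton 0).compl

/-- Linear statistics of the zeros of a jointly measurable random analytic function are
measurable, by the integral representation. -/
lemma measurable_rootSum (hf : Measurable (Function.uncurry f))
    (hfan : ∀ ω j, AnalyticOnNhd ℂ (f ω) (Metric.ball (z j) 2)) {ρ : ℝ} (hρ : ρ < 2)
    {G : (Fin k → ℂ) → ℂ} (hG : ContDiff ℝ (2 * k : ℕ) G)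
    (hGS : ∀ w ∉ Set.univ.pi fun j => Metric.closedBall (z j) ρ, G w = 0) :
    Measurable fun ω => rootSum (f ω) G := by
  classical
  set I : Ω → ℂ := fun ω => ∫ w, (∏ j, Real.log ‖f ω (w j)‖) • lapAll G w with hI
  have hIm : Measurable I := by
    refine (StronglyMeasurable.integral_prod_right ?_).measurable
    refine Measurable.stronglyMeasurable ?_
    have h1 : Measurable fun q : Ω × (Fin k → ℂ) => ∏ j, Real.log ‖f q.1 (q.2 j)‖ :=
      Finset.measurable_prod _ fun j _ =>
        measurable_uncurry_apply_coord hf (Real.measurable_log.comp measurable_norm) j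
    exact h1.smul ((continuous_lapAll hG).measurable.comp measurable_snd)
  -- Where `f ω` vanishes identically on one of the disks, the sum over the zeros is zero by
  -- convention, and the integral representation fails.
  set E : Set Ω := ⋂ j, {ω | ∃ w ∈ Metric.ball (z j) 2, f ω w ≠ 0} with hE
  have hEm : MeasurableSet E :=
    MeasurableSet.iInter fun j => measurableSet_exists_ne_zero hf fun ω => hfan ω j
  have heq : (fun ω => rootSum (f ω) G) =
      E.indicator fun ω => ((2 * Real.pi) ^ k)⁻¹ • I ω := by
    ext ω
    by_cases hω : ω ∈ E
    · rw [Set.indicator_of_mem hω]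
      simp only [hI]
      rw [← rootSum_eq_integral hρ (hfan ω) (fun j => Set.mem_iInter.1 hω j) hG hGS, smul_smul,
        inv_mul_cancel₀ (by positivity), one_smul]
    · rw [Set.indicator_of_notMem hω]
      simp only [hE, Set.mem_iInter, not_forall] at hω
      obtain ⟨j, hj⟩ := hω
      refine rootSum_eq_zero hρ j (fun w hw => ?_) hGS
      by_contra hne
      exact hj ⟨w, hw, hne⟩
  rw [heq]
  exact (hIm.const_smul ((2 * Real.pi) ^ k)⁻¹).indicator hEm

/-- A measurable random variable between the number of zeros in a small disk and the number of zeros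
in a larger disk. -/
lemma exists_measurable_count (hf : Measurable (Function.uncurry f)) {z : ℂ}
    (hfan : ∀ ω, AnalyticOnNhd ℂ (f ω) (Metric.ball z 2)) :
    ∃ N : Ω → ℝ, Measurable N ∧ (∀ ω, 0 ≤ N ω) ∧
      (∀ ω, ENNReal.ofReal (N ω) ≤ zeroCount (f ω) z 1) ∧
      ∀ ω (Z : Finset ℂ), (Z : Set ℂ) ⊆ Metric.closedBall z (1 / 100) →
        (∑ w ∈ Z, (analyticOrderNatAt (f ω) w : ℝ)) ≤ N ω := by
  classical
  let χ : ContDiffBump z := ⟨1 / 100, 1 / 2, by norm_num, by norm_num⟩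
  set G : (Fin 1 → ℂ) → ℂ := fun w => ∏ j, ((χ (w j) : ℝ) : ℂ) with hG
  have hGc : ContDiff ℝ (2 * 1 : ℕ) G := by
    refine contDiff_prod fun j _ => ?_
    exact Complex.ofRealCLM.contDiff.comp (χ.contDiff.comp (contDiff_apply ℝ ℂ j))
  have hχ0 : ∀ w ∉ Metric.closedBall z (1 / 2), χ w = 0 := fun w hw =>
    χ.zero_of_le_dist (not_le.1 hw).le
  have hGS : ∀ w ∉ Set.univ.pi fun _ : Fin 1 => Metric.closedBall z (1 / 2), G w = 0 := by
    intro w hw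
    simp only [Set.mem_pi, Set.mem_univ, true_implies, not_forall] at hw
    obtain ⟨j, hj⟩ := hw
    refine Finset.prod_eq_zero (Finset.mem_univ j) ?_
    rw [hχ0 _ hj, Complex.ofReal_zero]
  have hmeas := measurable_rootSum (z := fun _ : Fin 1 => z) hf (fun ω _ => hfan ω)
    (ρ := 1 / 2) (by norm_num) hGc hGS
  have hfin : ∀ ω, {w | w ∈ Metric.closedBall z (1 / 2) ∧ analyticOrderNatAt (f ω) w ≠ 0}.Finite :=
    fun ω => finite_setOf_analyticOrderNatAt_ne_zero (hfan ω) (isCompact_closedBall z (1 / 2))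
      (Metric.closedBall_subset_ball (by norm_num))
  have hsum : ∀ ω, rootSum (f ω) G =
      ((∑ w ∈ (hfin ω).toFinset, (analyticOrderNatAt (f ω) w : ℝ) * χ w : ℝ) : ℂ) := fun ω => by
    rw [rootSum_eq_sum_piFinset (S := fun _ => Metric.closedBall z (1 / 2))
      (Z := fun _ => (hfin ω).toFinset) (fun j w => by simp) hGS]
    simp only [hG, ← Finset.prod_mul_distrib]
    rw [← Finset.prod_univ_sum (fun _ : Fin 1 => (hfin ω).toFinset)
      (fun _ w => (analyticOrderNatAt (f ω) w : ℂ) * ((χ w : ℝ) : ℂ))]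
    simp
  refine ⟨fun ω => (rootSum (f ω) G).re, Complex.measurable_re.comp hmeas, fun ω => ?_,
    fun ω => ?_, fun ω Z hZ => ?_⟩
  · simp only [hsum, Complex.ofReal_re]
    exact Finset.sum_nonneg fun w _ => mul_nonneg (Nat.cast_nonneg _) χ.nonneg
  · simp only [hsum, Complex.ofReal_re]
    have hmem : ∀ w ∈ (hfin ω).toFinset, w ∈ Metric.ball z 1 := fun w hw =>
      Metric.closedBall_subset_ball (by norm_num) ((Set.Finite.mem_toFinset _).1 hw).1
    calc ENNReal.ofReal (∑ w ∈ (hfin ω).toFinset, (analyticOrderNatAt (f ω) w : ℝ) * χ w)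
        ≤ ENNReal.ofReal (∑ w ∈ (hfin ω).toFinset, (analyticOrderNatAt (f ω) w : ℝ)) :=
          ENNReal.ofReal_le_ofReal (Finset.sum_le_sum fun w _ =>
            mul_le_of_le_one_right (Nat.cast_nonneg _) χ.le_one)
      _ = ∑ w ∈ (hfin ω).toFinset, (analyticOrderNatAt (f ω) w : ℝ≥0∞) := by
          rw [ENNReal.ofReal_sum_of_nonneg fun _ _ => Nat.cast_nonneg _]
          simp
      _ = ∑ w ∈ (hfin ω).toFinset.subtype fun w => w ∈ Metric.ball z 1,
            (analyticOrderNatAt (f ω) (w : ℂ) : ℝ≥0∞) :=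
          (Finset.sum_subtype_of_mem (fun w => (analyticOrderNatAt (f ω) w : ℝ≥0∞)) hmem).symm
      _ ≤ _ := ENNReal.sum_le_tsum _
  · simp only [hsum, Complex.ofReal_re]
    calc ∑ w ∈ Z, (analyticOrderNatAt (f ω) w : ℝ)
        = ∑ w ∈ Z.filter fun w => analyticOrderNatAt (f ω) w ≠ 0,
            (analyticOrderNatAt (f ω) w : ℝ) := by
          rw [Finset.sum_filter_of_ne]
          intro w _ h
          exact_mod_cast h
      _ = ∑ w ∈ Z.filter fun w => analyticOrderNatAt (f ω) w ≠ 0,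
            (analyticOrderNatAt (f ω) w : ℝ) * χ w := by
          refine Finset.sum_congr rfl fun w hw => ?_
          rw [χ.one_of_mem_closedBall (hZ (Finset.mem_filter.1 hw).1), mul_one]
      _ ≤ _ := by
          refine Finset.sum_le_sum_of_subset_of_nonneg (fun w hw => ?_) fun w _ _ =>
            mul_nonneg (Nat.cast_nonneg _) χ.nonneg
          rw [Finset.mem_filter] at hw
          exact (Set.Finite.mem_toFinset _).2
            ⟨Metric.closedBall_subset_closedBall (by norm_num) (hZ hw.1), hw.2⟩

lemma norm_rootSum_le {g : ℂ → ℂ} {N : Fin k → ℝ} {B : ℝ}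
    (hg : ∀ j, AnalyticOnNhd ℂ g (Metric.ball (z j) 2))
    (hN : ∀ j (Z : Finset ℂ), (Z : Set ℂ) ⊆ Metric.closedBall (z j) (1 / 100) →
      (∑ w ∈ Z, (analyticOrderNatAt g w : ℝ)) ≤ N j)
    {G : (Fin k → ℂ) → ℂ} (hGB : ∀ w, ‖G w‖ ≤ B)
    (hGS : ∀ w ∉ Set.univ.pi fun j => Metric.closedBall (z j) (1 / 100), G w = 0) :
    ‖rootSum g G‖ ≤ B * ∏ j, N j := by
  have hB : 0 ≤ B := (norm_nonneg _).trans (hGB 0)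
  have hfin : ∀ j, {w | w ∈ Metric.closedBall (z j) (1 / 100) ∧
      analyticOrderNatAt g w ≠ 0}.Finite := fun j =>
    finite_setOf_analyticOrderNatAt_ne_zero (hg j) (isCompact_closedBall _ _)
      (Metric.closedBall_subset_ball (by norm_num))
  rw [rootSum_eq_sum_piFinset (S := fun j => Metric.closedBall (z j) (1 / 100))
    (Z := fun j => (hfin j).toFinset) (fun j w => by simp) hGS]
  calc _ ≤ ∑ w ∈ Fintype.piFinset fun j => (hfin j).toFinset,
        (∏ j, (analyticOrderNatAt g (w j) : ℝ)) * B := by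
        refine (norm_sum_le _ _).trans (Finset.sum_le_sum fun w _ => ?_)
        rw [norm_mul, norm_prod]
        simp only [Complex.norm_natCast]
        gcongr
        exact hGB w
    _ = B * ∏ j, ∑ w ∈ (hfin j).toFinset, (analyticOrderNatAt g w : ℝ) := by
        rw [← Finset.sum_mul, Finset.prod_univ_sum, mul_comm]
    _ ≤ _ := by
        refine mul_le_mul_of_nonneg_left (Finset.prod_le_prod (fun j _ =>
          Finset.sum_nonneg fun _ _ => Nat.cast_nonneg _) fun j _ => hN j _ fun w hw => ?_) hB
        exact ((Set.Finite.mem_toFinset _).1 hw).1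

end RandomField

/-! ### Clipping the logarithm -/

section Clip

/-- The logarithm `log ‖u‖`, clipped to the interval `[-M, M]`. -/
noncomputable def clipLog (M : ℝ) (u : ℂ) : ℝ := max (-M) (min M (Real.log ‖u‖))

lemma measurable_clipLog (M : ℝ) : Measurable (clipLog M) :=
  measurable_const.max (measurable_const.min (Real.measurable_log.comp measurable_norm))

lemma abs_clipLog_le {M : ℝ} (hM : 0 ≤ M) (u : ℂ) : |clipLog M u| ≤ M :=
  abs_le.2 ⟨le_max_left _ _, max_le (by linarith) (min_le_left _ _)⟩

lemma clipLog_eq {M : ℝ} {u : ℂ} (hu : |Real.log ‖u‖| ≤ M) : clipLog M u = Real.log ‖u‖ := by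
  rw [abs_le] at hu
  rw [clipLog, min_eq_right hu.2, max_eq_right hu.1]

lemma abs_clipLog_le_abs_log {M : ℝ} (hM : 0 ≤ M) (u : ℂ) :
    |clipLog M u| ≤ |Real.log ‖u‖| := by
  rcases le_or_gt |Real.log ‖u‖| M with h | h
  · rw [clipLog_eq h]
  · exact (abs_clipLog_le hM u).trans h.le

/-- Two products of bounded factors differ only where some factors differ; `q` dominates the indicator
of that. -/
lemma abs_prod_sub_prod_le {k : ℕ} {a b q : Fin k → ℝ} {R : ℝ} (ha : |∏ j, a j| ≤ R)
    (hb : |∏ j, b j| ≤ R) (hq : ∀ j, 0 ≤ q j) (h : ∀ j, a j ≠ b j → 1 ≤ q j) :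
    |∏ j, a j - ∏ j, b j| ≤ 2 * R * ∑ j, q j := by
  have hR : 0 ≤ R := (abs_nonneg _).trans ha
  by_cases hall : ∀ j, a j = b j
  · rw [Finset.prod_congr rfl fun j _ => hall j, sub_self, abs_zero]
    exact mul_nonneg (by linarith) (Finset.sum_nonneg fun j _ => hq j)
  · push Not at hall
    obtain ⟨j, hj⟩ := hall
    have h1 : 1 ≤ ∑ j, q j :=
      (h j hj).trans (Finset.single_le_sum (fun i _ => hq i) (Finset.mem_univ j))
    calc _ ≤ |∏ j, a j| + |∏ j, b j| := abs_sub _ _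
      _ ≤ 2 * R * 1 := by linarith
      _ ≤ _ := by gcongr

/-- The two truncations of the logarithm differ only at values that are small compared with the
smoothing scale, or whose logarithm is large. -/
lemma abs_prod_clipLog_sub_prod_truncLog_le {k : ℕ} {M : ℝ} (hM : 0 < M) {s : Fin k → ℝ}
    {u : Fin k → ℂ} (hs : ∀ j, 0 ≤ s j) (h0 : ∀ j, s j = 0 → u j = 0) :
    |∏ j, clipLog M (u j) - ∏ j, truncLog M (s j) (u j)| ≤
      2 * (2 * M) ^ k * ∑ j, ((if ‖u j‖ < s j then 1 else 0) +
        if M < |Real.log ‖u j‖| then 1 else 0) := by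
  have hbd : ∀ a : Fin k → ℝ, (∀ j, |a j| ≤ 2 * M) → |∏ j, a j| ≤ (2 * M) ^ k := fun a ha => by
    rw [Finset.abs_prod]
    calc _ ≤ ∏ _j : Fin k, (2 * M) := Finset.prod_le_prod (fun _ _ => abs_nonneg _) fun j _ => ha j
      _ = _ := by simp
  refine abs_prod_sub_prod_le
    (hbd _ fun j => (abs_clipLog_le hM.le _).trans (by linarith))
    (hbd _ fun j => abs_truncLog_le hM.le _ _) (fun j => ?_) fun j hj => ?_
  · split_ifs <;> norm_num
  · by_contra hlt
    have h1 : ¬ ‖u j‖ < s j := fun h => hlt (by rw [if_pos h]; split_ifs <;> norm_num)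
    have h2 : ¬ M < |Real.log ‖u j‖| := fun h => hlt (by rw [if_pos h, if_neg h1]; norm_num)
    rw [not_lt] at h1 h2
    refine hj ?_
    rw [clipLog_eq h2]
    rcases (hs j).eq_or_lt with h | h
    · rw [h0 j h.symm, ← h, truncLog, if_pos rfl, norm_zero, Real.log_zero]
    · rw [truncLog_eq hM h h1 h2]

lemma volume_real_closedBall_le_one (z : ℂ) :
    volume.real (Metric.closedBall z (1 / 100)) ≤ 1 := by
  rw [Measure.real, Complex.volume_closedBall]
  have := Real.pi_lt_four
  rw [ENNReal.toReal_mul, ENNReal.toReal_pow, ENNReal.toReal_ofReal (by norm_num)]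
  simp only [ENNReal.coe_toReal, NNReal.coe_real_pi]
  nlinarith

/-- Truncating the logarithms in an integral against a bounded function costs little when high
moments of the logarithms are under control. -/
lemma norm_integral_prod_log_sub_prod_clipLog_le {k m : ℕ} {g : ℂ → ℂ} (hg : Measurable g)
    {S : Fin k → Set ℂ} (hS : ∀ j, IsCompact (S j)) {B Q M L : ℝ}
    (hM : 0 < M) (h1 : ∀ j, IntegrableOn (fun w => |Real.log ‖g w‖|) (S j))
    (h1B : ∀ j, ∫ w in S j, |Real.log ‖g w‖| ≤ B * Q)
    (hm : ∀ j, IntegrableOn (fun w => |Real.log ‖g w‖| ^ (m + 1)) (S j))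
    (hmB : ∀ j, ∫ w in S j, |Real.log ‖g w‖| ^ (m + 1) ≤ B * Q ^ (m + 1))
    {H : (Fin k → ℂ) → ℂ} (hH : Continuous H) (hHL : ∀ w, ‖H w‖ ≤ L)
    (hHS : ∀ w ∉ Set.univ.pi S, H w = 0) :
    ‖(∫ w, (∏ j, Real.log ‖g (w j)‖) • H w) - ∫ w, (∏ j, clipLog M (g (w j))) • H w‖ ≤
      L * (2 * (k * (B ^ k * (Q ^ (k + m) / M ^ m)))) := by
  have hL : 0 ≤ L := (norm_nonneg _).trans (hHL 0)
  have hlm : Measurable fun w => Real.log ‖g w‖ := Real.measurable_log.comp hg.norm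
  have hi1 : ∀ j, IntegrableOn (fun w => Real.log ‖g w‖) (S j) := fun j =>
    (integrable_norm_iff hlm.aestronglyMeasurable).1 (h1 j)
  have hi2 : ∀ j, IntegrableOn (fun w => clipLog M (g w)) (S j) := fun j =>
    Integrable.mono (hi1 j) ((measurable_clipLog M).comp hg).aestronglyMeasurable
      (Eventually.of_forall fun w => abs_clipLog_le_abs_log hM.le _)
  have hI1 := integrable_prod_smul hS hi1 hH hHS
  have hI2 := integrable_prod_smul hS hi2 hH hHS
  rw [← integral_sub hI1 hI2]
  -- If the `j`-th factor is clipped, then `M⁻ᵐ |log ‖g (w j)‖|ᵐ` is at least one there, at the price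
  -- of raising the `j`-th factor to the power `m + 1`.
  set h : Fin k → Fin k → ℂ → ℝ := fun j i =>
    (S i).indicator fun w => |Real.log ‖g w‖| ^ (1 + if i = j then m else 0) with hh
  have hint : ∀ i j, Integrable (h j i) ∧
      ∫ w, h j i w ≤ B * Q ^ (1 + if i = j then m else 0) := fun i j => by
    simp only [hh]
    rw [integrable_indicator_iff (hS i).measurableSet, integral_indicator (hS i).measurableSet]
    by_cases hij : i = j
    · simp only [if_pos hij, add_comm 1 m]
      exact ⟨hm i, hmB i⟩
    · simp only [if_neg hij, add_zero, pow_one]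
      exact ⟨h1 i, h1B i⟩
  have hprod : ∀ j, Integrable (fun w : Fin k → ℂ => ∏ i, h j i (w i)) := fun j =>
    Integrable.fintype_prod fun i => (hint i j).1
  have hprodle : ∀ j, ∫ w : Fin k → ℂ, ∏ i, h j i (w i) ≤ B ^ k * Q ^ (k + m) := fun j => by
    rw [integral_fintype_prod_volume_eq_prod]
    calc _ ≤ ∏ i, (B * Q ^ (1 + if i = j then m else 0)) := by
          refine Finset.prod_le_prod (fun i _ => integral_nonneg fun w => ?_) fun i _ => (hint i j).2
          exact Set.indicator_nonneg (fun _ _ => by positivity) _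
      _ = _ := by
          rw [Finset.prod_mul_distrib, Finset.prod_pow_eq_pow_sum, Finset.sum_add_distrib]
          simp
  have hpt : ∀ w, ‖(∏ j, Real.log ‖g (w j)‖) • H w - (∏ j, clipLog M (g (w j))) • H w‖ ≤
      L * (2 * (M ^ m)⁻¹) * ∑ j, ∏ i, h j i (w i) := fun w => by
    rw [← sub_smul, norm_smul]
    by_cases hw : w ∈ Set.univ.pi S
    · have e1 := abs_prod_sub_prod_le (a := fun j => Real.log ‖g (w j)‖)
        (b := fun j => clipLog M (g (w j))) (R := ∏ j, |Real.log ‖g (w j)‖|)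
        (q := fun j => |Real.log ‖g (w j)‖| ^ m * (M ^ m)⁻¹) (Finset.abs_prod _ _).le
        (by
          rw [Finset.abs_prod]
          exact Finset.prod_le_prod (fun _ _ => abs_nonneg _) fun j _ =>
            abs_clipLog_le_abs_log hM.le _)
        (fun j => by positivity) fun j hj => by
          have hlt : M < |Real.log ‖g (w j)‖| := by
            by_contra hc
            exact hj (clipLog_eq (not_lt.1 hc)).symm
          rw [← div_eq_mul_inv, one_le_div (by positivity)]
          exact pow_le_pow_left₀ hM.le hlt.le m
      have e2 : ∀ j, ∏ i, h j i (w i) =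
          (∏ i, |Real.log ‖g (w i)‖|) * |Real.log ‖g (w j)‖| ^ m := fun j => by
        have : ∀ i, h j i (w i) = |Real.log ‖g (w i)‖| *
            if i = j then |Real.log ‖g (w i)‖| ^ m else 1 := fun i => by
          simp only [hh]
          rw [Set.indicator_of_mem (hw i trivial), pow_add, pow_one]
          split_ifs <;> simp
        rw [Finset.prod_congr rfl fun i _ => this i, Finset.prod_mul_distrib]
        simp
      simp_rw [e2]
      rw [Real.norm_eq_abs]
      calc _ ≤ (2 * (∏ j, |Real.log ‖g (w j)‖|) *
            ∑ j, |Real.log ‖g (w j)‖| ^ m * (M ^ m)⁻¹) * L :=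
            mul_le_mul e1 (hHL w) (norm_nonneg _) (by positivity)
        _ = _ := by
            rw [← Finset.sum_mul, ← Finset.mul_sum]
            ring
    · rw [hHS w hw, norm_zero, mul_zero]
      refine mul_nonneg (by positivity) (Finset.sum_nonneg fun j _ => Finset.prod_nonneg fun i _ =>
        Set.indicator_nonneg (fun _ _ => by positivity) _)
  have hsumi : Integrable fun w : Fin k → ℂ => ∑ j, ∏ i, h j i (w i) :=
    integrable_finsetSum _ fun j _ => hprod j
  calc _ ≤ ∫ w : Fin k → ℂ, L * (2 * (M ^ m)⁻¹) * ∑ j, ∏ i, h j i (w i) :=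
        norm_integral_le_of_norm_le (hsumi.const_mul _) (Eventually.of_forall hpt)
    _ = L * (2 * (M ^ m)⁻¹) * ∑ j, ∫ w : Fin k → ℂ, ∏ i, h j i (w i) := by
        rw [integral_const_mul, integral_finsetSum _ fun j _ => hprod j]
    _ ≤ L * (2 * (M ^ m)⁻¹) * ∑ _j : Fin k, B ^ k * Q ^ (k + m) := by
        gcongr with j
        exact hprodle j
    _ = _ := by
        rw [Finset.sum_const, Finset.card_univ, Fintype.card_fin, nsmul_eq_mul]
        ring

end Clip

/-! ### Linear statistics of the zeros of one random function -/

section Counting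

/-- A product of counts is at most the `k`-th power of the largest one. This is at most `T ^ k` unless
the largest count exceeds `T`, where two more powers gain a factor `T⁻²`. -/
lemma prod_le_sum_truncated {k : ℕ} (hk : 0 < k) {N : Fin k → ℝ} (hN : ∀ j, 0 ≤ N j) {T : ℝ}
    (hT : 0 < T) :
    ∏ j, N j ≤ ∑ j, (T ^ k + (T ^ 2)⁻¹ * if T ≤ N j then N j ^ (k + 2) else 0) := by
  have hne : (Finset.univ : Finset (Fin k)).Nonempty := ⟨⟨0, hk⟩, Finset.mem_univ _⟩
  obtain ⟨i, -, hi⟩ := Finset.exists_max_image Finset.univ N hne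
  have h1 : ∏ j, N j ≤ N i ^ k := by
    calc _ ≤ ∏ _j : Fin k, N i := Finset.prod_le_prod (fun j _ => hN j) fun j hj => hi j hj
      _ = _ := by simp
  have h2 : N i ^ k ≤ T ^ k + (T ^ 2)⁻¹ * if T ≤ N i then N i ^ (k + 2) else 0 := by
    split_ifs with h
    · have h3 : N i ^ k ≤ (T ^ 2)⁻¹ * N i ^ (k + 2) := by
        rw [le_inv_mul_iff₀ (by positivity), pow_add, mul_comm]
        exact mul_le_mul_of_nonneg_left (pow_le_pow_left₀ hT.le h 2) (pow_nonneg (hN i) k)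
      have : 0 ≤ T ^ k := by positivity
      linarith
    · rw [mul_zero, add_zero]
      exact pow_le_pow_left₀ (hN i) (not_le.1 h).le k
  refine (h1.trans h2).trans (Finset.single_le_sum
    (f := fun j => T ^ k + (T ^ 2)⁻¹ * if T ≤ N j then N j ^ (k + 2) else 0)
    (fun j _ => ?_) (Finset.mem_univ i))
  have := hN j
  positivity

variable {Ω : Type*} [MeasurableSpace Ω] {P : Measure Ω}

lemma integrable_truncated_pow {N : Ω → ℝ} (hNm : Measurable N) (hN : ∀ ω, 0 ≤ N ω)
    {Z : Ω → ℝ≥0∞} (hNZ : ∀ ω, ENNReal.ofReal (N ω) ≤ Z ω) {T C : ℝ} (hC : 0 ≤ C) {p : ℕ}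
    (h : ∫⁻ ω, ({ω | ENNReal.ofReal T ≤ Z ω}.indicator (fun ω => Z ω ^ p) ω) ∂P ≤
      ENNReal.ofReal C) :
    Integrable (fun ω => if T ≤ N ω then N ω ^ p else 0) P ∧
      ∫ ω, (if T ≤ N ω then N ω ^ p else 0) ∂P ≤ C := by
  have hm : Measurable fun ω => if T ≤ N ω then N ω ^ p else 0 :=
    Measurable.ite (measurableSet_le measurable_const hNm) (hNm.pow_const p) measurable_const
  have h0 : ∀ ω, 0 ≤ if T ≤ N ω then N ω ^ p else 0 := fun ω => by
    have := hN ω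
    positivity
  have hle : ∫⁻ ω, ENNReal.ofReal (if T ≤ N ω then N ω ^ p else 0) ∂P ≤ ENNReal.ofReal C := by
    refine (lintegral_mono fun ω => ?_).trans h
    split_ifs with hT
    · rw [Set.indicator_of_mem (show ω ∈ {ω | ENNReal.ofReal T ≤ Z ω} from
        (ENNReal.ofReal_le_ofReal hT).trans (hNZ ω)), ENNReal.ofReal_pow (hN ω)]
      exact pow_le_pow_left₀ (zero_le) (hNZ ω) p
    · simp
  constructor
  · rw [← lintegral_ofReal_ne_top_iff_integrable hm.aestronglyMeasurable
      (Eventually.of_forall h0)]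
    exact (hle.trans_lt ENNReal.ofReal_lt_top).ne
  · rw [integral_eq_lintegral_of_nonneg_ae (Eventually.of_forall h0) hm.aestronglyMeasurable]
    exact ENNReal.toReal_le_of_le_ofReal hC hle

end Counting

section ClipSum

variable {k : ℕ}

/-- The linear statistic of the zeros of `g`, expressed through the logarithm of `‖g‖` and with this
logarithm clipped to `[-M, M]`. -/
noncomputable def clipSum (M : ℝ) (g : ℂ → ℂ) (G : (Fin k → ℂ) → ℂ) : ℂ :=
  ((2 * Real.pi) ^ k)⁻¹ • ∫ w, (∏ j, clipLog M (g (w j))) • lapAll G w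

lemma norm_inv_two_pi_pow_le_one (k : ℕ) : ‖((2 * Real.pi) ^ k)⁻¹‖ ≤ 1 := by
  have h1 : (1 : ℝ) ≤ (2 * Real.pi) ^ k := one_le_pow₀ (by linarith [Real.pi_gt_three])
  rw [norm_inv, Real.norm_of_nonneg (by positivity)]
  exact inv_le_one_of_one_le₀ h1

lemma volume_real_pi_closedBall_le_one (z : Fin k → ℂ) :
    volume.real (Set.univ.pi fun j => Metric.closedBall (z j) (1 / 100)) ≤ 1 := by
  rw [Measure.real, volume_pi_pi, ENNReal.toReal_prod]
  exact Finset.prod_le_one (fun _ _ => ENNReal.toReal_nonneg) fun j _ =>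
    volume_real_closedBall_le_one (z j)

lemma isCompact_pi_closedBall (z : Fin k → ℂ) (r : ℝ) :
    IsCompact (Set.univ.pi fun j => Metric.closedBall (z j) r) :=
  isCompact_univ_pi fun j => isCompact_closedBall (z j) r

lemma norm_integral_le_of_support {z : Fin k → ℂ} {F : (Fin k → ℂ) → ℂ} {B : ℝ} (hB : 0 ≤ B)
    (hF : ∀ w ∉ Set.univ.pi fun j => Metric.closedBall (z j) (1 / 100), F w = 0)
    (hb : ∀ w, ‖F w‖ ≤ B) : ‖∫ w, F w‖ ≤ B := by
  rw [← setIntegral_eq_integral_of_forall_compl_eq_zero hF]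
  refine (norm_setIntegral_le_of_norm_le_const (isCompact_pi_closedBall z _).measure_lt_top
    fun w _ => hb w).trans ?_
  exact mul_le_of_le_one_right hB (volume_real_pi_closedBall_le_one z)

lemma abs_prod_clipLog_le {M : ℝ} (hM : 0 ≤ M) (u : Fin k → ℂ) :
    |∏ j, clipLog M (u j)| ≤ M ^ k := by
  rw [Finset.abs_prod]
  calc _ ≤ ∏ _j : Fin k, M :=
        Finset.prod_le_prod (fun _ _ => abs_nonneg _) fun j _ => abs_clipLog_le hM _
    _ = _ := by simp

lemma norm_clipSum_le {M L : ℝ} (hM : 0 ≤ M) (g : ℂ → ℂ) {G : (Fin k → ℂ) → ℂ} {z : Fin k → ℂ}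
    (hGS : ∀ w ∉ Set.univ.pi fun j => Metric.closedBall (z j) (1 / 100), G w = 0)
    (hGL : ∀ w, ‖lapAll G w‖ ≤ L) : ‖clipSum M g G‖ ≤ L * M ^ k := by
  have hL : 0 ≤ L := (norm_nonneg _).trans (hGL 0)
  rw [clipSum, norm_smul]
  refine (mul_le_of_le_one_left (norm_nonneg _) (norm_inv_two_pi_pow_le_one k)).trans ?_
  refine norm_integral_le_of_support (z := z) (by positivity) (fun w hw => ?_) fun w => ?_
  · rw [lapAll_eq_zero (isCompact_pi_closedBall z _).isClosed hGS w hw, smul_zero]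
  · rw [norm_smul, mul_comm]
    exact mul_le_mul (hGL w) (abs_prod_clipLog_le hM _) (norm_nonneg _) hL

variable {Ω : Type*} [MeasurableSpace Ω] {P : Measure Ω} {f : Ω → ℂ → ℂ}

lemma measurable_prod_clipLog_smul (hf : Measurable (Function.uncurry f)) (M : ℝ)
    {G : (Fin k → ℂ) → ℂ} (hG : ContDiff ℝ (2 * k : ℕ) G) :
    Measurable fun q : Ω × (Fin k → ℂ) => (∏ j, clipLog M (f q.1 (q.2 j))) • lapAll G q.2 := by
  have h1 : Measurable fun q : Ω × (Fin k → ℂ) => ∏ j, clipLog M (f q.1 (q.2 j)) :=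
    Finset.measurable_prod _ fun j _ => measurable_uncurry_apply_coord hf (measurable_clipLog M) j
  exact h1.smul ((continuous_lapAll hG).measurable.comp measurable_snd)

lemma measurable_clipSum (hf : Measurable (Function.uncurry f)) (M : ℝ)
    {G : (Fin k → ℂ) → ℂ} (hG : ContDiff ℝ (2 * k : ℕ) G) :
    Measurable fun ω => clipSum M (f ω) G := by
  have h := (measurable_prod_clipLog_smul hf M hG).stronglyMeasurable
  exact (StronglyMeasurable.integral_prod_right' h).measurable.const_smul ((2 * Real.pi) ^ k)⁻¹

variable [IsProbabilityMeasure P]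

lemma integral_clipSum (hf : Measurable (Function.uncurry f)) {M : ℝ} (hM : 0 ≤ M)
    {G : (Fin k → ℂ) → ℂ} {z : Fin k → ℂ} (hG : ContDiff ℝ (2 * k : ℕ) G)
    (hGS : ∀ w ∉ Set.univ.pi fun j => Metric.closedBall (z j) (1 / 100), G w = 0) :
    ∫ ω, clipSum M (f ω) G ∂P =
      ((2 * Real.pi) ^ k)⁻¹ • ∫ w, (∫ ω, ∏ j, clipLog M (f ω (w j)) ∂P) • lapAll G w := by
  have hLS := lapAll_eq_zero (isCompact_pi_closedBall z (1 / 100)).isClosed hGS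
  have hc : HasCompactSupport (lapAll G) :=
    HasCompactSupport.of_support_subset_isCompact (isCompact_pi_closedBall z (1 / 100))
      fun w hw => by by_contra h; exact hw (hLS w h)
  have hLi : Integrable (lapAll G) := (continuous_lapAll hG).integrable_of_hasCompactSupport hc
  have hint : Integrable (Function.uncurry fun (ω : Ω) (w : Fin k → ℂ) =>
      (∏ j, clipLog M (f ω (w j))) • lapAll G w) (P.prod volume) := by
    have h2 : Integrable (fun q : Ω × (Fin k → ℂ) => M ^ k * ‖lapAll G q.2‖) (P.prod volume) :=
      (hLi.norm.comp_snd P).const_mul _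
    refine h2.mono' (measurable_prod_clipLog_smul hf M hG).aestronglyMeasurable
      (Eventually.of_forall fun q => ?_)
    simp only [Function.uncurry]
    rw [norm_smul]
    exact mul_le_mul_of_nonneg_right (abs_prod_clipLog_le hM _) (norm_nonneg _)
  simp only [clipSum]
  rw [integral_smul, integral_integral_swap hint]
  congr 2 with w
  rw [integral_smul_const]

/-- Comparison, in mean, of a linear statistic of the zeros with its truncated version. On the good
event `E` the logarithm has moments under control; the contribution of the complement is bounded
through the number of zeros. -/
lemma integrable_rootSum_and_norm_sub_le (hk : 0 < k) (hf : Measurable (Function.uncurry f))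
    {z : Fin k → ℂ} (hfan : ∀ ω j, AnalyticOnNhd ℂ (f ω) (Metric.ball (z j) 2)) {M L : ℝ}
    (hM : 0 < M) {G : (Fin k → ℂ) → ℂ} (hG : ContDiff ℝ (2 * k : ℕ) G)
    (hGS : ∀ w ∉ Set.univ.pi fun j => Metric.closedBall (z j) (1 / 100), G w = 0)
    (hG2 : ∀ w, ‖G w‖ ≤ 2) (hGL : ∀ w, ‖lapAll G w‖ ≤ L) {B Q : ℝ} {m : ℕ} (hB : 0 ≤ B)
    (hQ : 0 ≤ Q) {E : Set Ω} (hE : MeasurableSet E)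
    (hne : ∀ ω ∈ E, ∀ j, ∃ w ∈ Metric.ball (z j) 2, f ω w ≠ 0)
    (h1 : ∀ ω ∈ E, ∀ j,
      IntegrableOn (fun w => |Real.log ‖f ω w‖|) (Metric.closedBall (z j) (1 / 100)) ∧
      ∫ w in Metric.closedBall (z j) (1 / 100), |Real.log ‖f ω w‖| ≤ B * Q)
    (hm : ∀ ω ∈ E, ∀ j,
      IntegrableOn (fun w => |Real.log ‖f ω w‖| ^ (m + 1)) (Metric.closedBall (z j) (1 / 100)) ∧
      ∫ w in Metric.closedBall (z j) (1 / 100), |Real.log ‖f ω w‖| ^ (m + 1) ≤ B * Q ^ (m + 1))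
    {p₀ T C : ℝ} (hp₀ : P.real Eᶜ ≤ p₀) (hT : 0 < T) (hC : 0 ≤ C)
    (hroot : ∀ j, ∫⁻ ω, ({ω | ENNReal.ofReal T ≤ zeroCount (f ω) (z j) 1}.indicator
      (fun ω => zeroCount (f ω) (z j) 1 ^ (k + 2)) ω) ∂P ≤ ENNReal.ofReal C) :
    Integrable (fun ω => rootSum (f ω) G) P ∧
      ‖(∫ ω, rootSum (f ω) G ∂P) - ∫ ω, clipSum M (f ω) G ∂P‖ ≤
        L * (2 * (k * (B ^ k * (Q ^ (k + m) / M ^ m)))) +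
          (2 * (k * (T ^ k * p₀ + (T ^ 2)⁻¹ * C)) + L * M ^ k * p₀) := by
  have hL : 0 ≤ L := (norm_nonneg _).trans (hGL 0)
  have hN := fun j => exists_measurable_count hf (z := z j) fun ω => hfan ω j
  choose N hNm hN0 hNZ hNs using hN
  have hgi := fun j => integrable_truncated_pow (P := P) (hNm j) (hN0 j) (hNZ j) hC (hroot j)
  set g : Fin k → Ω → ℝ := fun j ω => if T ≤ N j ω then N j ω ^ (k + 2) else 0 with hg
  have hYm : Measurable fun ω => rootSum (f ω) G :=
    measurable_rootSum hf hfan (ρ := 1 / 100) (by norm_num) hG hGS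
  set b : Ω → ℝ := fun ω => 2 * ∑ j, (T ^ k + (T ^ 2)⁻¹ * g j ω) with hb
  have hYb : ∀ ω, ‖rootSum (f ω) G‖ ≤ b ω := fun ω => by
    refine (norm_rootSum_le (N := fun j => N j ω) (hfan ω) (fun j Z hZ => hNs j ω Z hZ) hG2
      hGS).trans ?_
    exact mul_le_mul_of_nonneg_left (prod_le_sum_truncated hk (fun j => hN0 j ω) hT) zero_le_two
  have hbj : ∀ j, Integrable (fun ω => T ^ k + (T ^ 2)⁻¹ * g j ω) P := fun j =>
    (integrable_const _).add ((hgi j).1.const_mul _)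
  have hbi : Integrable b P := (integrable_finsetSum _ fun j _ => hbj j).const_mul 2
  have hYi : Integrable (fun ω => rootSum (f ω) G) P :=
    hbi.mono' hYm.aestronglyMeasurable (Eventually.of_forall hYb)
  have hXm : Measurable fun ω => clipSum M (f ω) G := measurable_clipSum hf M hG
  have hXb : ∀ ω, ‖clipSum M (f ω) G‖ ≤ L * M ^ k := fun ω => norm_clipSum_le hM.le _ hGS hGL
  have hXi : Integrable (fun ω => clipSum M (f ω) G) P :=
    Integrable.of_bound hXm.aestronglyMeasurable _ (Eventually.of_forall hXb)
  refine ⟨hYi, ?_⟩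
  rw [← integral_sub hYi hXi]
  set D := L * (2 * (k * (B ^ k * (Q ^ (k + m) / M ^ m)))) with hD
  have hD0 : 0 ≤ D := by positivity
  have hdi : Integrable (fun ω => ‖rootSum (f ω) G - clipSum M (f ω) G‖) P := (hYi.sub hXi).norm
  have hin : ∀ ω ∈ E, ‖rootSum (f ω) G - clipSum M (f ω) G‖ ≤ D := fun ω hω => by
    have hrep := rootSum_eq_integral (ρ := 1 / 100) (by norm_num) (hfan ω) (hne ω hω) hG hGS
    have h2 : rootSum (f ω) G = ((2 * Real.pi) ^ k)⁻¹ •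
        ∫ w, (∏ j, Real.log ‖f ω (w j)‖) • lapAll G w := by
      rw [← hrep, smul_smul, inv_mul_cancel₀ (by positivity), one_smul]
    rw [h2, clipSum, ← smul_sub, norm_smul]
    refine (mul_le_of_le_one_left (norm_nonneg _) (norm_inv_two_pi_pow_le_one k)).trans ?_
    exact norm_integral_prod_log_sub_prod_clipLog_le
      (hf.comp (measurable_const.prodMk measurable_id)) (fun j => isCompact_closedBall _ _) hM
      (fun j => (h1 ω hω j).1) (fun j => (h1 ω hω j).2) (fun j => (hm ω hω j).1)
      (fun j => (hm ω hω j).2) (continuous_lapAll hG) hGL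
      (lapAll_eq_zero (isCompact_pi_closedBall z (1 / 100)).isClosed hGS)
  -- Only the constant part `T ^ k` of the bound profits from the smallness of `Eᶜ`; the other part
  -- carries the factor `T⁻²`.
  have hbint : ∫ ω in Eᶜ, b ω ∂P ≤ 2 * (k * (T ^ k * p₀ + (T ^ 2)⁻¹ * C)) := by
    simp only [hb]
    rw [integral_const_mul, integral_finsetSum _ fun j _ => (hbj j).integrableOn]
    have : ∀ j, ∫ ω in Eᶜ, (T ^ k + (T ^ 2)⁻¹ * g j ω) ∂P ≤ T ^ k * p₀ + (T ^ 2)⁻¹ * C := by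
      intro j
      rw [integral_add (integrable_const _) ((hgi j).1.integrableOn.const_mul _),
        integral_const_mul, setIntegral_const, smul_eq_mul, mul_comm (P.real Eᶜ)]
      have h3 : ∫ ω in Eᶜ, g j ω ∂P ≤ C := by
        refine (setIntegral_le_integral (hgi j).1 (Eventually.of_forall fun ω => ?_)).trans
          (hgi j).2
        have := hN0 j ω
        simp only [Pi.zero_apply]
        positivity
      gcongr
    calc _ ≤ 2 * ∑ _j : Fin k, (T ^ k * p₀ + (T ^ 2)⁻¹ * C) := by
          gcongr with j
          exact this j
      _ = _ := by simp only [Finset.sum_const, Finset.card_univ, Fintype.card_fin, nsmul_eq_mul]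
  calc ‖∫ ω, (rootSum (f ω) G - clipSum M (f ω) G) ∂P‖
      ≤ ∫ ω, ‖rootSum (f ω) G - clipSum M (f ω) G‖ ∂P := norm_integral_le_integral_norm _
    _ = (∫ ω in E, ‖rootSum (f ω) G - clipSum M (f ω) G‖ ∂P) +
        ∫ ω in Eᶜ, ‖rootSum (f ω) G - clipSum M (f ω) G‖ ∂P := (integral_add_compl hE hdi).symm
    _ ≤ D + (2 * (k * (T ^ k * p₀ + (T ^ 2)⁻¹ * C)) + L * M ^ k * p₀) := by
        refine add_le_add ?_ ?_
        · calc _ ≤ ∫ ω in E, D ∂P :=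
                setIntegral_mono_on hdi.integrableOn (integrable_const _) hE hin
            _ = P.real E * D := by rw [setIntegral_const, smul_eq_mul]
            _ ≤ D := mul_le_of_le_one_left hD0 measureReal_le_one
        · calc _ ≤ ∫ ω in Eᶜ, (b ω + L * M ^ k) ∂P := by
                refine setIntegral_mono hdi.integrableOn
                  (hbi.integrableOn.add (integrable_const _)) fun ω => ?_
                exact (norm_sub_le _ _).trans (add_le_add (hYb ω) (hXb ω))
            _ = (∫ ω in Eᶜ, b ω ∂P) + P.real Eᶜ * (L * M ^ k) := by
                rw [integral_add hbi.integrableOn (integrable_const _), setIntegral_const,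
                  smul_eq_mul]
            _ ≤ _ := by
                rw [mul_comm (P.real Eᶜ)]
                gcongr

/-- The probability of a large logarithm, averaged over a disk. -/
lemma integral_measureReal_log_gt_le (hf : Measurable (Function.uncurry f)) {z : ℂ} {M B Q : ℝ}
    {m : ℕ} (hM : 0 < M) {E : Set Ω} (hE : MeasurableSet E) (hBQ : 0 ≤ B * Q ^ (m + 1))
    (hm : ∀ ω ∈ E,
      IntegrableOn (fun w => |Real.log ‖f ω w‖| ^ (m + 1)) (Metric.closedBall z (1 / 100)) ∧
      ∫ w in Metric.closedBall z (1 / 100), |Real.log ‖f ω w‖| ^ (m + 1) ≤ B * Q ^ (m + 1))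
    {p₀ : ℝ} (hp₀ : P.real Eᶜ ≤ p₀) :
    Measurable (fun w => P.real {ω | M < |Real.log ‖f ω w‖|}) ∧
    ∫ w in Metric.closedBall z (1 / 100), P.real {ω | M < |Real.log ‖f ω w‖|} ≤
      p₀ + B * Q ^ (m + 1) / M ^ (m + 1) := by
  classical
  set A : Set (Ω × ℂ) := {q | M < |Real.log ‖f q.1 q.2‖|} with hA
  have hlm : Measurable fun q : Ω × ℂ => |Real.log ‖f q.1 q.2‖| :=
    (Real.measurable_log.comp hf.norm).norm
  have hAm : MeasurableSet A := measurableSet_lt measurable_const hlm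
  set χ : Ω → ℂ → ℝ := fun ω w => A.indicator (fun _ => 1) (ω, w) with hχ
  have hχm : Measurable (Function.uncurry χ) := measurable_const.indicator hAm
  have hχ0 : ∀ ω w, 0 ≤ χ ω w := fun ω w => Set.indicator_nonneg (fun _ _ => zero_le_one) _
  have hχ1 : ∀ ω w, χ ω w ≤ 1 := fun ω w => Set.indicator_le_self' (fun _ _ => zero_le_one) _
  have hPχ : ∀ w, P.real {ω | M < |Real.log ‖f ω w‖|} = ∫ ω, χ ω w ∂P := fun w => by
    have hs : MeasurableSet {ω | M < |Real.log ‖f ω w‖|} :=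
      hAm.preimage (measurable_id.prodMk measurable_const)
    rw [← integral_indicator_one hs]
    rfl
  simp_rw [hPχ]
  refine ⟨(StronglyMeasurable.integral_prod_left hχm.stronglyMeasurable).measurable, ?_⟩
  set S := Metric.closedBall z (1 / 100) with hS
  have hSfin : IsFiniteMeasure (volume.restrict S) :=
    ⟨by rw [Measure.restrict_apply_univ]; exact (isCompact_closedBall z _).measure_lt_top⟩
  have hint : Integrable (Function.uncurry χ) (P.prod (volume.restrict S)) := by
    refine Integrable.of_bound hχm.aestronglyMeasurable 1 (Eventually.of_forall fun q => ?_)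
    change ‖χ q.1 q.2‖ ≤ 1
    rw [Real.norm_of_nonneg (hχ0 _ _)]
    exact hχ1 _ _
  rw [← integral_integral_swap hint]
  have hgi : Integrable (fun ω => ∫ w in S, χ ω w) P := hint.integral_prod_left
  have hle1 : ∀ ω, ∫ w in S, χ ω w ≤ 1 := fun ω => by
    have := norm_setIntegral_le_of_norm_le_const (μ := volume) (s := S) (f := χ ω) (C := 1)
      (isCompact_closedBall z (1 / 100)).measure_lt_top
      (fun w _ => by rw [Real.norm_of_nonneg (hχ0 _ _)]; exact hχ1 _ _)
    have h2 := volume_real_closedBall_le_one z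
    rw [one_mul] at this
    exact (le_abs_self _).trans (this.trans h2)
  have hleE : ∀ ω ∈ E, ∫ w in S, χ ω w ≤ B * Q ^ (m + 1) / M ^ (m + 1) := fun ω hω => by
    rw [le_div_iff₀ (by positivity), mul_comm, ← integral_const_mul]
    refine le_trans (integral_mono_of_nonneg (Eventually.of_forall fun w => ?_) (hm ω hω).1
      (Eventually.of_forall fun w => ?_)) (hm ω hω).2
    · exact mul_nonneg (by positivity) (hχ0 ω w)
    · simp only [hχ]
      by_cases hw : (ω, w) ∈ A
      · rw [Set.indicator_of_mem hw, mul_one]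
        exact pow_le_pow_left₀ hM.le (le_of_lt hw) _
      · rw [Set.indicator_of_notMem hw, mul_zero]
        positivity
  rw [← integral_add_compl hE hgi, add_comm p₀]
  refine add_le_add ?_ ?_
  · calc _ ≤ ∫ ω in E, B * Q ^ (m + 1) / M ^ (m + 1) ∂P :=
          setIntegral_mono_on hgi.integrableOn (integrable_const _) hE hleE
      _ = P.real E * (B * Q ^ (m + 1) / M ^ (m + 1)) := by rw [setIntegral_const, smul_eq_mul]
      _ ≤ _ := mul_le_of_le_one_left (by positivity) measureReal_le_one
  · calc _ ≤ ∫ ω in Eᶜ, (1 : ℝ) ∂P :=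
          setIntegral_mono hgi.integrableOn (integrable_const _) hle1
      _ = P.real Eᶜ := by rw [setIntegral_const, smul_eq_mul, mul_one]
      _ ≤ p₀ := hp₀

end ClipSum

/-! ### Comparison of the two random functions -/

section Compare

variable {Ω Ω' : Type*} [MeasurableSpace Ω] [MeasurableSpace Ω'] {P : Measure Ω} {P' : Measure Ω'}
  {k : ℕ}

lemma randomFun_eq_zero {Ω : Type*} {n : ℕ∞} {φ : ℕ → ℂ → ℂ} {w : ℂ} (h : ∀ i ∈ idx n, φ i w = 0)
    (ξ : ℕ → Ω → ℂ) (ω : Ω) : randomFun n ξ φ ω w = 0 := by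
  have h1 : partialSum n ξ φ ω w = fun _ => 0 := funext fun N =>
    Finset.sum_eq_zero fun i hi => by
      classical
      rw [h i (by simpa using (Finset.mem_filter.1 hi).2), mul_zero]
  rw [randomFun, h1]
  exact tendsto_const_nhds.limUnder_eq

lemma abs_integral_prod_clipLog_sub_prod_truncLog_le [IsProbabilityMeasure P] {M : ℝ} (hM : 0 < M)
    {s : Fin k → ℝ} (hs : ∀ j, 0 ≤ s j) {X : Fin k → Ω → ℂ} (hX : ∀ j, Measurable (X j))
    (h0 : ∀ᵐ ω ∂P, ∀ j, s j = 0 → X j ω = 0) :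
    |(∫ ω, ∏ j, clipLog M (X j ω) ∂P) - ∫ ω, ∏ j, truncLog M (s j) (X j ω) ∂P| ≤
      2 * (2 * M) ^ k * ∑ j, (P.real {ω | ‖X j ω‖ < s j} +
        P.real {ω | M < |Real.log ‖X j ω‖|}) := by
  classical
  have hi1 : Integrable (fun ω => ∏ j, clipLog M (X j ω)) P := by
    refine Integrable.of_bound (C := M ^ k) ?_ (Eventually.of_forall fun ω => abs_prod_clipLog_le hM.le _)
    exact (Finset.measurable_prod _ fun j _ =>
      (measurable_clipLog M).comp (hX j)).aestronglyMeasurable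
  have hi2 : Integrable (fun ω => ∏ j, truncLog M (s j) (X j ω)) P := by
    refine Integrable.of_bound (C := (2 * M) ^ k) ?_ (Eventually.of_forall fun ω => ?_)
    · exact (Finset.measurable_prod _ fun j _ => (measurable_truncLog M).comp
        (measurable_const.prodMk (hX j))).aestronglyMeasurable
    · rw [Real.norm_eq_abs, Finset.abs_prod]
      calc _ ≤ ∏ _j : Fin k, (2 * M) :=
            Finset.prod_le_prod (fun _ _ => abs_nonneg _) fun j _ => abs_truncLog_le hM.le _ _
        _ = _ := by simp
  have hS1 : ∀ j, MeasurableSet {ω | ‖X j ω‖ < s j} := fun j =>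
    measurableSet_lt (hX j).norm measurable_const
  have hS2 : ∀ j, MeasurableSet {ω | M < |Real.log ‖X j ω‖|} := fun j =>
    measurableSet_lt measurable_const (Real.measurable_log.comp (hX j).norm).norm
  have hj1 : ∀ j, Integrable ({ω | ‖X j ω‖ < s j}.indicator (1 : Ω → ℝ)) P := fun j =>
    (integrable_const (1 : ℝ)).indicator (hS1 j)
  have hj2 : ∀ j, Integrable ({ω | M < |Real.log ‖X j ω‖|}.indicator (1 : Ω → ℝ)) P := fun j =>
    (integrable_const (1 : ℝ)).indicator (hS2 j)
  have hj : ∀ j, Integrable (fun ω => {ω | ‖X j ω‖ < s j}.indicator (1 : Ω → ℝ) ω +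
      {ω | M < |Real.log ‖X j ω‖|}.indicator (1 : Ω → ℝ) ω) P := fun j => (hj1 j).add (hj2 j)
  rw [← integral_sub hi1 hi2, ← Real.norm_eq_abs]
  calc _ ≤ ∫ ω, 2 * (2 * M) ^ k * ∑ j, ({ω | ‖X j ω‖ < s j}.indicator (1 : Ω → ℝ) ω +
        {ω | M < |Real.log ‖X j ω‖|}.indicator (1 : Ω → ℝ) ω) ∂P := by
        refine norm_integral_le_of_norm_le ((integrable_finsetSum _ fun j _ => hj j).const_mul _) ?_
        filter_upwards [h0] with ω hω
        refine (abs_prod_clipLog_sub_prod_truncLog_le hM hs hω).trans (le_of_eq ?_)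
        simp only [Set.indicator_apply, Set.mem_ofPred_eq, Pi.one_apply]
    _ = _ := by
        rw [integral_const_mul, integral_finsetSum _ fun j _ => hj j]
        congr 2 with j
        rw [integral_add (hj1 j) (hj2 j), integral_indicator_one (hS1 j),
          integral_indicator_one (hS2 j)]

/-- Bound for the small ball probability of a value of the random series at relative scale `r`, when
each term carries at most a fraction `η` of the standard deviation. -/
noncomputable def smallBallBound (τ ε η r : ℝ) : ℝ :=
  2 * (8 * r + (η / (r * min 1 ((1 / (64 * τ)) ^ (1 / ε)))) ^ 2)

/-- The bound of `ConditionC1.abs_integral_truncLog_sub_le` for the exchange of coefficients. -/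
noncomputable def exchangeBound (N₀ : ℕ) (τ ε : ℝ) (k : ℕ) (η r M : ℝ) : ℝ :=
  exchangeConst N₀ τ k * (M ^ k * (r⁻¹ ^ 3 * η ^ ε + r⁻¹ * η))

variable [IsProbabilityMeasure P] [IsProbabilityMeasure P']

/-- Passage from the clipped to the smoothed logarithm for values of the random series. The small
ball estimate bounds the probability that the smoothing scale matters. -/
lemma BoundedCentralMoments.abs_integral_clipLog_sub_truncLog_le {n : ℕ∞} {φ : ℕ → ℂ → ℂ}
    {ξ : ℕ → Ω → ℂ} {τ ε : ℝ} (h : BoundedCentralMoments P n ξ τ ε) (hτ : 0 < τ) (hε0 : 0 < ε)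
    (hε1 : ε ≤ 1) {w : Fin k → ℂ} (hconv : ∀ j, ∀ᵐ ω ∂P, SeriesConverges n ξ φ ω (w j))
    (hsum : ∀ j, Summable fun i : idx n => ‖φ i (w j)‖ ^ 2) {η : ℝ} (hη : 0 < η)
    (hdel : ∀ j, ∀ i : idx n, ‖φ i (w j)‖ ≤ η * √(∑' i : idx n, ‖φ i (w j)‖ ^ 2))
    {r M : ℝ} (hr : 0 < r) (hM : 0 < M) {X : Fin k → Ω → ℂ} (hX : ∀ j, Measurable (X j))
    (hXF : ∀ j, ∀ᵐ ω ∂P, X j ω = randomFun n ξ φ ω (w j)) :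
    |(∫ ω, ∏ j, clipLog M (X j ω) ∂P) - ∫ ω, ∏ j,
        truncLog M (r * √(∑' i : idx n, ‖φ i (w j)‖ ^ 2)) (randomFun n ξ φ ω (w j)) ∂P| ≤
      2 * (2 * M) ^ k * ∑ j, (smallBallBound τ ε η r + P.real {ω | M < |Real.log ‖X j ω‖|}) := by
  have hXF' := ae_all_iff.2 hXF
  have hcongr : ∫ ω, ∏ j, truncLog M (r * √(∑' i : idx n, ‖φ i (w j)‖ ^ 2))
        (randomFun n ξ φ ω (w j)) ∂P =
      ∫ ω, ∏ j, truncLog M (r * √(∑' i : idx n, ‖φ i (w j)‖ ^ 2)) (X j ω) ∂P := by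
    refine integral_congr_ae (hXF'.mono fun ω hω => ?_)
    exact Finset.prod_congr rfl fun j _ => by rw [hω j]
  rw [hcongr]
  refine (abs_integral_prod_clipLog_sub_prod_truncLog_le hM (fun j => by positivity) hX
    (hXF'.mono fun ω hω j hj => ?_)).trans ?_
  -- With zero variance all terms vanish at the point, and so does the series.
  · rw [hω j]
    have hV : √(∑' i : idx n, ‖φ i (w j)‖ ^ 2) = 0 := (mul_eq_zero.1 hj).resolve_left hr.ne'
    refine randomFun_eq_zero (fun i hi => ?_) _ _
    have := hdel j ⟨i, hi⟩
    rw [hV, mul_zero] at this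
    exact norm_le_zero_iff.1 this
  · gcongr with j
    rcases (Real.sqrt_nonneg (∑' i : idx n, ‖φ i (w j)‖ ^ 2)).eq_or_lt with hV | hV
    · rw [← hV, mul_zero]
      have : {ω | ‖X j ω‖ < 0} = ∅ := Set.eq_empty_of_forall_notMem fun ω hω =>
        absurd hω (not_lt.2 (norm_nonneg _))
      rw [this, measureReal_empty, smallBallBound]
      positivity
    · refine le_trans (le_of_eq (measureReal_congr ?_))
        (h.measureReal_norm_randomFun_lt_le hτ hε0 hε1 (hconv j) (hsum j) hη (hdel j) hV hr)
      filter_upwards [hXF j] with ω hω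
      change (‖X j ω‖ < _) = (‖randomFun n ξ φ ω (w j)‖ < _)
      rw [hω]

/-- Universality of the clipped logarithms at fixed points. -/
lemma ConditionC1.abs_integral_clipLog_sub_le {n : ℕ∞} {φ : ℕ → ℂ → ℂ}
    {ξ : ℕ → Ω → ℂ} {ξ' : ℕ → Ω' → ℂ} {N₀ : ℕ} {τ ε : ℝ} (h : ConditionC1 P P' n ξ ξ' N₀ τ ε)
    (hτ : 0 < τ) (hε0 : 0 < ε) (hε1 : ε ≤ 1) {w : Fin k → ℂ}
    (hconv : ∀ j, ∀ᵐ ω ∂P, SeriesConverges n ξ φ ω (w j))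
    (hconv' : ∀ j, ∀ᵐ ω ∂P', SeriesConverges n ξ' φ ω (w j))
    (hsum : ∀ j, Summable fun i : idx n => ‖φ i (w j)‖ ^ 2) {η : ℝ} (hη : 0 < η)
    (hdel : ∀ j, ∀ i : idx n, ‖φ i (w j)‖ ≤ η * √(∑' i : idx n, ‖φ i (w j)‖ ^ 2))
    {r M : ℝ} (hr : 0 < r) (hr1 : r ≤ 1) (hM : 1 ≤ M) {X : Fin k → Ω → ℂ}
    (hX : ∀ j, Measurable (X j)) (hXF : ∀ j, ∀ᵐ ω ∂P, X j ω = randomFun n ξ φ ω (w j))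
    {X' : Fin k → Ω' → ℂ} (hX' : ∀ j, Measurable (X' j))
    (hXF' : ∀ j, ∀ᵐ ω ∂P', X' j ω = randomFun n ξ' φ ω (w j)) :
    |(∫ ω, ∏ j, clipLog M (X j ω) ∂P) - ∫ ω, ∏ j, clipLog M (X' j ω) ∂P'| ≤
      exchangeBound N₀ τ ε k η r M + 2 * (2 * M) ^ k * ∑ j, (2 * smallBallBound τ ε η r +
        (P.real {ω | M < |Real.log ‖X j ω‖|} + P'.real {ω | M < |Real.log ‖X' j ω‖|})) := by
  have e1 := h.left.abs_integral_clipLog_sub_truncLog_le hτ hε0 hε1 hconv hsum hη hdel hr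
    (zero_lt_one.trans_le hM) hX hXF
  have e2 := h.right.abs_integral_clipLog_sub_truncLog_le hτ hε0 hε1 hconv' hsum hη hdel hr
    (zero_lt_one.trans_le hM) hX' hXF'
  have e3 := h.abs_integral_truncLog_sub_le hτ hε0 hε1 hconv hconv' hsum hη.le hdel hM hr hr1
  rw [← exchangeBound] at e3
  have e4 : ∑ j, (2 * smallBallBound τ ε η r +
        (P.real {ω | M < |Real.log ‖X j ω‖|} + P'.real {ω | M < |Real.log ‖X' j ω‖|})) =
      ∑ j, (smallBallBound τ ε η r + P.real {ω | M < |Real.log ‖X j ω‖|}) +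
      ∑ j, (smallBallBound τ ε η r + P'.real {ω | M < |Real.log ‖X' j ω‖|}) := by
    rw [← Finset.sum_add_distrib]
    exact Finset.sum_congr rfl fun j _ => by ring
  rw [e4, mul_add]
  rw [abs_le] at e1 e2 e3 ⊢
  constructor <;> linarith [e1.1, e1.2, e2.1, e2.2, e3.1, e3.2]

/-- A function of one coordinate, integrated over a product of sets of volume at most one. -/
lemma integrableOn_pi_coord_and_le {z : Fin k → ℂ} {q : ℂ → ℝ} (hq : Measurable q)
    (hq0 : ∀ w, 0 ≤ q w) {b : ℝ} (hqb : ∀ w, q w ≤ b) (j : Fin k) :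
    IntegrableOn (fun w : Fin k → ℂ => q (w j))
        (Set.univ.pi fun j => Metric.closedBall (z j) (1 / 100)) ∧
      ∫ w in Set.univ.pi fun j => Metric.closedBall (z j) (1 / 100), q (w j) ≤
        ∫ w in Metric.closedBall (z j) (1 / 100), q w := by
  classical
  refine ⟨Measure.integrableOn_of_bounded (M := b)
    (isCompact_pi_closedBall z _).measure_lt_top.ne
    (hq.comp (measurable_pi_apply j)).aestronglyMeasurable (Eventually.of_forall fun w => ?_), ?_⟩
  · rw [Real.norm_of_nonneg (hq0 _)]
    exact hqb _
  · have hm : ∀ i, MeasurableSet (Metric.closedBall (z i) (1 / 100)) := fun i =>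
      Metric.isClosed_closedBall.measurableSet
    rw [← integral_indicator (MeasurableSet.univ_pi hm)]
    set g : Fin k → ℂ → ℝ := fun i => (Metric.closedBall (z i) (1 / 100)).indicator
      fun w => if i = j then q w else 1 with hg
    have hfun : ((Set.univ.pi fun j => Metric.closedBall (z j) (1 / 100)).indicator
        fun w : Fin k → ℂ => q (w j)) = fun w => ∏ i, g i (w i) := by
      funext w
      by_cases hw : w ∈ Set.univ.pi fun j => Metric.closedBall (z j) (1 / 100)
      · rw [Set.indicator_of_mem hw]
        have : ∀ i, g i (w i) = if i = j then q (w i) else 1 := fun i =>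
          Set.indicator_of_mem (hw i trivial) _
        simp [this]
      · rw [Set.indicator_of_notMem hw]
        obtain ⟨i, hi⟩ : ∃ i, w i ∉ Metric.closedBall (z i) (1 / 100) := by
          by_contra hc
          push Not at hc
          exact hw fun i _ => hc i
        exact (Finset.prod_eq_zero (Finset.mem_univ i) (Set.indicator_of_notMem hi _)).symm
    rw [hfun, integral_fintype_prod_volume_eq_prod, ← Finset.mul_prod_erase _ _ (Finset.mem_univ j)]
    have h1 : ∫ w, g j w = ∫ w in Metric.closedBall (z j) (1 / 100), q w := by
      rw [← integral_indicator (hm j)]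
      simp [hg]
    have h2 : ∏ i ∈ Finset.univ.erase j, ∫ w, g i w ≤ 1 := by
      refine Finset.prod_le_one (fun i _ => integral_nonneg fun w => ?_) fun i hi => ?_
      · refine Set.indicator_nonneg (fun w _ => ?_) w
        split_ifs
        exacts [hq0 w, zero_le_one]
      · have : g i = (Metric.closedBall (z i) (1 / 100)).indicator 1 := by
          simp only [hg, if_neg (Finset.ne_of_mem_erase hi)]
          rfl
        rw [this, integral_indicator_one (hm i)]
        exact volume_real_closedBall_le_one _
    rw [h1]
    exact mul_le_of_le_one_right (integral_nonneg fun w => hq0 w) h2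

lemma integrable_integral_clipLog_smul_lapAll {f : Ω → ℂ → ℂ} (hf : Measurable (Function.uncurry f))
    {M : ℝ} (hM : 0 ≤ M) {G : (Fin k → ℂ) → ℂ} {z : Fin k → ℂ} (hG : ContDiff ℝ (2 * k : ℕ) G)
    (hGS : ∀ w ∉ Set.univ.pi fun j => Metric.closedBall (z j) (1 / 100), G w = 0) :
    Integrable fun w => (∫ ω, ∏ j, clipLog M (f ω (w j)) ∂P) • lapAll G w := by
  have hLS := lapAll_eq_zero (isCompact_pi_closedBall z (1 / 100)).isClosed hGS
  have hLi : Integrable (lapAll G) := (continuous_lapAll hG).integrable_of_hasCompactSupport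
    (HasCompactSupport.of_support_subset_isCompact (isCompact_pi_closedBall z (1 / 100))
      fun w hw => by by_contra h; exact hw (hLS w h))
  refine Integrable.bdd_smul (φ := fun w : Fin k → ℂ => ∫ ω, ∏ j, clipLog M (f ω (w j)) ∂P) hLi
    (M ^ k) ?_ (Eventually.of_forall fun w => ?_)
  · have h1 : Measurable fun q : Ω × (Fin k → ℂ) => ∏ j, clipLog M (f q.1 (q.2 j)) :=
      Finset.measurable_prod _ fun j _ =>
        measurable_uncurry_apply_coord hf (measurable_clipLog M) j
    exact (StronglyMeasurable.integral_prod_left' h1.stronglyMeasurable).aestronglyMeasurable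
  · have := norm_integral_le_of_norm_le_const (μ := P) (C := M ^ k)
      (f := fun ω => ∏ j, clipLog M (f ω (w j)))
      (Eventually.of_forall fun ω => abs_prod_clipLog_le hM _)
    simpa using this

/-- A comparison of the clipped logarithms at each tuple of points carries over to the
linear statistics. -/
lemma norm_integral_clipSum_sub_le {f : Ω → ℂ → ℂ} {f' : Ω' → ℂ → ℂ}
    (hf : Measurable (Function.uncurry f)) (hf' : Measurable (Function.uncurry f')) {M L q₀ t : ℝ}
    (hM : 0 ≤ M) (hq₀ : 0 ≤ q₀) {K : ℝ} (hK : 0 ≤ K)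
    {G : (Fin k → ℂ) → ℂ} {z : Fin k → ℂ} (hG : ContDiff ℝ (2 * k : ℕ) G)
    (hGS : ∀ w ∉ Set.univ.pi fun j => Metric.closedBall (z j) (1 / 100), G w = 0)
    (hGL : ∀ w, ‖lapAll G w‖ ≤ L) {q : ℂ → ℝ} (hq : Measurable q)
    (hq0 : ∀ w, 0 ≤ q w) {b : ℝ} (hqb : ∀ w, q w ≤ b)
    (hqt : ∀ j, ∫ w in Metric.closedBall (z j) (1 / 100), q w ≤ t)
    (hcmp : ∀ w ∈ Set.univ.pi fun j => Metric.closedBall (z j) (1 / 100),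
      |(∫ ω, ∏ j, clipLog M (f ω (w j)) ∂P) - ∫ ω, ∏ j, clipLog M (f' ω (w j)) ∂P'| ≤
        q₀ + K * ∑ j, q (w j)) :
    ‖(∫ ω, clipSum M (f ω) G ∂P) - ∫ ω, clipSum M (f' ω) G ∂P'‖ ≤ L * (q₀ + K * (k * t)) := by
  have hL : 0 ≤ L := (norm_nonneg _).trans (hGL 0)
  set S := Set.univ.pi fun j => Metric.closedBall (z j) (1 / 100) with hS
  have hSm : MeasurableSet S := (isCompact_pi_closedBall z _).isClosed.measurableSet
  have hLS := lapAll_eq_zero (isCompact_pi_closedBall z (1 / 100)).isClosed hGS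
  have hint := integrable_integral_clipLog_smul_lapAll (P := P) hf hM hG hGS
  have hint' := integrable_integral_clipLog_smul_lapAll (P := P') hf' hM hG hGS
  rw [integral_clipSum hf hM hG hGS, integral_clipSum hf' hM hG hGS, ← smul_sub,
    ← integral_sub hint hint', norm_smul]
  refine (mul_le_of_le_one_left (norm_nonneg _) (norm_inv_two_pi_pow_le_one k)).trans ?_
  rw [← setIntegral_eq_integral_of_forall_compl_eq_zero (s := S) fun w hw => by
    rw [hLS w hw, smul_zero, smul_zero, sub_zero]]
  have hfin : volume S < ⊤ := (isCompact_pi_closedBall z _).measure_lt_top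
  have : IsFiniteMeasure (volume.restrict S) := ⟨by rwa [Measure.restrict_apply_univ]⟩
  have hqi := fun j => integrableOn_pi_coord_and_le (z := z) hq hq0 hqb j
  have hsi : Integrable (fun w : Fin k → ℂ => ∑ j, q (w j)) (volume.restrict S) :=
    integrable_finsetSum _ fun j _ => (hqi j).1
  have hri : Integrable (fun w : Fin k → ℂ => q₀ + K * ∑ j, q (w j)) (volume.restrict S) :=
    (integrable_const _).add (hsi.const_mul _)
  calc _ ≤ ∫ w in S, L * (q₀ + K * ∑ j, q (w j)) := by
        refine norm_integral_le_of_norm_le (hri.const_mul _) ?_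
        filter_upwards [ae_restrict_mem hSm] with w hw
        rw [← sub_smul, norm_smul, mul_comm]
        exact mul_le_mul (hGL w) (hcmp w hw) (norm_nonneg _) hL
    _ = L * (volume.real S * q₀ + K * ∑ j, ∫ w in S, q (w j)) := by
        rw [integral_const_mul, integral_add (integrable_const _) (hsi.const_mul _),
          setIntegral_const, smul_eq_mul, integral_const_mul,
          integral_finsetSum _ fun j _ => (hqi j).1]
    _ ≤ L * (q₀ + K * ∑ _j : Fin k, t) := by
        gcongr with j
        · exact mul_le_of_le_one_left hq₀ (volume_real_pi_closedBall_le_one z)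
        · exact (hqi j).2.trans (hqt j)
    _ = _ := by rw [Finset.sum_const, Finset.card_univ, Fintype.card_fin, nsmul_eq_mul]

end Compare

/-! ### The good event -/

section GoodEvent

/-- The constant `B` bounds the first moment and the moment of order `m + 1` of `log ‖f‖` on a disk,
for all analytic `f` that are not too large nor too small, at the scales `Q` and `Q ^ (m + 1)`. -/
def LogMomentBound (B : ℝ) (m : ℕ) : Prop :=
  ∀ (f : ℂ → ℂ) (z z' : ℂ) (Q : ℝ), 1 ≤ Q →
    AnalyticOnNhd ℂ f (Metric.ball z 2) → (∀ w ∈ Metric.ball z 2, ‖f w‖ ≤ Real.exp Q) →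
    z' ∈ Metric.ball z (1 / 100) → Real.exp (-Q) ≤ ‖f z'‖ →
    (IntegrableOn (fun w => |Real.log ‖f w‖|) (Metric.closedBall z (1 / 100)) ∧
      ∫ w in Metric.closedBall z (1 / 100), |Real.log ‖f w‖| ≤ B * Q) ∧
    IntegrableOn (fun w => |Real.log ‖f w‖| ^ (m + 1)) (Metric.closedBall z (1 / 100)) ∧
      ∫ w in Metric.closedBall z (1 / 100), |Real.log ‖f w‖| ^ (m + 1) ≤ B * Q ^ (m + 1)

lemma exists_logMomentBound (m : ℕ) : ∃ B : ℝ, 0 < B ∧ LogMomentBound B m := by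
  obtain ⟨B₁, hB₁, h₁⟩ := exists_integral_abs_log_pow_le 1 one_ne_zero
  obtain ⟨B₂, hB₂, h₂⟩ := exists_integral_abs_log_pow_le (m + 1) m.succ_ne_zero
  refine ⟨max B₁ B₂, lt_max_of_lt_left hB₁, fun f z z' Q hQ hf hb hz' hl => ?_⟩
  have e1 := h₁ f z z' Q hQ hf hb hz' hl
  have e2 := h₂ f z z' Q hQ hf hb hz' hl
  simp only [pow_one] at e1
  exact ⟨⟨e1.1, e1.2.trans (by gcongr; exact le_max_left _ _)⟩, e2.1,
    e2.2.trans (by gcongr; exact le_max_right _ _)⟩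

variable {Ω : Type*} [MeasurableSpace Ω] {P : Measure Ω} {k : ℕ}

/-- Outside an event of small probability, the random function is neither too large on the disks
nor too small near their centres. -/
lemma ConditionC2.exists_good_event {n : ℕ∞} {ξ : ℕ → Ω → ℂ} {φ : ℕ → ℂ → ℂ} {δ : ℝ} {D : Set ℂ}
    {k' : ℕ} {C₁ α₁ A c₁ C : ℝ} (h : ConditionC2 P n ξ φ δ D k' C₁ α₁ A c₁ C) (hδ : 0 < δ)
    (hC : 0 < C) {z : Fin k → ℂ} (hz : ∀ j, z j ∈ D) {f : Ω → ℂ → ℂ}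
    (hfF : ∀ᵐ ω ∂P, ∀ j, ∀ w ∈ Metric.ball (z j) 2, f ω w = randomFun n ξ φ ω w) :
    ∃ E : Set Ω, MeasurableSet E ∧ P.real Eᶜ ≤ 2 * k * C * δ ^ A ∧ ∀ ω ∈ E, ∀ j,
      (∀ w ∈ Metric.ball (z j) 2, ‖f ω w‖ ≤ Real.exp (δ ^ (-c₁))) ∧
      ∃ z' ∈ Metric.ball (z j) (1 / 100), Real.exp (-δ ^ (-c₁)) ≤ ‖f ω z'‖ := by
  set p : Set Ω := {ω | ¬ ∀ j, ∀ w ∈ Metric.ball (z j) 2, f ω w = randomFun n ξ φ ω w} with hp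
  set b₁ : Fin k → Set Ω := fun j => {ω | ¬ ∃ z' ∈ Metric.ball (z j) (1 / 100),
    Real.exp (-δ ^ (-c₁)) ≤ ‖randomFun n ξ φ ω z'‖} with hb₁
  set b₂ : Fin k → Set Ω := fun j => {ω | ¬ ∀ w ∈ Metric.ball (z j) 2,
    ‖randomFun n ξ φ ω w‖ ≤ Real.exp (δ ^ (-c₁))} with hb₂
  set bad : Set Ω := p ∪ ⋃ j, (b₁ j ∪ b₂ j) with hbad
  have hx : 0 ≤ C * δ ^ A := by positivity
  have hbadP : P bad ≤ ENNReal.ofReal (2 * k * C * δ ^ A) := by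
    have hp0 : P p = 0 := ae_iff.1 hfF
    have hj : ∀ j, P (b₁ j ∪ b₂ j) ≤ ENNReal.ofReal (2 * (C * δ ^ A)) := fun j => by
      rw [two_mul, ENNReal.ofReal_add hx hx]
      exact (measure_union_le _ _).trans
        (add_le_add (h.antiConcentration _ (hz j)) (h.bounded _ (hz j)))
    calc P bad ≤ P p + P (⋃ j, (b₁ j ∪ b₂ j)) := measure_union_le _ _
      _ ≤ 0 + ∑ j, P (b₁ j ∪ b₂ j) := add_le_add hp0.le (measure_iUnion_fintype_le _ _)
      _ ≤ 0 + ∑ _j : Fin k, ENNReal.ofReal (2 * (C * δ ^ A)) := by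
          gcongr with j
          exact hj j
      _ = _ := by
          rw [zero_add, Finset.sum_const, Finset.card_univ, Fintype.card_fin, nsmul_eq_mul,
            ← ENNReal.ofReal_natCast, ← ENNReal.ofReal_mul (Nat.cast_nonneg k)]
          congr 1
          ring
  refine ⟨(toMeasurable P bad)ᶜ, (measurableSet_toMeasurable _ _).compl, ?_, fun ω hω j => ?_⟩
  · rw [compl_compl, Measure.real, measure_toMeasurable]
    exact ENNReal.toReal_le_of_le_ofReal (by positivity) hbadP
  · have hω' : ω ∉ bad := fun hc => hω (subset_toMeasurable _ _ hc)
    have h0 : ∀ j, ∀ w ∈ Metric.ball (z j) 2, f ω w = randomFun n ξ φ ω w := by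
      by_contra hc
      exact hω' (Or.inl hc)
    have h1 : ∃ z' ∈ Metric.ball (z j) (1 / 100),
        Real.exp (-δ ^ (-c₁)) ≤ ‖randomFun n ξ φ ω z'‖ := by
      by_contra hc
      exact hω' (Or.inr (Set.mem_iUnion.2 ⟨j, Or.inl hc⟩))
    have h2 : ∀ w ∈ Metric.ball (z j) 2, ‖randomFun n ξ φ ω w‖ ≤ Real.exp (δ ^ (-c₁)) := by
      by_contra hc
      exact hω' (Or.inr (Set.mem_iUnion.2 ⟨j, Or.inr hc⟩))
    refine ⟨fun w hw => by rw [h0 j w hw]; exact h2 w hw, ?_⟩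
    obtain ⟨z', hz', hle⟩ := h1
    exact ⟨z', hz', by rwa [h0 j z' (Metric.ball_subset_ball (by norm_num) hz')]⟩

variable [IsProbabilityMeasure P]

/-- What the conditions on a single random function give: its zero statistic is integrable and is
close in mean to the truncated statistic of a jointly measurable version, whose logarithm is rarely
large. -/
lemma ConditionC2.exists_version_rootSum_sub_clipSum_le {n : ℕ∞} {ξ : ℕ → Ω → ℂ} {φ : ℕ → ℂ → ℂ}
    {δ : ℝ} {D : Set ℂ} {C₁ α₁ A c₁ C : ℝ} (h : ConditionC2 P n ξ φ δ D k C₁ α₁ A c₁ C)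
    (hξ : ∀ i ∈ idx n, Measurable (ξ i)) (hk : 0 < k) (hδ : 0 < δ) (hC : 0 < C) {z : Fin k → ℂ}
    (hz : ∀ j, z j ∈ D) {B Q M L : ℝ} {m : ℕ} (hQ : Q = δ ^ (-c₁)) (hQ1 : 1 ≤ Q) (hM : 0 < M)
    (hB : 0 < B) (hBlog : LogMomentBound B m)
    {G : (Fin k → ℂ) → ℂ} (hG : ContDiff ℝ (2 * k : ℕ) G)
    (hGS : ∀ w ∉ Set.univ.pi fun j => Metric.closedBall (z j) (1 / 100), G w = 0)
    (hG2 : ∀ w, ‖G w‖ ≤ 2) (hGL : ∀ w, ‖lapAll G w‖ ≤ L) {p₀ T : ℝ}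
    (hp₀ : p₀ = 2 * k * C * δ ^ A) (hT : T = δ ^ (-C₁)) :
    ∃ f : Ω → ℂ → ℂ, Measurable (Function.uncurry f) ∧
      (∀ j, ∀ w ∈ Metric.ball (z j) 2, ∀ᵐ ω ∂P,
        SeriesConverges n ξ φ ω w ∧ f ω w = randomFun n ξ φ ω w) ∧
      (Measurable fun w => P.real {ω | M < |Real.log ‖f ω w‖|}) ∧
      (∀ j, ∫ w in Metric.closedBall (z j) (1 / 100), P.real {ω | M < |Real.log ‖f ω w‖|} ≤
        p₀ + B * Q ^ (m + 1) / M ^ (m + 1)) ∧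
      Integrable (fun ω => rootSum (randomFun n ξ φ ω) G) P ∧
      ‖(∫ ω, rootSum (randomFun n ξ φ ω) G ∂P) - ∫ ω, clipSum M (f ω) G ∂P‖ ≤
        L * (2 * (k * (B ^ k * (Q ^ (k + m) / M ^ m)))) +
          (2 * (k * (T ^ k * p₀ + (T ^ 2)⁻¹ * C)) + L * M ^ k * p₀) := by
  obtain ⟨f, hf, hfan, hfF⟩ := exists_measurable_analytic_version hξ z fun j => h.analytic _ (hz j)
  obtain ⟨E, hE, hEp, hEg⟩ := h.exists_good_event hδ hC hz hfF
  rw [← hp₀] at hEp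
  rw [← hQ] at hEg
  have hlog := fun ω (hω : ω ∈ E) j =>
    (hEg ω hω j).2.elim fun z' hz' => hBlog (f ω) (z j) z' Q hQ1 (hfan ω j) (hEg ω hω j).1 hz'.1 hz'.2
  have hne : ∀ ω ∈ E, ∀ j, ∃ w ∈ Metric.ball (z j) 2, f ω w ≠ 0 := fun ω hω j => by
    obtain ⟨-, z', hz', hl⟩ := hEg ω hω j
    exact ⟨z', Metric.ball_subset_ball (by norm_num) hz',
      norm_pos_iff.1 ((Real.exp_pos _).trans_le hl)⟩
  have hroot : ∀ j, ∫⁻ ω, ({ω | ENNReal.ofReal T ≤ zeroCount (f ω) (z j) 1}.indicator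
      (fun ω => zeroCount (f ω) (z j) 1 ^ (k + 2)) ω) ∂P ≤ ENNReal.ofReal C := fun j => by
    refine le_trans (le_of_eq (lintegral_congr_ae (hfF.mono fun ω hω => ?_)))
      (h.rootCount _ (hz j))
    have e := zeroCount_congr_of_eqOn (z := z j) (r := 1) (R := 2) (by norm_num) (hω j)
    simp only [Set.indicator_apply, Set.mem_ofPred_eq, e, hT]
  have hae : (fun ω => rootSum (f ω) G) =ᵐ[P] fun ω => rootSum (randomFun n ξ φ ω) G :=
    hfF.mono fun ω hω => rootSum_congr_of_eqOn (ρ := 1 / 100) (R := 2) (by norm_num) hω hGS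
  obtain ⟨hi, hle⟩ := integrable_rootSum_and_norm_sub_le hk hf hfan hM hG hGS hG2 hGL hB.le
    (zero_le_one.trans hQ1) hE hne (fun ω hω j => (hlog ω hω j).1) (fun ω hω j => (hlog ω hω j).2) hEp
    (T := T) (by rw [hT]; positivity) hC.le hroot
  have hq := fun j => integral_measureReal_log_gt_le hf (z := z j) hM hE
    (B := B) (Q := Q) (m := m) (by positivity) (fun ω hω => (hlog ω hω j).2) hEp
  refine ⟨f, hf, fun j w hw => ?_, (hq ⟨0, hk⟩).1, fun j => (hq j).2, hi.congr hae, ?_⟩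
  · filter_upwards [hfF, h.analytic _ (hz j)] with ω h1 h2
    exact ⟨h2.1 w hw, h1 j w hw⟩
  · rwa [← integral_congr_ae hae]

end GoodEvent

/-! ### Choice of the parameters -/

section Parameters

lemma pow_div_pow_four_le_inv {Q : ℝ} (hQ : 1 ≤ Q) {a b : ℕ} (h : a + 1 ≤ 4 * b) :
    Q ^ a / (Q ^ 4) ^ b ≤ Q⁻¹ := by
  have h0 : 0 < Q := by linarith
  rw [div_le_iff₀ (by positivity), ← pow_mul, le_inv_mul_iff₀ h0, ← pow_succ']
  exact pow_le_pow_right₀ hQ h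

variable {δ d a : ℝ} {k : ℕ}

lemma rpow_neg_pow_four_pow (hδ : 0 < δ) (d : ℝ) (k : ℕ) :
    ((δ ^ (-d)) ^ 4) ^ k = δ ^ (-(4 * (d * k))) := by
  rw [← pow_mul, ← Real.rpow_mul_natCast hδ.le]
  congr 1
  push_cast
  ring

lemma smallBallBound_nonneg (τ ε η : ℝ) {r : ℝ} (hr : 0 ≤ r) : 0 ≤ smallBallBound τ ε η r := by
  rw [smallBallBound]
  positivity

lemma exchangeBound_nonneg (N₀ : ℕ) {τ : ℝ} (hτ : 0 < τ) (ε : ℝ) (k : ℕ) {η r M : ℝ} (hη : 0 ≤ η)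
    (hr : 0 ≤ r) (hM : 0 ≤ M) : 0 ≤ exchangeBound N₀ τ ε k η r M := by
  have := exchangeConst_nonneg N₀ hτ k
  rw [exchangeBound]
  positivity

/-- The small ball probability beats the size `M ^ k` of the product of clipped logarithms. -/
lemma pow_mul_smallBallBound_le (hδ : 0 < δ) (hδ1 : δ < 1) (hd0 : 0 < d) (hd : d ≤ a / 10 ^ 5)
    (hdk : d * k ≤ a / 10 ^ 5) {τ ε α₁ C : ℝ} (ha : a ≤ α₁) :
    ((δ ^ (-d)) ^ 4) ^ k * smallBallBound τ ε (C * δ ^ α₁) (δ ^ (a / 10)) ≤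
      2 * (8 + (C / min 1 ((1 / (64 * τ)) ^ (1 / ε))) ^ 2) * δ ^ d := by
  have h1 : δ ^ (-(4 * (d * k))) * δ ^ (a / 10) ≤ δ ^ d := by
    rw [← Real.rpow_add hδ]
    exact Real.rpow_le_rpow_of_exponent_ge hδ hδ1.le (by linarith)
  have h2 : δ ^ (-(4 * (d * k))) * (δ ^ α₁ / δ ^ (a / 10)) ^ 2 ≤ δ ^ d := by
    rw [← Real.rpow_sub hδ, ← Real.rpow_mul_natCast hδ.le, ← Real.rpow_add hδ]
    exact Real.rpow_le_rpow_of_exponent_ge hδ hδ1.le (by push_cast; linarith)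
  rw [rpow_neg_pow_four_pow hδ, smallBallBound]
  set μ := min 1 ((1 / (64 * τ)) ^ (1 / ε))
  calc _ = 2 * (8 * (δ ^ (-(4 * (d * k))) * δ ^ (a / 10)) +
        (C / μ) ^ 2 * (δ ^ (-(4 * (d * k))) * (δ ^ α₁ / δ ^ (a / 10)) ^ 2)) := by
        rw [mul_comm (δ ^ (a / 10)) μ, mul_div_mul_comm]
        ring
    _ ≤ 2 * (8 * δ ^ d + (C / μ) ^ 2 * δ ^ d) := by gcongr
    _ = _ := by ring

/-- The error of the exchange of coefficients is a positive power of `δ`. -/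
lemma exchangeBound_le (hδ : 0 < δ) (hδ1 : δ < 1) (hd0 : 0 < d) (hd : d ≤ a / 10 ^ 5)
    (hdk : d * k ≤ a / 10 ^ 5) {τ ε α₁ C : ℝ} (hτ : 0 < τ) (hC : 0 < C) (haε : a = α₁ * ε)
    (ha : a ≤ α₁) (N₀ : ℕ) :
    exchangeBound N₀ τ ε k (C * δ ^ α₁) (δ ^ (a / 10)) ((δ ^ (-d)) ^ 4) ≤
      exchangeConst N₀ τ k * (C ^ ε + C) * δ ^ d := by
  have h1 : δ ^ (-(4 * (d * k))) * ((δ ^ (a / 10))⁻¹ ^ 3 * (δ ^ α₁) ^ ε) ≤ δ ^ d := by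
    rw [← Real.rpow_neg hδ.le, ← Real.rpow_mul_natCast hδ.le, ← Real.rpow_mul hδ.le, ← haε,
      ← Real.rpow_add hδ, ← Real.rpow_add hδ]
    exact Real.rpow_le_rpow_of_exponent_ge hδ hδ1.le (by push_cast; linarith)
  have h2 : δ ^ (-(4 * (d * k))) * ((δ ^ (a / 10))⁻¹ * δ ^ α₁) ≤ δ ^ d := by
    rw [← Real.rpow_neg hδ.le, ← Real.rpow_add hδ, ← Real.rpow_add hδ]
    exact Real.rpow_le_rpow_of_exponent_ge hδ hδ1.le (by linarith)
  have h3 := exchangeConst_nonneg N₀ hτ k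
  rw [exchangeBound, rpow_neg_pow_four_pow hδ, Real.mul_rpow hC.le (by positivity)]
  calc _ = exchangeConst N₀ τ k *
        (C ^ ε * (δ ^ (-(4 * (d * k))) * ((δ ^ (a / 10))⁻¹ ^ 3 * (δ ^ α₁) ^ ε)) +
          C * (δ ^ (-(4 * (d * k))) * ((δ ^ (a / 10))⁻¹ * δ ^ α₁))) := by ring
    _ ≤ exchangeConst N₀ τ k * (C ^ ε * δ ^ d + C * δ ^ d) := by gcongr
    _ = _ := by ring

/-- The exceptional probability `δ ^ A` beats both `M ^ k` and the `k`-th power of the typical bound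
for the number of zeros. -/
lemma pow_mul_rpow_le (hδ : 0 < δ) (hδ1 : δ < 1) (hd0 : 0 < d) (hd : d ≤ a / 10 ^ 5)
    (hdk : d * k ≤ a / 10 ^ 5) {C₁ : ℝ} (hC₁ : 0 < C₁) :
    ((δ ^ (-d)) ^ 4) ^ k * δ ^ (2 * k * C₁ + a / 60) ≤ δ ^ d ∧
      (δ ^ (-C₁)) ^ k * δ ^ (2 * k * C₁ + a / 60) ≤ δ ^ d := by
  have hk : 0 ≤ k * C₁ := by positivity
  rw [rpow_neg_pow_four_pow hδ, ← Real.rpow_mul_natCast hδ.le, ← Real.rpow_add hδ,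
    ← Real.rpow_add hδ]
  exact ⟨Real.rpow_le_rpow_of_exponent_ge hδ hδ1.le (by linarith),
    Real.rpow_le_rpow_of_exponent_ge hδ hδ1.le (by linarith)⟩

end Parameters

end RandomRoots

theorem theorem2p3 (N₀ : ℕ) (τ ε α₁ C₁ C : ℝ) (k : ℕ)
    (hτ : 0 < τ) (hε0 : 0 < ε) (hε1 : ε < 1) (hα₁ : 0 < α₁) (hC₁ : 0 < C₁) (hC : 0 < C)
    (hk : 0 < k) :
    ∃ C' c : ℝ, 0 < C' ∧ 0 < c ∧
      ∀ (n : ℕ∞) (δ : ℝ) (D : Set ℂ) (φ : ℕ → ℂ → ℂ),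
      0 < δ → δ < 1 →
      ∀ (Ω : Type u) [MeasurableSpace Ω] (P : Measure Ω) [IsProbabilityMeasure P]
        (Ω' : Type v) [MeasurableSpace Ω'] (P' : Measure Ω') [IsProbabilityMeasure P']
        (ξ : ℕ → Ω → ℂ) (ξ' : ℕ → Ω' → ℂ),
      RandomRoots.ConditionC1 P P' n ξ ξ' N₀ τ ε →
      RandomRoots.ConditionC2 P n ξ φ δ D k C₁ α₁
        (2 * k * C₁ + α₁ * ε / 60) (α₁ * ε / (10 ^ 5 * k ^ 2)) C →
      RandomRoots.ConditionC2 P' n ξ' φ δ D k C₁ α₁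
        (2 * k * C₁ + α₁ * ε / 60) (α₁ * ε / (10 ^ 5 * k ^ 2)) C →
      ∀ (z : Fin k → ℂ) (G : (Fin k → ℂ) → ℂ),
      (∀ j, z j ∈ D) →
      Function.support G ⊆ Set.univ.pi (fun j => Metric.ball (z j) (1 / 100)) →
      ContDiff ℝ (2 * k + 4 : ℕ) G →
      (∀ a ≤ 2 * k + 4, RandomRoots.gradSup a G ≤ 1) →
      Integrable (fun ω => RandomRoots.rootSum (RandomRoots.randomFun n ξ φ ω) G) P ∧
      Integrable (fun ω => RandomRoots.rootSum (RandomRoots.randomFun n ξ' φ ω) G) P' ∧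
      ‖(∫ ω, RandomRoots.rootSum (RandomRoots.randomFun n ξ φ ω) G ∂P) -
        ∫ ω, RandomRoots.rootSum (RandomRoots.randomFun n ξ' φ ω) G ∂P'‖ ≤ C' * δ ^ c := by
  -- The order `2 k + 2` of the moment makes up for the loss of `M ^ k = Q ^ (4 k)` in the clipping.
  obtain ⟨B, hB, hBlog⟩ := RandomRoots.exists_logMomentBound (2 * k + 1)
  set L : ℝ := 2 ^ k * ((2 * k + 1 : ℝ) ^ (2 * k) * 2) with hLdef
  set R : ℝ := L * (2 * (k * B ^ k)) + (2 * (k * (2 * k * C + C)) + L * (2 * k * C)) with hR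
  set S : ℝ := RandomRoots.exchangeConst N₀ τ k * (C ^ ε + C) + 2 * 2 ^ k * (k * (2 *
    (2 * (8 + (C / min 1 ((1 / (64 * τ)) ^ (1 / ε))) ^ 2)))) with hS
  set V : ℝ := 2 * 2 ^ k * (k * (2 * (2 * k * C + B))) with hV
  have hL0 : 0 < L := by positivity
  have hE0 := RandomRoots.exchangeConst_nonneg N₀ hτ k
  have hR0 : 0 < R := by positivity
  have hS0 : 0 ≤ S := by positivity
  have hV0 : 0 ≤ V := by positivity
  set d : ℝ := α₁ * ε / (10 ^ 5 * k ^ 2) with hd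
  have hd0 : 0 < d := by positivity
  refine ⟨2 * R + L * (S + V), min (2 * C₁) d, by positivity, by positivity, ?_⟩
  intro n δ D φ hδ hδ1 Ω _ P _ Ω' _ P' _ ξ ξ' hC1 hC2 hC2' z G hz hGsupp hGc hGd
  have hk1 : (1 : ℝ) ≤ k := by exact_mod_cast hk
  set a : ℝ := α₁ * ε with ha
  have ha0 : 0 < a := by positivity
  have haα : a ≤ α₁ := mul_le_of_le_one_right hα₁.le hε1.le
  have hdk : d * k ≤ a / 10 ^ 5 := by
    rw [hd, div_mul_eq_mul_div, div_le_div_iff₀ (by positivity) (by positivity)]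
    nlinarith [mul_pos ha0 (zero_lt_one.trans_le hk1)]
  have hda : d ≤ a / 10 ^ 5 := le_trans (le_mul_of_one_le_right hd0.le hk1) hdk
  -- The logarithms have size `Q` on the good event; they are clipped at `M = Q ^ 4`.
  obtain ⟨Q, hQ⟩ : ∃ Q, Q = δ ^ (-d) := ⟨_, rfl⟩
  have hQ1 : 1 ≤ Q := hQ ▸ Real.one_le_rpow_of_pos_of_le_one_of_nonpos hδ hδ1.le (by linarith)
  have hM1 : 1 ≤ Q ^ 4 := one_le_pow₀ hQ1
  have hM0 : 0 < Q ^ 4 := zero_lt_one.trans_le hM1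
  obtain ⟨p₀, hp₀⟩ : ∃ p₀, p₀ = 2 * k * C * δ ^ (2 * k * C₁ + a / 60) := ⟨_, rfl⟩
  obtain ⟨T, hT⟩ : ∃ T, T = δ ^ (-C₁) := ⟨_, rfl⟩
  have hG : ContDiff ℝ (2 * k : ℕ) G := hGc.of_le (by exact_mod_cast Nat.le_add_right _ _)
  have hGS : ∀ w ∉ Set.univ.pi fun j => Metric.closedBall (z j) (1 / 100), G w = 0 := fun w hw => by
    by_contra hne
    exact hw fun j hj => Metric.ball_subset_closedBall (hGsupp hne j hj)
  have hG2 := RandomRoots.norm_le_of_gradSup (hGc.of_le (by exact_mod_cast Nat.zero_le _))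
    (hGd 0 (Nat.zero_le _))
  have hGL := RandomRoots.norm_lapAll_le_of_gradSup hG fun b hb => hGd b (by omega)
  rw [← hLdef] at hGL
  obtain ⟨f, hf, hfF, hqm, hq, hfi, hfle⟩ := hC2.exists_version_rootSum_sub_clipSum_le
    hC1.left.measurable hk hδ hC hz hQ hQ1 hM0 hB hBlog hG hGS hG2 hGL hp₀ hT
  obtain ⟨f', hf', hfF', hqm', hq', hfi', hfle'⟩ := hC2'.exists_version_rootSum_sub_clipSum_le
    hC1.right.measurable hk hδ hC hz hQ hQ1 hM0 hB hBlog hG hGS hG2 hGL hp₀ hT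
  refine ⟨hfi, hfi', ?_⟩
  set q : ℂ → ℝ := fun w => P.real {ω | Q ^ 4 < |Real.log ‖f ω w‖|} +
    P'.real {ω | Q ^ 4 < |Real.log ‖f' ω w‖|} with hqdef
  have hqt : ∀ j, ∫ w in Metric.closedBall (z j) (1 / 100), q w ≤
      2 * (p₀ + B * Q ^ (2 * k + 1 + 1) / (Q ^ 4) ^ (2 * k + 1 + 1)) := fun j => by
    have hi : ∀ {g : ℂ → ℝ}, Measurable g → (∀ w, 0 ≤ g w) → (∀ w, g w ≤ 1) →
        IntegrableOn g (Metric.closedBall (z j) (1 / 100)) := fun hg h0 h1 =>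
      Measure.integrableOn_of_bounded (M := 1) (isCompact_closedBall (z j) _).measure_lt_top.ne
        hg.aestronglyMeasurable (Eventually.of_forall fun w => by
          rw [Real.norm_of_nonneg (h0 w)]
          exact h1 w)
    simp only [hqdef]
    rw [integral_add (hi hqm (fun _ => measureReal_nonneg) fun _ => measureReal_le_one)
      (hi hqm' (fun _ => measureReal_nonneg) fun _ => measureReal_le_one)]
    linarith [hq j, hq' j]
  -- The smoothing scale, relative to the standard deviation, is `δ ^ (a / 10)`.
  have hr1 : δ ^ (a / 10) ≤ 1 := Real.rpow_le_one hδ.le hδ1.le (by positivity)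
  set σ := RandomRoots.smallBallBound τ ε (C * δ ^ α₁) (δ ^ (a / 10)) with hσ
  have hσ0 : 0 ≤ σ := RandomRoots.smallBallBound_nonneg τ ε _ (by positivity)
  set X := RandomRoots.exchangeBound N₀ τ ε k (C * δ ^ α₁) (δ ^ (a / 10)) (Q ^ 4) with hX
  have hX0 : 0 ≤ X := RandomRoots.exchangeBound_nonneg N₀ hτ ε k (by positivity) (by positivity)
    hM0.le
  have hcmp : ∀ w ∈ Set.univ.pi fun j => Metric.closedBall (z j) (1 / 100),
      |(∫ ω, ∏ j, RandomRoots.clipLog (Q ^ 4) (f ω (w j)) ∂P) -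
        ∫ ω, ∏ j, RandomRoots.clipLog (Q ^ 4) (f' ω (w j)) ∂P'| ≤
      (X + 2 * (2 * Q ^ 4) ^ k * (k * (2 * σ))) + 2 * (2 * Q ^ 4) ^ k * ∑ j, q (w j) := by
    intro w hw
    have hw2 : ∀ j, w j ∈ Metric.ball (z j) 2 := fun j =>
      Metric.closedBall_subset_ball (by norm_num) (hw j trivial)
    have hwD : ∀ j, w j ∈ D + Metric.ball (0 : ℂ) 1 := fun j =>
      Set.mem_add.2 ⟨z j, hz j, w j - z j, by
        have := Metric.closedBall_subset_ball (show (1 / 100 : ℝ) < 1 by norm_num) (hw j trivial)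
        rwa [mem_ball_zero_iff, ← mem_ball_iff_norm], by ring⟩
    have hdel := fun j => hC2.delocalization _ (hwD j)
    refine (hC1.abs_integral_clipLog_sub_le hτ hε0 hε1.le
      (fun j => (hfF j _ (hw2 j)).mono fun _ h => h.1)
      (fun j => (hfF' j _ (hw2 j)).mono fun _ h => h.1) (fun j => (hdel j).1)
      (η := C * δ ^ α₁) (by positivity) (fun j i => (hdel j).2 i i.2) (r := δ ^ (a / 10))
      (by positivity) hr1 hM1
      (fun j => RandomRoots.measurable_apply_of_uncurry hf (w j))
      (fun j => (hfF j _ (hw2 j)).mono fun _ h => h.2)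
      (fun j => RandomRoots.measurable_apply_of_uncurry hf' (w j))
      (fun j => (hfF' j _ (hw2 j)).mono fun _ h => h.2)).trans (le_of_eq ?_)
    rw [Finset.sum_add_distrib, Finset.sum_const, Finset.card_univ, Fintype.card_fin, nsmul_eq_mul]
    ring
  have hmid := RandomRoots.norm_integral_clipSum_sub_le hf hf' hM0.le (by positivity)
    (by positivity) hG hGS hGL (hqm.add hqm')
    (fun w => add_nonneg measureReal_nonneg measureReal_nonneg)
    (fun w => add_le_add measureReal_le_one measureReal_le_one) hqt hcmp
  have hbound : ‖(∫ ω, RandomRoots.rootSum (RandomRoots.randomFun n ξ φ ω) G ∂P) -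
      ∫ ω, RandomRoots.rootSum (RandomRoots.randomFun n ξ' φ ω) G ∂P'‖ ≤ _ :=
    (norm_sub_le_norm_sub_add_norm_sub _ (∫ ω, RandomRoots.clipSum (Q ^ 4) (f ω) G ∂P) _).trans
      (add_le_add hfle ((norm_sub_le_norm_sub_add_norm_sub _
        (∫ ω, RandomRoots.clipSum (Q ^ 4) (f' ω) G ∂P') _).trans
        (add_le_add hmid ((norm_sub_rev _ _).trans_le hfle'))))
  refine hbound.trans ?_
  set x : ℝ := δ ^ min (2 * C₁) d with hx
  have hdx : δ ^ d ≤ x := Real.rpow_le_rpow_of_exponent_ge hδ hδ1.le (min_le_right _ _)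
  have hQx : Q⁻¹ ≤ x := by rwa [hQ, Real.rpow_neg hδ.le, inv_inv]
  have hTx : (T ^ 2)⁻¹ ≤ x := by
    rw [hT, ← Real.rpow_mul_natCast hδ.le, ← Real.rpow_neg hδ.le]
    refine Real.rpow_le_rpow_of_exponent_ge hδ hδ1.le ((min_le_left _ _).trans (le_of_eq ?_))
    push_cast
    ring
  -- Each error term is at most a constant times `x`.
  have hp := RandomRoots.pow_mul_rpow_le hδ hδ1 hd0 hda hdk hC₁
  have hkC : 0 ≤ 2 * k * C := by positivity
  have hx0 : 0 < x := by positivity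
  have e1 : Q ^ (k + (2 * k + 1)) / (Q ^ 4) ^ (2 * k + 1) ≤ x :=
    (RandomRoots.pow_div_pow_four_le_inv hQ1 (by omega)).trans hQx
  have e2 : T ^ k * p₀ ≤ 2 * k * C * x := by
    rw [hp₀, mul_left_comm, hT]
    exact mul_le_mul_of_nonneg_left (hp.2.trans hdx) hkC
  have e3 : (Q ^ 4) ^ k * p₀ ≤ 2 * k * C * x := by
    rw [hp₀, mul_left_comm, hQ]
    exact mul_le_mul_of_nonneg_left (hp.1.trans hdx) hkC
  have e4 : (Q ^ 4) ^ k * (Q ^ (2 * k + 1 + 1) / (Q ^ 4) ^ (2 * k + 1 + 1)) ≤ x := by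
    rw [← mul_div_assoc, ← pow_mul, ← pow_add]
    exact (RandomRoots.pow_div_pow_four_le_inv hQ1 (by omega)).trans hQx
  have e5 : (Q ^ 4) ^ k * σ ≤ _ * x :=
    (hQ ▸ RandomRoots.pow_mul_smallBallBound_le hδ hδ1 hd0 hda hdk haα).trans
      (mul_le_mul_of_nonneg_left hdx (by positivity))
  have e6 : X ≤ _ * x :=
    (hX.trans_le (hQ ▸ RandomRoots.exchangeBound_le hδ hδ1 hd0 hda hdk hτ hC ha haα N₀)).trans
      (mul_le_mul_of_nonneg_left hdx (by positivity))
  have hR' : L * (2 * (k * (B ^ k * (Q ^ (k + (2 * k + 1)) / (Q ^ 4) ^ (2 * k + 1))))) +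
      (2 * (k * (T ^ k * p₀ + (T ^ 2)⁻¹ * C)) + L * (Q ^ 4) ^ k * p₀) ≤ R * x := by
    calc _ ≤ L * (2 * (k * (B ^ k * x))) +
          (2 * (k * (2 * k * C * x + x * C)) + L * (2 * k * C * x)) := by
          rw [mul_assoc L ((Q ^ 4) ^ k)]
          gcongr
      _ = R * x := by rw [hR]; ring
  have hmid' : L * (X + 2 * (2 * Q ^ 4) ^ k * (k * (2 * σ)) + 2 * (2 * Q ^ 4) ^ k *
      (k * (2 * (p₀ + B * Q ^ (2 * k + 1 + 1) / (Q ^ 4) ^ (2 * k + 1 + 1))))) ≤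
      L * (S + V) * x := by
    rw [mul_assoc L]
    refine mul_le_mul_of_nonneg_left ?_ hL0.le
    calc _ = X + 2 * 2 ^ k * (k * (2 * ((Q ^ 4) ^ k * σ))) + 2 * 2 ^ k * (k * (2 * ((Q ^ 4) ^ k * p₀ +
          B * ((Q ^ 4) ^ k * (Q ^ (2 * k + 1 + 1) / (Q ^ 4) ^ (2 * k + 1 + 1)))))) := by
          rw [mul_pow 2 (Q ^ 4) k]
          ring
      _ ≤ RandomRoots.exchangeConst N₀ τ k * (C ^ ε + C) * x + 2 * 2 ^ k * (k * (2 *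
          (2 * (8 + (C / min 1 ((1 / (64 * τ)) ^ (1 / ε))) ^ 2) * x))) +
          2 * 2 ^ k * (k * (2 * (2 * k * C * x + B * x))) := by gcongr
      _ = (S + V) * x := by rw [hS, hV]; ring
  linarith
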